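/- Let $q\in L^2(\mathbb R)$ be real valued with $\int_{\mathbb R}(1+|x|)|q(x)|\,dx<\infty$ and let $M=\begin{pmatrix}m_{11}&m_{12}\\ m_{21}&m_{22}\end{pmatrix}$ be a real matrix with $\det M=1$. Consider $$-y''+q y=\zeta^2 y\ \text{ on } (-\infty,0)\cup(0,\infty),\qquad \begin{pmatrix}y(0^+)\\ y'(0^+)\end{pmatrix}=M\begin{pmatrix}y(0^-)\\ y'(0^-)\end{pmatrix},\qquad(*)$$ and let $L$ be the operator $Ly=-y''+qy$ in $L^2(\mathbb R)$ whose domain consists of the $y\in L^2(\mathbb R)$ with $-y''+qy\in L^2(\mathbb R)$, with $y,y'$ locally absolutely continuous on $(-\infty,0)$ and on $(0,\infty)$, and satisfying the transfer condition in $(*)$. For $\operatorname{Im}\zeta\ge 0$ let $f_{\pm,M}(\cdot,\zeta)$ be the Jost solutions, i.e. the solutions of $(*)$ with $e^{-i\zeta x}f_{+,M}(x,\zeta)\to1$ as $x\to\infty$ and $e^{i\zeta x}f_{-,M}(x,\zeta)\to1$ as $x\to-\infty$. For real $\xi\ne0$ let $A(\xi),B(\xi)$ be the unique coefficients with $$f_{-,M}(x,\xi)=A(\xi)\overline{f_{+,M}(x,\xi)}+B(\xi)f_{+,M}(x,\xi)\quad(x\neq0),$$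 let $R(\xi)=B(\xi)/A(\xi)$ be the reflection coefficient, and let $A(\zeta)=\frac{1}{2i\zeta}\bigl(f_{-,M}f_{+,M}'-f_{-,M}'f_{+,M}\bigr)(\cdot,\zeta)$ be the analytic continuation of $A$ to $\operatorname{Im}\zeta>0$. Then $L$ has only finitely many eigenvalues, and they are $-\eta_1^2,\dots,-\eta_N^2$ for some $N\ge0$ and $0<\eta_1<\dots<\eta_N$. Moreover: 1. (Reflectionless case.) If $R(\xi)=0$ for all real $\xi\neq0$, then for some sign $s\in\{1,-1\}$ $$M=\begin{pmatrix}s&0\\ m_{21}&s\end{pmatrix}\quad\text{and}\quad A(\zeta)=s\prod_{j=1}^N\frac{\zeta-i\eta_j}{\zeta+i\eta_j}\qquad(\operatorname{Im}\zeta\ge0,\ \zeta\ne0).$$ 2. If $m_{12}=0$, then $\lim_{\xi\to\infty}R(\xi)$ exists and is real; put $C_2=-\lim_{\xi\to\infty}R(\xi)$. Then $|C_2|<1$. If in addition $|R(\xi)|=|C_2|$ for all real $\xi\ne0$, then for some sign $s\in\{1,-1\}$ $$m_{22}=s\sqrt{\frac{1+C_2}{1-C_2}},\qquad m_{11}=s\sqrt{\frac{1-C_2}{1+C_2}},$$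 $$A(\zeta)=\frac{s}{\sqrt{1-C_2^2}}\prod_{j=1}^N\frac{\zeta-i\eta_j}{\zeta+i\eta_j}\qquad(\operatorname{Im}\zeta\ge0,\ \zeta\ne0).$$ -/

import Mathlib

open Filter Topology MeasureTheory

noncomputable section

namespace PointTransfer

/-- The differential expression `ℓ y = -y'' + q y` (meaningful almost everywhere when `y'` is
locally absolutely continuous). -/
def ell (q : ℝ → ℝ) (y : ℝ → ℂ) (x : ℝ) : ℂ :=
  -(deriv (deriv y) x) + (q x : ℂ) * y x

/-- `y` is differentiable off the origin, and `y`, `y'` are absolutely continuous on every compact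
interval contained in `(-∞,0)` or in `(0,∞)`. -/
def IsACOffZero (y : ℝ → ℂ) : Prop :=
  (∀ x : ℝ, x ≠ 0 → DifferentiableAt ℝ y x) ∧
  ∀ a b : ℝ, a ≤ b → (0 < a ∨ b < 0) →
    AbsolutelyContinuousOnInterval y a b ∧ AbsolutelyContinuousOnInterval (deriv y) a b

/-- The point transfer condition `(y(0⁺), y'(0⁺))ᵀ = M (y(0⁻), y'(0⁻))ᵀ`; the existence of the
four one-sided limits is part of the condition. -/
def TransferCondition (M : Matrix (Fin 2) (Fin 2) ℝ) (y : ℝ → ℂ) : Prop :=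
  ∃ u₀ u₁ v₀ v₁ : ℂ,
    Tendsto y (𝓝[<] 0) (𝓝 u₀) ∧ Tendsto (deriv y) (𝓝[<] 0) (𝓝 u₁) ∧
    Tendsto y (𝓝[>] 0) (𝓝 v₀) ∧ Tendsto (deriv y) (𝓝[>] 0) (𝓝 v₁) ∧
    v₀ = (M 0 0 : ℂ) * u₀ + (M 0 1 : ℂ) * u₁ ∧
    v₁ = (M 1 0 : ℂ) * u₀ + (M 1 1 : ℂ) * u₁

/-- The domain of the operator `L y = ℓ y` in `L²(ℝ)` with the transfer condition at the origin. -/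
def domL (q : ℝ → ℝ) (M : Matrix (Fin 2) (Fin 2) ℝ) : Set (ℝ → ℂ) :=
  {y | MemLp y 2 volume ∧ MemLp (ell q y) 2 volume ∧ IsACOffZero y ∧ TransferCondition M y}

/-- `lam` is an eigenvalue of the operator `L`. -/
def IsEigenvalueL (q : ℝ → ℝ) (M : Matrix (Fin 2) (Fin 2) ℝ) (lam : ℂ) : Prop :=
  ∃ y ∈ domL q M, ¬ (y =ᵐ[volume] 0) ∧ ∀ᵐ x ∂volume, ell q y x = lam * y x

/-- `y` solves `ℓ y = ζ² y` on `(-∞,0) ∪ (0,∞)` and obeys the transfer condition. -/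
def IsSolution (q : ℝ → ℝ) (M : Matrix (Fin 2) (Fin 2) ℝ) (ζ : ℂ) (y : ℝ → ℂ) : Prop :=
  IsACOffZero y ∧ TransferCondition M y ∧ ∀ᵐ x ∂volume, ell q y x = ζ ^ 2 * y x

/-- `f` is the right Jost solution at `ζ`: a solution with `e^{-iζx} f(x) → 1` as `x → ∞`. -/
def IsJostPlus (q : ℝ → ℝ) (M : Matrix (Fin 2) (Fin 2) ℝ) (ζ : ℂ) (f : ℝ → ℂ) : Prop :=
  IsSolution q M ζ f ∧
    Tendsto (fun x : ℝ => Complex.exp (-(Complex.I * ζ * x)) * f x) atTop (𝓝 1)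

/-- `f` is the left Jost solution at `ζ`: a solution with `e^{iζx} f(x) → 1` as `x → -∞`. -/
def IsJostMinus (q : ℝ → ℝ) (M : Matrix (Fin 2) (Fin 2) ℝ) (ζ : ℂ) (f : ℝ → ℂ) : Prop :=
  IsSolution q M ζ f ∧
    Tendsto (fun x : ℝ => Complex.exp (Complex.I * ζ * x) * f x) atBot (𝓝 1)

/-- The Jost solution `f_{+,M}(·, ζ)`. For `Im ζ ≥ 0` (the only case used) the defining property
determines it at every `x ≠ 0`; its value at `x = 0` is never used. -/
def jostPlus (q : ℝ → ℝ) (M : Matrix (Fin 2) (Fin 2) ℝ) (ζ : ℂ) : ℝ → ℂ :=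
  Classical.epsilon (IsJostPlus q M ζ)

/-- The Jost solution `f_{-,M}(·, ζ)`. For `Im ζ ≥ 0` (the only case used) the defining property
determines it at every `x ≠ 0`; its value at `x = 0` is never used. -/
def jostMinus (q : ℝ → ℝ) (M : Matrix (Fin 2) (Fin 2) ℝ) (ζ : ℂ) : ℝ → ℂ :=
  Classical.epsilon (IsJostMinus q M ζ)

/-- The unique pair `(A(ξ), B(ξ))` with
`f_{-,M}(x,ξ) = A(ξ) * conj (f_{+,M}(x,ξ)) + B(ξ) * f_{+,M}(x,ξ)` for all `x ≠ 0`,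
for real `ξ ≠ 0`. -/
def scatteringPair (q : ℝ → ℝ) (M : Matrix (Fin 2) (Fin 2) ℝ) (ξ : ℝ) : ℂ × ℂ :=
  Classical.epsilon fun p : ℂ × ℂ => ∀ x : ℝ, x ≠ 0 →
    jostMinus q M ξ x = p.1 * (starRingEnd ℂ) (jostPlus q M ξ x) + p.2 * jostPlus q M ξ x

/-- The Wronskian `f g' - f' g` at `x`. -/
def wronskian (f g : ℝ → ℂ) (x : ℝ) : ℂ := f x * deriv g x - deriv f x * g x

/-- The scattering coefficient `A`. On the real line it is the coefficient in the connection
formula above. In the upper half-plane it is the analytic continuation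
`A(ζ) = (f_{-,M} f_{+,M}' - f_{-,M}' f_{+,M}) / (2iζ)`; the Wronskian does not depend on the point
`x > 0` (nor on the side of the origin, if `det M = 1`) and is evaluated at `x = 1`. For real
`ζ ≠ 0` the same formula returns the connection coefficient. -/
def coeffA (q : ℝ → ℝ) (M : Matrix (Fin 2) (Fin 2) ℝ) (ζ : ℂ) : ℂ :=
  open Classical in
  if ζ.im = 0 then (scatteringPair q M ζ.re).1
  else wronskian (jostMinus q M ζ) (jostPlus q M ζ) 1 / (2 * Complex.I * ζ)

/-- The scattering coefficient `B(ξ)`, for real `ξ ≠ 0`. -/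
def coeffB (q : ℝ → ℝ) (M : Matrix (Fin 2) (Fin 2) ℝ) (ξ : ℝ) : ℂ := (scatteringPair q M ξ).2

/-- The reflection coefficient `R(ξ) = B(ξ) / A(ξ)`, for real `ξ ≠ 0`. -/
def reflection (q : ℝ → ℝ) (M : Matrix (Fin 2) (Fin 2) ℝ) (ξ : ℝ) : ℂ :=
  coeffB q M ξ / coeffA q M ξ

end PointTransfer

end

open PointTransfer

namespace PointTransfer
open Set

/-! ### Absolutely continuous functions with complex values -/

/-! Reflecting the left half-line turns the problem into two equations on `(0,∞)`, coupled at the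
origin by `M`. On a half-line the Jost solution is `e^{iζx} m(x,ζ)`, where `m` is the Neumann series
of a Volterra equation. By `jostTerm_spec` its `k`-th term is at most `tailMoment ^ k / k!`,
uniformly in `Im ζ ≥ 0`; this gives continuity up to the real axis, holomorphy inside, and, with the
integrated equation, the limits as `|ζ| → ∞`. The central object is `W = jostW`, the Wronskian at
`0⁺` of the two Jost solutions, with `A = W/(2iζ)`.

Self-adjointness enters through the flux `Im(y' ȳ)`, which a real matrix of determinant one
preserves. Inserted in the identity `norm_sq_wedge`, it gives `|A|² = 1 + |B|²` on the real axis,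
and in the open upper half-plane the bound `|W(ζ)| ≥ |Re ζ| e^{-X Im ζ}/2` of
`exists_le_norm_jostW`. Hence zeros of `W` lie on the imaginary axis and are simple. A zero is
exactly a place where the two decaying solutions match at the origin, that is, an eigenvalue
(`isEigenvalueL_iff`). Zeros cannot accumulate at `∞`, where `W` has a nonzero leading coefficient,
nor at `0`, where `W` vanishes at most to first order (`exists_low_energy_bound`); so there are
finitely many.

If `|A|` is constant on the real axis and `m₁₂ = 0`, dividing `A` by the Blaschke product of its
zeros leaves a zero-free function with boundary values of constant modulus and a finite nonzero
limit `(m₁₁ + m₂₂)/2` at infinity. Phragmén–Lindelöf applied to it and to its reciprocal shows that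
it is constant (`eq_blaschke`).

The matrix is read off at high energy. If `R = 0` then `|W(ξ)| = 2|ξ|`, while `W(ξ)/ξ² → m₁₂`, so
`m₁₂ = 0`; moreover `B → (m₁₁ - m₂₂)/2` forces `m₁₁ = m₂₂`. If `m₁₂ = 0` then `R → (m₁₁ - m₂₂)/(m₁₁
+ m₂₂)`, which with `m₁₁ m₂₂ = 1` determines the diagonal up to sign; constancy of `|R|` makes `|A|`
constant through `|A|² (1 - |R|²) = 1`. -/

theorem aci_clm {E F : Type*} [NormedAddCommGroup E] [NormedSpace ℝ E] [NormedAddCommGroup F]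
    [NormedSpace ℝ F] (L : E →L[ℝ] F) {f : ℝ → E} {a b : ℝ}
    (hf : AbsolutelyContinuousOnInterval f a b) :
    AbsolutelyContinuousOnInterval (fun x => L (f x)) a b := by
  refine squeeze_zero (g := fun E => ‖L‖ * ∑ i ∈ Finset.range E.1, dist (f (E.2 i).1) (f (E.2 i).2))
    (fun t => Finset.sum_nonneg (fun i hi => by positivity)) (fun t => ?_)
    (by simpa using Tendsto.const_mul ‖L‖ hf)
  rw [Finset.mul_sum]
  refine Finset.sum_le_sum fun i _ => ?_
  rw [dist_eq_norm, dist_eq_norm, ← map_sub]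
  exact L.le_opNorm _

theorem aci_const {E : Type*} [NormedAddCommGroup E] (c : E) (a b : ℝ) :
    AbsolutelyContinuousOnInterval (fun _ : ℝ => c) a b := by
  simpa [AbsolutelyContinuousOnInterval] using tendsto_const_nhds

theorem aci_mul {f g : ℝ → ℂ} {a b : ℝ} (hf : AbsolutelyContinuousOnInterval f a b)
    (hg : AbsolutelyContinuousOnInterval g a b) :
    AbsolutelyContinuousOnInterval (fun x => f x * g x) a b :=
  hf.smul hg

theorem aci_congr {E : Type*} [NormedAddCommGroup E] {f g : ℝ → E} {a b : ℝ}
    (hf : AbsolutelyContinuousOnInterval f a b) (h : ∀ x ∈ uIcc a b, f x = g x) :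
    AbsolutelyContinuousOnInterval g a b := by
  refine Tendsto.congr' ?_ hf
  filter_upwards [mem_inf_of_right (mem_principal_self _)] with E hE
  refine Finset.sum_congr rfl fun i hi => ?_
  rw [h _ (hE.1 i hi).1, h _ (hE.1 i hi).2]

theorem aci_comp_neg {E : Type*} [NormedAddCommGroup E] {f : ℝ → E} {a b : ℝ}
    (hf : AbsolutelyContinuousOnInterval f a b) :
    AbsolutelyContinuousOnInterval (fun x => f (-x)) (-a) (-b) := by
  rw [absolutelyContinuousOnInterval_iff] at hf ⊢
  intro ε hε
  obtain ⟨δ, hδ, H⟩ := hf ε hε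
  refine ⟨δ, hδ, fun I hI hs => ?_⟩
  -- Reflection reverses orientation, so each interval is sent to its mirror image with the
  -- endpoints exchanged.
  have key := H (I.1, fun i => (-(I.2 i).2, -(I.2 i).1)) ?_ ?_
  · simpa [dist_comm] using key
  · have mem : ∀ x : ℝ, x ∈ uIcc (-a) (-b) → -x ∈ uIcc a b := by
      intro x hx
      have : uIcc (-a) (-b) = Neg.neg ⁻¹' uIcc a b := by simp
      rw [this] at hx
      exact hx
    refine ⟨fun i hi => ⟨mem _ (hI.1 i hi).2, mem _ (hI.1 i hi).1⟩, ?_⟩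
    intro i hi j hj hij
    have := hI.2 hi hj hij
    simp only [Function.onFun, uIoc] at this ⊢
    rw [Set.disjoint_iff_inter_eq_empty, Set.Ioc_inter_Ioc, Set.Ioc_eq_empty_iff, not_lt] at this ⊢
    rw [min_neg_neg, max_neg_neg, min_neg_neg, max_neg_neg]
    rw [max_neg_neg, min_neg_neg]
    grind
  · simpa [dist_comm] using hs

theorem aci_primitive {g : ℝ → ℂ} {a b c : ℝ} (h : IntervalIntegrable g volume a b)
    (hc : c ∈ uIcc a b) : AbsolutelyContinuousOnInterval (fun x => ∫ v in c..x, g v) a b := by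
  have hre : IntervalIntegrable (fun x => (g x).re) volume a b := ⟨h.1.re, h.2.re⟩
  have him : IntervalIntegrable (fun x => (g x).im) volume a b := ⟨h.1.im, h.2.im⟩
  have h1 := aci_clm Complex.ofRealCLM (hre.absolutelyContinuousOnInterval_intervalIntegral hc)
  have h2 := aci_clm Complex.ofRealCLM (him.absolutelyContinuousOnInterval_intervalIntegral hc)
  refine aci_congr (h1.add (aci_mul (aci_const Complex.I a b) h2)) fun x hx => ?_
  have hsub : uIcc c x ⊆ uIcc a b := uIcc_subset_uIcc hc hx
  have hg : IntervalIntegrable g volume c x := h.mono_set hsub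
  apply Complex.ext
  · have := intervalIntegral.intervalIntegral_eq_integral_uIoc g c x volume
    simp only [Pi.add_apply, Complex.ofRealCLM_apply, Complex.add_re, Complex.ofReal_re,
      Complex.mul_re, Complex.I_re, Complex.I_im, Complex.ofReal_im]
    simpa using Complex.reCLM.intervalIntegral_comp_comm hg
  · simp only [Pi.add_apply, Complex.ofRealCLM_apply, Complex.add_im, Complex.ofReal_im,
      Complex.mul_im, Complex.I_re, Complex.I_im, Complex.ofReal_re]
    simpa using Complex.imCLM.intervalIntegral_comp_comm hg

/-- The difference of `f` and a primitive of `f'` is absolutely continuous with derivative zero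
almost everywhere, hence constant. -/
theorem aci_integral_eq_sub {f f' : ℝ → ℂ} {a b : ℝ} (hf : AbsolutelyContinuousOnInterval f a b)
    (h : ∀ᵐ x, x ∈ uIcc a b → HasDerivAt f (f' x) x) (hi : IntervalIntegrable f' volume a b) :
    ∫ x in a..b, f' x = f b - f a := by
  obtain ⟨C, hC⟩ := (hf.sub (aci_primitive hi left_mem_uIcc)).const_of_ae_hasDerivAt_zero (by
    filter_upwards [h, hi.ae_hasDerivAt_integral] with x h1 h2 hx
    simpa using! (h1 hx).sub (h2 hx a left_mem_uIcc))
  have h1 := hC a left_mem_uIcc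
  have h2 := hC b right_mem_uIcc
  simp only [Pi.sub_apply, intervalIntegral.integral_same, sub_zero] at h1 h2
  rw [h1, ← h2]; ring

theorem aci_ae_differentiableAt {f : ℝ → ℂ} {a b : ℝ} (hf : AbsolutelyContinuousOnInterval f a b) :
    ∀ᵐ x, x ∈ uIcc a b → DifferentiableAt ℝ f x :=
  hf.boundedVariationOn.ae_differentiableAt_of_mem_uIcc

theorem aci_of_hasDerivAt {f f' : ℝ → ℂ} {a b : ℝ} (h : ∀ x ∈ uIcc a b, HasDerivAt f (f' x) x)
    (hc : ContinuousOn f' (uIcc a b)) : AbsolutelyContinuousOnInterval f a b := by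
  have hi : IntervalIntegrable f' volume a b := hc.intervalIntegrable
  refine aci_congr ((aci_const (f a) a b).add (aci_primitive hi left_mem_uIcc)) fun x hx => ?_
  have hsub : uIcc a x ⊆ uIcc a b := uIcc_subset_uIcc left_mem_uIcc hx
  rw [Pi.add_apply, intervalIntegral.integral_eq_sub_of_hasDerivAt (fun t ht => h t (hsub ht))
    (hi.mono_set hsub)]
  ring

/-! ### Solutions on the positive half-line -/

/-- `y'' = V y` on `(0,∞)`, in the sense of Carathéodory. -/
structure HalfSol (V : ℝ → ℂ) (y : ℝ → ℂ) : Prop where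
  diff : ∀ x, 0 < x → DifferentiableAt ℝ y x
  ac : ∀ a b, 0 < a → a ≤ b → AbsolutelyContinuousOnInterval y a b
  ac_deriv : ∀ a b, 0 < a → a ≤ b → AbsolutelyContinuousOnInterval (deriv y) a b
  eq : ∀ᵐ x, 0 < x → deriv (deriv y) x = V x * y x

namespace HalfSol

variable {V U : ℝ → ℂ} {y z : ℝ → ℂ}

theorem continuousOn (h : HalfSol V y) : ContinuousOn y (Ioi 0) :=
  fun x hx => (h.diff x hx).continuousAt.continuousWithinAt

theorem continuousAt_deriv (h : HalfSol V y) {x : ℝ} (hx : 0 < x) : ContinuousAt (deriv y) x := by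
  have h1 := (h.ac_deriv (x / 2) (x + 1) (by linarith) (by linarith)).continuousOn
  exact h1.continuousAt (by rw [uIcc_of_le (by linarith)]; exact Icc_mem_nhds (by linarith) (by linarith))

theorem continuousOn_deriv (h : HalfSol V y) : ContinuousOn (deriv y) (Ioi 0) :=
  fun _ hx => (h.continuousAt_deriv hx).continuousWithinAt

theorem ae_hasDerivAt (h : HalfSol V y) :
    ∀ᵐ x, 0 < x → HasDerivAt (deriv y) (V x * y x) x := by
  -- Absolute continuity is available only on compact intervals, so `(0,∞)` is exhausted by the
  -- intervals `[1/(n+1), n+1]`.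
  have h1 : ∀ n : ℕ, ∀ᵐ x, x ∈ uIcc (1 / (n + 1 : ℝ)) (n + 1) → DifferentiableAt ℝ (deriv y) x := by
    intro n
    refine aci_ae_differentiableAt (h.ac_deriv _ _ (by positivity) ?_)
    rw [div_le_iff₀ (by positivity)]
    nlinarith [(Nat.cast_nonneg n : (0 : ℝ) ≤ n)]
  filter_upwards [ae_all_iff.2 h1, h.eq] with x hx he h0
  obtain ⟨n, hn⟩ := exists_nat_gt (max x (1 / x))
  have hn1 : x < n := (le_max_left _ _).trans_lt hn
  have hn2 : 1 / x < n := (le_max_right _ _).trans_lt hn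
  have := hx n (by
    rw [uIcc_of_le]
    · refine ⟨?_, by linarith⟩
      rw [div_le_iff₀ (by positivity)]
      rw [div_lt_iff₀ h0] at hn2
      nlinarith
    · rw [div_le_iff₀ (by positivity)]
      nlinarith [(Nat.cast_nonneg n : (0 : ℝ) ≤ n)])
  rw [← he h0]
  exact this.hasDerivAt

theorem add (h : HalfSol V y) (h' : HalfSol V z) : HalfSol V (fun x => y x + z x) := by
  have e : ∀ x, 0 < x → deriv (fun x => y x + z x) x = deriv y x + deriv z x := fun x hx =>
    deriv_add (h.diff x hx) (h'.diff x hx)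
  refine ⟨fun x hx => (h.diff x hx).add (h'.diff x hx), fun a b ha hab =>
    (h.ac a b ha hab).add (h'.ac a b ha hab), fun a b ha hab =>
    aci_congr ((h.ac_deriv a b ha hab).add (h'.ac_deriv a b ha hab)) fun x hx => ?_, ?_⟩
  · rw [uIcc_of_le hab] at hx
    exact (e x (ha.trans_le hx.1)).symm
  · filter_upwards [h.ae_hasDerivAt, h'.ae_hasDerivAt] with x h1 h2 hx
    have : deriv (fun x => y x + z x) =ᶠ[𝓝 x] fun x => deriv y x + deriv z x := by
      filter_upwards [Ioi_mem_nhds hx] with t ht using e t ht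
    rw [this.deriv_eq]
    refine (((h1 hx).add (h2 hx)).deriv).trans ?_
    ring

theorem const_mul (h : HalfSol V y) (c : ℂ) : HalfSol V (fun x => c * y x) := by
  have e : ∀ x, deriv (fun x => c * y x) x = c * deriv y x := fun x => deriv_const_mul_field _
  refine ⟨fun x hx => (h.diff x hx).const_mul c, fun a b ha hab =>
    aci_mul (aci_const c a b) (h.ac a b ha hab), fun a b ha hab =>
    aci_congr (aci_mul (aci_const c a b) (h.ac_deriv a b ha hab)) fun x _ => (e x).symm, ?_⟩
  filter_upwards [h.eq] with x h1 hx
  rw [funext e, deriv_const_mul_field, h1 hx]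
  ring

theorem congr (h : HalfSol V y) (hz : ∀ x, 0 < x → y x = z x) : HalfSol V z := by
  have e : ∀ x, 0 < x → y =ᶠ[𝓝 x] z := fun x hx => by
    filter_upwards [Ioi_mem_nhds hx] with t ht using hz t ht
  refine ⟨fun x hx => (h.diff x hx).congr_of_eventuallyEq (e x hx).symm, fun a b ha hab =>
    aci_congr (h.ac a b ha hab) fun x hx => ?_, fun a b ha hab =>
    aci_congr (h.ac_deriv a b ha hab) fun x hx => ?_, ?_⟩
  · rw [uIcc_of_le hab] at hx
    exact hz x (ha.trans_le hx.1)
  · rw [uIcc_of_le hab] at hx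
    exact (e x (ha.trans_le hx.1)).deriv_eq
  · filter_upwards [h.eq] with x h1 hx
    rw [← hz x hx, ← h1 hx, (e x hx).symm.deriv.deriv_eq]

theorem congr_potential (h : HalfSol V y) (hV : ∀ᵐ x, 0 < x → V x = U x) : HalfSol U y := by
  refine ⟨h.diff, h.ac, h.ac_deriv, ?_⟩
  filter_upwards [h.eq, hV] with x h1 h2 hx
  rw [h1 hx, h2 hx]

theorem conj (h : HalfSol V y) :
    HalfSol (fun x => (starRingEnd ℂ) (V x)) (fun x => (starRingEnd ℂ) (y x)) := by
  have e : ∀ x, deriv (fun x => (starRingEnd ℂ) (y x)) x = (starRingEnd ℂ) (deriv y x) :=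
    fun x => deriv.star (f := y)
  refine ⟨fun x hx => (h.diff x hx).star, fun a b ha hab =>
    aci_clm (Complex.conjCLE : ℂ →L[ℝ] ℂ) (h.ac a b ha hab), fun a b ha hab =>
    aci_congr (aci_clm (Complex.conjCLE : ℂ →L[ℝ] ℂ) (h.ac_deriv a b ha hab)) fun x _ =>
      (e x).symm, ?_⟩
  filter_upwards [h.eq] with x h1 hx
  rw [funext e]
  rw [← map_mul, ← h1 hx]
  exact deriv.star (f := deriv y)

/-- Lagrange's identity for two Sturm–Liouville equations. -/
theorem lagrange (h : HalfSol V y) (h' : HalfSol U z) {a b : ℝ} (ha : 0 < a) (hab : a ≤ b)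
    (hV : IntervalIntegrable (fun x => U x - V x) volume a b) :
    ∫ x in a..b, (U x - V x) * (y x * z x) = wronskian y z b - wronskian y z a := by
  have hsub : uIcc a b ⊆ Ioi 0 := by
    rw [uIcc_of_le hab]
    exact fun x hx => ha.trans_le hx.1
  refine aci_integral_eq_sub (f := wronskian y z) ?_ ?_ ?_
  · exact (aci_mul (h.ac a b ha hab) (h'.ac_deriv a b ha hab)).sub
      (aci_mul (h.ac_deriv a b ha hab) (h'.ac a b ha hab))
  · filter_upwards [h.ae_hasDerivAt, h'.ae_hasDerivAt] with x h1 h2 hx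
    have hx := hsub hx
    have := ((h.diff x hx).hasDerivAt.mul (h2 hx)).sub ((h1 hx).mul (h'.diff x hx).hasDerivAt)
    refine this.congr_deriv ?_
    ring
  · exact hV.mul_continuousOn ((h.continuousOn.mono hsub).mul (h'.continuousOn.mono hsub))

theorem wronskian_eq (h : HalfSol V y) (h' : HalfSol V z) {a b : ℝ} (ha : 0 < a) (hb : 0 < b) :
    wronskian y z a = wronskian y z b := by
  wlog hab : a ≤ b generalizing a b
  · exact (this hb ha (le_of_not_ge hab)).symm
  have := h.lagrange h' ha hab (by simp)
  simp only [sub_self, zero_mul, intervalIntegral.integral_zero] at this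
  exact (sub_eq_zero.1 this.symm).symm

end HalfSol

/-! ### Tails of integrals -/

section Tail

variable {E : Type*} [NormedAddCommGroup E] [NormedSpace ℝ E] {g : ℝ → E}

theorem intervalIntegrable_of_tail {E : Type*} [NormedAddCommGroup E] {g : ℝ → E}
    (hg : ∀ x, IntegrableOn g (Ioi x)) (a b : ℝ) : IntervalIntegrable g volume a b := by
  rw [intervalIntegrable_iff]
  exact (hg (min a b)).mono_set fun t ht => ht.1

/-- Tails are rewritten as a constant minus a primitive, so that facts about primitives transfer to
them. -/
theorem tail_eq (hg : ∀ x, IntegrableOn g (Ioi x)) (a s : ℝ) :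
    ∫ t in Ioi s, g t = (∫ t in Ioi a, g t) - ∫ t in a..s, g t := by
  rw [← intervalIntegral.integral_Ioi_sub_Ioi' (hg a) (hg s)]
  abel

theorem continuous_tail (hg : ∀ x, IntegrableOn g (Ioi x)) :
    Continuous fun s => ∫ t in Ioi s, g t := by
  rw [funext (tail_eq hg 0)]
  exact continuous_const.sub
    (intervalIntegral.continuous_primitive (fun a b => intervalIntegrable_of_tail hg a b) 0)

theorem tendsto_tail (hg : ∀ x, IntegrableOn g (Ioi x)) :
    Tendsto (fun s => ∫ t in Ioi s, g t) atTop (𝓝 0) := by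
  rw [funext (tail_eq hg 0), ← sub_self (∫ t in Ioi (0 : ℝ), g t)]
  exact tendsto_const_nhds.sub (intervalIntegral_tendsto_integral_Ioi 0 (hg 0) tendsto_id)

theorem hasDerivAt_tail [CompleteSpace E] (hg : ∀ x, IntegrableOn g (Ioi x)) (hc : Continuous g)
    (s : ℝ) : HasDerivAt (fun s => ∫ t in Ioi s, g t) (-g s) s := by
  rw [funext (tail_eq hg 0), ← zero_sub]
  exact (hasDerivAt_const s _).sub (hc.integral_hasStrictDerivAt 0 s).hasDerivAt

end Tail

theorem ae_hasDerivAt_tail {g : ℝ → ℂ} (hg : ∀ x, IntegrableOn g (Ioi x)) :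
    ∀ᵐ s, HasDerivAt (fun s => ∫ t in Ioi s, g t) (-g s) s := by
  have hl : LocallyIntegrable g volume := by
    intro x
    exact ⟨Ioi (x - 1), Ioi_mem_nhds (by linarith), hg _⟩
  filter_upwards [_root_.LocallyIntegrable.ae_hasDerivAt_integral hl] with s hs
  rw [funext (tail_eq hg 0), ← zero_sub]
  exact (hasDerivAt_const s _).sub (hs 0)

theorem aci_tail {g : ℝ → ℂ} (hg : ∀ x, IntegrableOn g (Ioi x)) (a b : ℝ) :
    AbsolutelyContinuousOnInterval (fun s => ∫ t in Ioi s, g t) a b := by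
  rw [funext (tail_eq hg a)]
  exact (aci_const _ a b).sub (aci_primitive (intervalIntegrable_of_tail hg a b) left_mem_uIcc)

/-! ### Potentials with integrable tails and first moments -/

/-- Decay is demanded only towards `+∞`. Nothing is imposed at `-∞`, because `exists_halfSol_one`
uses a potential that need not be integrable there. -/
structure TailIntegrable (V : ℝ → ℂ) : Prop where
  int : ∀ x, IntegrableOn V (Ioi x)
  mom : ∀ x, IntegrableOn (fun t => t * ‖V t‖) (Ioi x)

/-- `∫_s^∞ |V|`. -/
noncomputable def tailNorm (V : ℝ → ℂ) (s : ℝ) : ℝ := ∫ t in Ioi s, ‖V t‖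

/-- `∫_x^∞ ∫_s^∞ |V(t)| dt ds`. -/
noncomputable def tailMoment (V : ℝ → ℂ) (x : ℝ) : ℝ := ∫ s in Ioi x, tailNorm V s

theorem tailNorm_nonneg (V : ℝ → ℂ) (s : ℝ) : 0 ≤ tailNorm V s :=
  setIntegral_nonneg measurableSet_Ioi fun _ _ => norm_nonneg _

theorem tailMoment_nonneg (V : ℝ → ℂ) (s : ℝ) : 0 ≤ tailMoment V s :=
  setIntegral_nonneg measurableSet_Ioi fun _ _ => tailNorm_nonneg _ _

namespace TailIntegrable

variable {V : ℝ → ℂ} (hV : TailIntegrable V)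
include hV

theorem tailNorm_antitone : Antitone (tailNorm V) := fun a _ hab =>
  setIntegral_mono_set (hV.int a).norm (Eventually.of_forall fun _ => norm_nonneg _)
    (Ioi_subset_Ioi hab).eventuallyLE

theorem continuous_tailNorm : Continuous (tailNorm V) :=
  continuous_tail fun x => (hV.int x).norm

/-- By the layer cake formula `∫_x^∞ ∫_s^∞ |V(t)| dt ds = ∫_x^∞ (t - x) |V(t)| dt`, which the first
moment bounds. -/
theorem tailNorm_integrableOn (x : ℝ) : IntegrableOn (tailNorm V) (Ioi x) := by
  set μ : Measure ℝ := (volume.restrict (Ioi x)).withDensity fun t => ‖V t‖ₑ with hμ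
  have hm : AEMeasurable (fun t => ‖V t‖ₑ) (volume.restrict (Ioi x)) :=
    (hV.int x).aestronglyMeasurable.enorm
  have lc := lintegral_eq_lintegral_meas_lt μ (f := fun t => max (t - x) 0)
    (Eventually.of_forall fun t => le_max_right _ _) (by fun_prop)
  have h1 : ∫⁻ t, ENNReal.ofReal (max (t - x) 0) ∂μ < ⊤ := by
    rw [hμ, lintegral_withDensity_eq_lintegral_mul₀ hm (by fun_prop)]
    have hi : IntegrableOn (fun t => t * ‖V t‖ - x * ‖V t‖) (Ioi x) :=
      (hV.mom x).sub ((hV.int x).norm.const_mul x)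
    refine lt_of_le_of_lt (lintegral_mono_ae ?_) hi.2
    filter_upwards [ae_restrict_mem measurableSet_Ioi] with t ht
    have ht : x < t := ht
    rw [Pi.mul_apply, max_eq_left (by linarith), ← sub_mul, enorm_mul, mul_comm, enorm_norm,
      Real.enorm_of_nonneg (by linarith)]
  rw [lc] at h1
  have h2 : ∫⁻ u in Ioi (0 : ℝ), ENNReal.ofReal (tailNorm V (x + u)) < ⊤ := by
    refine lt_of_eq_of_lt (setLIntegral_congr_fun measurableSet_Ioi fun u hu => ?_) h1
    have hu : 0 < u := hu
    have : {a : ℝ | u < max (a - x) 0} = Ioi (x + u) := by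
      ext a
      simp only [mem_ofPred_eq, lt_max_iff, mem_Ioi]
      constructor
      · rintro (h | h) <;> linarith
      · intro h; left; linarith
    rw [this, hμ, withDensity_apply _ measurableSet_Ioi, Measure.restrict_restrict measurableSet_Ioi,
      inter_eq_left.2 (Ioi_subset_Ioi (by linarith)), tailNorm,
      ofReal_integral_eq_lintegral_ofReal (hV.int _).norm
        (Eventually.of_forall fun _ => norm_nonneg _)]
    simp
  have h3 : IntegrableOn (fun u => tailNorm V (x + u)) (Ioi 0) := by
    refine ⟨(hV.continuous_tailNorm.comp (by fun_prop)).aestronglyMeasurable, ?_⟩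
    rw [hasFiniteIntegral_iff_ofReal (Eventually.of_forall fun _ => tailNorm_nonneg _ _)]
    exact h2
  have h4 := ((measurePreserving_add_left volume x).integrableOn_comp_preimage
    (f := tailNorm V) (s := Ioi x) (MeasurableEquiv.addLeft x).measurableEmbedding).1
  apply h4
  simpa [Function.comp_def] using h3

theorem tailMoment_antitone : Antitone (tailMoment V) := fun a _ hab =>
  setIntegral_mono_set (hV.tailNorm_integrableOn a)
    (Eventually.of_forall fun _ => tailNorm_nonneg _ _) (Ioi_subset_Ioi hab).eventuallyLE

theorem hasDerivAt_tailMoment (x : ℝ) : HasDerivAt (tailMoment V) (-tailNorm V x) x :=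
  hasDerivAt_tail hV.tailNorm_integrableOn hV.continuous_tailNorm x

theorem continuous_tailMoment : Continuous (tailMoment V) :=
  continuous_tail hV.tailNorm_integrableOn

theorem tendsto_tailNorm : Tendsto (tailNorm V) atTop (𝓝 0) :=
  tendsto_tail fun x => (hV.int x).norm

theorem tendsto_tailMoment : Tendsto (tailMoment V) atTop (𝓝 0) :=
  tendsto_tail hV.tailNorm_integrableOn

theorem tailNorm_mul_pow_integrableOn (k : ℕ) (x : ℝ) :
    IntegrableOn (fun s => tailNorm V s * (tailMoment V s ^ k / k.factorial)) (Ioi x) := by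
  refine (hV.tailNorm_integrableOn x).mul_bdd (c := tailMoment V x ^ k / k.factorial)
    ((hV.continuous_tailMoment.pow k).div_const _).aestronglyMeasurable ?_
  filter_upwards [ae_restrict_mem measurableSet_Ioi] with s hs
  have h0 := tailMoment_nonneg V s
  rw [Real.norm_of_nonneg (by positivity)]
  gcongr
  exact hV.tailMoment_antitone (le_of_lt hs)

/-- Since `tailNorm` is minus the derivative of `tailMoment`, the integrand is an exact derivative.
This is the source of the factorials in the Neumann series. -/
theorem integral_tailNorm_mul_pow (k : ℕ) (x : ℝ) :
    ∫ s in Ioi x, tailNorm V s * (tailMoment V s ^ k / k.factorial) =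
      tailMoment V x ^ (k + 1) / (k + 1).factorial := by
  have hd : ∀ s ∈ Ici x, HasDerivAt (fun s => -(tailMoment V s ^ (k + 1) / (k + 1).factorial))
      (tailNorm V s * (tailMoment V s ^ k / k.factorial)) s := by
    intro s _
    refine (((hV.hasDerivAt_tailMoment s).pow (k + 1)).div_const _).neg.congr_deriv ?_
    rw [Nat.factorial_succ]
    push_cast
    field_simp
  rw [integral_Ioi_of_hasDerivAt_of_tendsto' hd (hV.tailNorm_mul_pow_integrableOn k x)
    (m := -((0 : ℝ) ^ (k + 1) / ((k + 1).factorial : ℝ)))]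
  · simp
  · exact ((hV.tendsto_tailMoment.pow (k + 1)).div_const _).neg

end TailIntegrable

/-! ### Holomorphic dependence of integrals on a parameter -/

/-- Only `F` itself has to be dominated: Cauchy's estimate on discs of radius `ρ/2` bounds its
`ζ`-derivative by `b/(ρ/2)`. The derivative is measurable in `a` as a limit of difference quotients
with steps `ρ/(n+1)`. -/
theorem differentiableOn_integral_of_dominated {α : Type*} [MeasurableSpace α] {μ : Measure α}
    {F : ℂ → α → ℂ} {U : Set ℂ} {b : α → ℝ} (hU : IsOpen U)
    (hmeas : ∀ ζ ∈ U, AEStronglyMeasurable (F ζ) μ)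
    (hdiff : ∀ᵐ a ∂μ, DifferentiableOn ℂ (fun ζ => F ζ a) U)
    (hbound : ∀ᵐ a ∂μ, ∀ ζ ∈ U, ‖F ζ a‖ ≤ b a) (hb : Integrable b μ) :
    DifferentiableOn ℂ (fun ζ => ∫ a, F ζ a ∂μ) U := by
  intro z hz
  obtain ⟨ρ, hρ, hsub⟩ := Metric.nhds_basis_closedBall.mem_iff.1 (hU.mem_nhds hz)
  have hball : ∀ w ∈ Metric.ball z (ρ / 2), Metric.closedBall w (ρ / 2) ⊆ U := by
    intro w hw
    refine Subset.trans (Metric.closedBall_subset_closedBall' ?_) hsub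
    have := Metric.mem_ball.1 hw
    linarith
  have hmeas' : AEStronglyMeasurable (fun a => deriv (fun ζ => F ζ a) z) μ := by
    have hseq : Tendsto (fun n : ℕ => ((ρ / (n + 1) : ℝ) : ℂ)) atTop (𝓝[≠] 0) := by
      rw [tendsto_nhdsWithin_iff]
      constructor
      · have h1 : Tendsto (fun n : ℕ => ρ * (1 / ((n : ℝ) + 1))) atTop (𝓝 (ρ * 0)) :=
          tendsto_one_div_add_atTop_nhds_zero_nat.const_mul ρ
        have h2 := (Complex.continuous_ofReal.tendsto _).comp h1
        simpa [Function.comp_def, div_eq_mul_inv] using h2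
      · refine Eventually.of_forall fun n => ?_
        simp only [mem_compl_iff, mem_singleton_iff, Complex.ofReal_eq_zero]
        positivity
    refine aestronglyMeasurable_of_tendsto_ae atTop
      (f := fun n : ℕ => fun a => ((ρ / (n + 1) : ℝ) : ℂ)⁻¹ • (F (z + ((ρ / (n + 1) : ℝ) : ℂ)) a - F z a))
      (fun n => ?_) ?_
    · refine ((hmeas _ (hsub ?_)).sub (hmeas z hz)).const_smul ((ρ / (n + 1) : ℝ) : ℂ)⁻¹
      simp only [Metric.mem_closedBall, dist_self_add_left, Complex.norm_real]
      rw [Real.norm_of_nonneg (by positivity)]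
      exact div_le_self hρ.le (by linarith [(Nat.cast_nonneg n : (0 : ℝ) ≤ n)])
    · filter_upwards [hdiff] with a ha
      have hd := ((ha z hz).differentiableAt (hU.mem_nhds hz)).hasDerivAt
      exact (hasDerivAt_iff_tendsto_slope_zero.1 hd).comp hseq
  refine (hasDerivAt_integral_of_dominated_loc_of_deriv_le (bound := fun a => b a / (ρ / 2))
    (F' := fun w a => deriv (fun ζ => F ζ a) w)
    (Metric.ball_mem_nhds z (half_pos hρ)) ?_ ?_ hmeas' ?_ (hb.div_const _) ?_).2.differentiableAt.differentiableWithinAt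
  · filter_upwards [hU.mem_nhds hz] with w hw using hmeas w hw
  · refine hb.mono' (hmeas z hz) ?_
    filter_upwards [hbound] with a ha using ha z hz
  · filter_upwards [hbound, hdiff] with a ha hd w hw
    refine Complex.norm_deriv_le_of_forall_mem_sphere_norm_le (half_pos hρ) ?_ fun v hv =>
      ha v (hball w hw (Metric.sphere_subset_closedBall hv))
    refine (hd.mono (hball w hw)).diffContOnCl_ball subset_rfl
  · filter_upwards [hdiff] with a hd w hw
    have hw' : w ∈ U := hball w hw (Metric.mem_closedBall_self (by positivity))
    exact ((hd w hw').differentiableAt (hU.mem_nhds hw')).hasDerivAt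

/-! ### The Volterra operator of the Jost solution -/

/-- `∫_s^∞ e^{2iζ(t-s)} V(t) d(t) dt`. -/
noncomputable def volterraInner (V : ℝ → ℂ) (ζ : ℂ) (d : ℝ → ℂ) (s : ℝ) : ℂ :=
  ∫ t in Ioi s, Complex.exp (2 * Complex.I * ζ * (t - s)) * (V t * d t)

noncomputable def volterraStep (V : ℝ → ℂ) (ζ : ℂ) (d : ℝ → ℂ) (x : ℝ) : ℂ :=
  ∫ s in Ioi x, volterraInner V ζ d s

/-- The terms of the Neumann series of `e^{-iζx} f(x,ζ)`. -/
noncomputable def jostTerm (V : ℝ → ℂ) (ζ : ℂ) : ℕ → ℝ → ℂ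
  | 0 => fun _ => 1
  | k + 1 => volterraStep V ζ (jostTerm V ζ k)

theorem norm_kernel (ζ : ℂ) (s t : ℝ) :
    ‖Complex.exp (2 * Complex.I * ζ * (t - s))‖ = Real.exp (-(2 * ζ.im * (t - s))) := by
  rw [Complex.norm_exp]
  congr 1
  simp [Complex.mul_re, Complex.mul_im]

theorem norm_kernel_le {ζ : ℂ} (hζ : 0 ≤ ζ.im) {s t : ℝ} (h : s ≤ t) :
    ‖Complex.exp (2 * Complex.I * ζ * (t - s))‖ ≤ 1 := by
  rw [norm_kernel, Real.exp_le_one_iff]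
  have := mul_nonneg (mul_nonneg zero_le_two hζ) (sub_nonneg.2 h)
  linarith

/-- Boundedness on every half-line `(x,∞)`. -/
def TailBounded (d : ℝ → ℂ) : Prop := ∀ x, ∃ C, ∀ t, x < t → ‖d t‖ ≤ C

/-- Factoring the kernel separates `s` from `t`. The inner integral becomes an exponential times the
tail of a function independent of `s`, which gives continuity, absolute continuity and the
derivative in `s`. -/
theorem volterraInner_eq (V : ℝ → ℂ) (ζ : ℂ) (d : ℝ → ℂ) (s : ℝ) :
    volterraInner V ζ d s = Complex.exp (-(2 * Complex.I * ζ * s)) *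
      ∫ t in Ioi s, Complex.exp (2 * Complex.I * ζ * (t - (0 : ℝ))) * (V t * d t) := by
  rw [volterraInner, ← integral_const_mul]
  refine integral_congr_ae (Eventually.of_forall fun t => ?_)
  have h : Complex.exp (2 * Complex.I * ζ * (t - s)) = Complex.exp (-(2 * Complex.I * ζ * s)) *
      Complex.exp (2 * Complex.I * ζ * (t - (0 : ℝ))) := by
    rw [← Complex.exp_add]
    congr 1
    push_cast
    ring
  simp only [h]
  ring

namespace TailIntegrable

variable {V : ℝ → ℂ} (hV : TailIntegrable V)
include hV

theorem integrableOn_mul {d : ℝ → ℂ} (hd : Continuous d) (hb : TailBounded d) (x : ℝ) :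
    IntegrableOn (fun t => V t * d t) (Ioi x) := by
  obtain ⟨C, hC⟩ := hb x
  refine (hV.int x).mul_bdd (c := C) hd.aestronglyMeasurable ?_
  filter_upwards [ae_restrict_mem measurableSet_Ioi] with t ht using hC t ht

theorem integrableOn_kernel {ζ : ℂ} (hζ : 0 ≤ ζ.im) {d : ℝ → ℂ} (hd : Continuous d)
    (hb : TailBounded d) (s x : ℝ) :
    IntegrableOn (fun t : ℝ => Complex.exp (2 * Complex.I * ζ * (t - s)) * (V t * d t)) (Ioi x) := by
  -- Here `x` may lie to the left of `s`, where the kernel can exceed one in modulus; its bound on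
  -- `(x,∞)` is its modulus at `x`.
  refine (hV.integrableOn_mul hd hb x).bdd_mul (c := Real.exp (-(2 * ζ.im * (x - s))))
    (by fun_prop : Continuous fun t : ℝ =>
      Complex.exp (2 * Complex.I * ζ * (t - s))).aestronglyMeasurable ?_
  filter_upwards [ae_restrict_mem measurableSet_Ioi] with t ht
  rw [norm_kernel, Real.exp_le_exp, neg_le_neg_iff]
  have : x < t := ht
  gcongr

theorem continuous_volterraInner {ζ : ℂ} (hζ : 0 ≤ ζ.im) {d : ℝ → ℂ} (hd : Continuous d)
    (hb : TailBounded d) : Continuous (volterraInner V ζ d) := by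
  rw [funext (volterraInner_eq V ζ d)]
  exact (by fun_prop : Continuous fun s : ℝ => Complex.exp (-(2 * Complex.I * ζ * s))).mul
    (continuous_tail (hV.integrableOn_kernel hζ hd hb 0))

theorem norm_volterraInner_le {ζ : ℂ} (hζ : 0 ≤ ζ.im) {d : ℝ → ℂ} {s C : ℝ}
    (hC : ∀ t, s < t → ‖d t‖ ≤ C) : ‖volterraInner V ζ d s‖ ≤ tailNorm V s * C := by
  rw [tailNorm, ← integral_mul_const]
  refine norm_integral_le_of_norm_le ((hV.int s).norm.mul_const C) ?_
  filter_upwards [ae_restrict_mem measurableSet_Ioi] with t ht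
  rw [norm_mul, norm_mul]
  have h1 := norm_kernel_le hζ (le_of_lt ht)
  have h2 := hC t ht
  calc _ ≤ 1 * (‖V t‖ * C) := by gcongr
    _ = _ := one_mul _

theorem integrableOn_volterraInner {ζ : ℂ} (hζ : 0 ≤ ζ.im) {d : ℝ → ℂ} (hd : Continuous d)
    (hb : TailBounded d) (x : ℝ) : IntegrableOn (volterraInner V ζ d) (Ioi x) := by
  obtain ⟨C, hC⟩ := hb x
  refine ((hV.tailNorm_integrableOn x).mul_const C).mono'
    (hV.continuous_volterraInner hζ hd hb).aestronglyMeasurable ?_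
  filter_upwards [ae_restrict_mem measurableSet_Ioi] with s hs
  exact hV.norm_volterraInner_le hζ fun t ht => hC t (lt_trans hs ht)

theorem continuousOn_volterraInner {D : ℂ → ℝ → ℂ} {s C : ℝ}
    (hD : ∀ ζ : ℂ, 0 ≤ ζ.im → Continuous (D ζ))
    (hC : ∀ ζ : ℂ, 0 ≤ ζ.im → ∀ t, s < t → ‖D ζ t‖ ≤ C)
    (hc : ∀ t, ContinuousOn (fun ζ => D ζ t) {ζ : ℂ | 0 ≤ ζ.im}) :
    ContinuousOn (fun ζ => volterraInner V ζ (D ζ) s) {ζ : ℂ | 0 ≤ ζ.im} := by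
  refine continuousOn_of_dominated (bound := fun t => ‖V t‖ * C) (fun ζ hζ => ?_) (fun ζ hζ => ?_)
    ((hV.int s).norm.mul_const C) (Eventually.of_forall fun t => ?_)
  · exact (by fun_prop : Continuous fun t : ℝ =>
      Complex.exp (2 * Complex.I * ζ * (t - s))).aestronglyMeasurable.mul
      ((hV.int s).aestronglyMeasurable.mul (hD ζ hζ).aestronglyMeasurable)
  · filter_upwards [ae_restrict_mem measurableSet_Ioi] with t ht
    rw [norm_mul, norm_mul]
    have h1 := norm_kernel_le hζ (le_of_lt ht)
    have h2 := hC ζ hζ t ht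
    calc _ ≤ 1 * (‖V t‖ * C) := by gcongr
      _ = _ := one_mul _
  · exact (by fun_prop : Continuous fun ζ : ℂ =>
      Complex.exp (2 * Complex.I * ζ * (t - s))).continuousOn.mul (continuousOn_const.mul (hc t))

theorem differentiableOn_volterraInner {D : ℂ → ℝ → ℂ} {s C : ℝ}
    (hD : ∀ ζ : ℂ, 0 ≤ ζ.im → Continuous (D ζ))
    (hC : ∀ ζ : ℂ, 0 ≤ ζ.im → ∀ t, s < t → ‖D ζ t‖ ≤ C)
    (hc : ∀ t, DifferentiableOn ℂ (fun ζ => D ζ t) {ζ : ℂ | 0 < ζ.im}) :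
    DifferentiableOn ℂ (fun ζ => volterraInner V ζ (D ζ) s) {ζ : ℂ | 0 < ζ.im} := by
  refine differentiableOn_integral_of_dominated (b := fun t => ‖V t‖ * C)
    (isOpen_lt continuous_const Complex.continuous_im) (fun ζ hζ => ?_)
    (Eventually.of_forall fun t => ?_) ?_ ((hV.int s).norm.mul_const C)
  · exact (by fun_prop : Continuous fun t : ℝ =>
      Complex.exp (2 * Complex.I * ζ * (t - s))).aestronglyMeasurable.mul
      ((hV.int s).aestronglyMeasurable.mul (hD ζ (le_of_lt hζ)).aestronglyMeasurable)
  · exact (by fun_prop : Differentiable ℂ fun ζ : ℂ =>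
      Complex.exp (2 * Complex.I * ζ * (t - s))).differentiableOn.mul
        ((differentiableOn_const _).mul (hc t))
  · filter_upwards [ae_restrict_mem measurableSet_Ioi] with t ht ζ hζ
    have hζ : 0 ≤ ζ.im := le_of_lt hζ
    rw [norm_mul, norm_mul]
    have h1 := norm_kernel_le hζ (le_of_lt ht)
    have h2 := hC ζ hζ t ht
    calc _ ≤ 1 * (‖V t‖ * C) := by gcongr
      _ = _ := one_mul _

/-! ### The Neumann series -/

/-- For `Im ζ ≥ 0` the kernel has modulus at most one, so each iteration integrates the previous
bound against `tailNorm`, and `integral_tailNorm_mul_pow` raises the exponent and the factorial by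
one. -/
theorem jostTerm_spec {ζ : ℂ} (hζ : 0 ≤ ζ.im) (k : ℕ) :
    Continuous (jostTerm V ζ k) ∧ ∀ x, ‖jostTerm V ζ k x‖ ≤ tailMoment V x ^ k / k.factorial := by
  induction k with
  | zero => exact ⟨continuous_const, fun x => by simp [jostTerm]⟩
  | succ k ih =>
    have hb : TailBounded (jostTerm V ζ k) := fun x =>
      ⟨tailMoment V x ^ k / k.factorial, fun t ht => (ih.2 t).trans (by
        have := tailMoment_nonneg V t
        gcongr
        exact hV.tailMoment_antitone ht.le)⟩
    refine ⟨continuous_tail (hV.integrableOn_volterraInner hζ ih.1 hb), fun x => ?_⟩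
    rw [← hV.integral_tailNorm_mul_pow k x]
    refine norm_integral_le_of_norm_le (hV.tailNorm_mul_pow_integrableOn k x)
      (Eventually.of_forall fun s => ?_)
    refine hV.norm_volterraInner_le hζ fun t ht => (ih.2 t).trans ?_
    have := tailMoment_nonneg V t
    gcongr
    exact hV.tailMoment_antitone ht.le

theorem norm_jostTerm_le {ζ : ℂ} (hζ : 0 ≤ ζ.im) (k : ℕ) {x t : ℝ} (h : x ≤ t) :
    ‖jostTerm V ζ k t‖ ≤ tailMoment V x ^ k / k.factorial := by
  refine ((hV.jostTerm_spec hζ k).2 t).trans ?_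
  have := tailMoment_nonneg V t
  gcongr
  exact hV.tailMoment_antitone h

theorem tailBounded_jostTerm {ζ : ℂ} (hζ : 0 ≤ ζ.im) (k : ℕ) : TailBounded (jostTerm V ζ k) :=
  fun x => ⟨_, fun _ ht => hV.norm_jostTerm_le hζ k (le_of_lt (a := x) ht)⟩

theorem norm_volterraInner_jostTerm_le {ζ : ℂ} (hζ : 0 ≤ ζ.im) (k : ℕ) {x s : ℝ} (h : x ≤ s) :
    ‖volterraInner V ζ (jostTerm V ζ k) s‖ ≤ tailNorm V s * (tailMoment V x ^ k / k.factorial) :=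
  hV.norm_volterraInner_le hζ fun _ ht => hV.norm_jostTerm_le hζ k (h.trans ht.le)

theorem continuousOn_jostTerm (k : ℕ) (x : ℝ) :
    ContinuousOn (fun ζ => jostTerm V ζ k x) {ζ : ℂ | 0 ≤ ζ.im} := by
  induction k generalizing x with
  | zero => exact continuousOn_const
  | succ k ih =>
    refine continuousOn_of_dominated
      (bound := fun s => tailNorm V s * (tailMoment V x ^ k / k.factorial))
      (fun ζ hζ => ?_) (fun ζ hζ => ?_) ((hV.tailNorm_integrableOn x).mul_const _)
      (Eventually.of_forall fun s => ?_)
    · exact (hV.continuous_volterraInner hζ (hV.jostTerm_spec hζ k).1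
        (hV.tailBounded_jostTerm hζ k)).aestronglyMeasurable
    · filter_upwards [ae_restrict_mem measurableSet_Ioi] with s hs
      exact hV.norm_volterraInner_jostTerm_le hζ k (le_of_lt hs)
    · exact hV.continuousOn_volterraInner (fun ζ hζ => (hV.jostTerm_spec hζ k).1)
        (fun ζ hζ t ht => hV.norm_jostTerm_le hζ k (le_of_lt ht)) ih

theorem differentiableOn_jostTerm (k : ℕ) (x : ℝ) :
    DifferentiableOn ℂ (fun ζ => jostTerm V ζ k x) {ζ : ℂ | 0 < ζ.im} := by
  induction k generalizing x with
  | zero => exact differentiableOn_const _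
  | succ k ih =>
    refine differentiableOn_integral_of_dominated
      (b := fun s => tailNorm V s * (tailMoment V x ^ k / k.factorial))
      (isOpen_lt continuous_const Complex.continuous_im) (fun ζ hζ => ?_)
      (Eventually.of_forall fun s => ?_) ?_ ((hV.tailNorm_integrableOn x).mul_const _)
    · have hζ : 0 ≤ ζ.im := le_of_lt hζ
      exact (hV.continuous_volterraInner hζ (hV.jostTerm_spec hζ k).1
        (hV.tailBounded_jostTerm hζ k)).aestronglyMeasurable
    · exact hV.differentiableOn_volterraInner (fun ζ hζ => (hV.jostTerm_spec hζ k).1)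
        (fun ζ hζ t ht => hV.norm_jostTerm_le hζ k (le_of_lt ht)) ih
    · filter_upwards [ae_restrict_mem measurableSet_Ioi] with s hs ζ hζ
      exact hV.norm_volterraInner_jostTerm_le (le_of_lt hζ) k (le_of_lt hs)

end TailIntegrable

/-- `e^{-iζx} f(x,ζ)` for the Jost solution `f`. -/
noncomputable def jostM (V : ℝ → ℂ) (ζ : ℂ) (x : ℝ) : ℂ := ∑' k, jostTerm V ζ k x

/-- The derivative of `jostM`. -/
noncomputable def jostN (V : ℝ → ℂ) (ζ : ℂ) (x : ℝ) : ℂ := -volterraInner V ζ (jostM V ζ) x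

/-- The solution of `-y'' + V y = ζ² y` on the line with `e^{-iζx} y(x) → 1` as `x → ∞`. -/
noncomputable def jostSol (V : ℝ → ℂ) (ζ : ℂ) (x : ℝ) : ℂ :=
  Complex.exp (Complex.I * ζ * x) * jostM V ζ x

/-- The derivative of `jostSol`. -/
noncomputable def jostDer (V : ℝ → ℂ) (ζ : ℂ) (x : ℝ) : ℂ :=
  Complex.exp (Complex.I * ζ * x) * (Complex.I * ζ * jostM V ζ x + jostN V ζ x)

theorem hasDerivAt_exp_linear (c : ℂ) (x : ℝ) :
    HasDerivAt (fun x : ℝ => Complex.exp (c * x)) (Complex.exp (c * x) * c) x := by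
  have := ((hasDerivAt_id (x : ℂ)).const_mul c).cexp.comp_ofReal
  simpa using this

/-- At zero energy, with a real potential, the Jost solution is real. -/
theorem conj_jostM_zero {V : ℝ → ℂ} (hr : ∀ x, (starRingEnd ℂ) (V x) = V x) (x : ℝ) :
    (starRingEnd ℂ) (jostM V 0 x) = jostM V 0 x := by
  have h : ∀ k x, (starRingEnd ℂ) (jostTerm V 0 k x) = jostTerm V 0 k x := by
    intro k
    induction k with
    | zero => intro x; simp [jostTerm]
    | succ k ih =>
      intro x
      have hi : ∀ s, (starRingEnd ℂ) (volterraInner V 0 (jostTerm V 0 k) s) =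
          volterraInner V 0 (jostTerm V 0 k) s := by
        intro s
        rw [volterraInner, ← integral_conj]
        simp [ih, hr]
      simp only [jostTerm, volterraStep]
      rw [← integral_conj]
      simp only [hi]
  rw [jostM, Complex.conj_tsum]
  simp only [h]

namespace TailIntegrable

variable {V : ℝ → ℂ} (hV : TailIntegrable V)
include hV

theorem summable_jostTerm {ζ : ℂ} (hζ : 0 ≤ ζ.im) (x : ℝ) :
    Summable fun k => jostTerm V ζ k x :=
  Summable.of_norm_bounded (Real.summable_pow_div_factorial (tailMoment V x))
    fun k => hV.norm_jostTerm_le hζ k le_rfl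

theorem continuous_jostM {ζ : ℂ} (hζ : 0 ≤ ζ.im) : Continuous (jostM V ζ) := by
  rw [continuous_iff_continuousAt]
  intro x
  have : ContinuousOn (jostM V ζ) (Ici (x - 1)) :=
    continuousOn_tsum (fun k => (hV.jostTerm_spec hζ k).1.continuousOn)
      (Real.summable_pow_div_factorial (tailMoment V (x - 1)))
      fun k t ht => hV.norm_jostTerm_le hζ k ht
  exact this.continuousAt (Ici_mem_nhds (by linarith))

theorem norm_jostM_le {ζ : ℂ} (hζ : 0 ≤ ζ.im) (x : ℝ) :
    ‖jostM V ζ x‖ ≤ Real.exp (tailMoment V x) := by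
  refine (tsum_of_norm_bounded (Real.summable_pow_div_factorial (tailMoment V x)).hasSum
    fun k => hV.norm_jostTerm_le hζ k le_rfl).trans_eq ?_
  rw [Real.exp_eq_exp_ℝ, NormedSpace.exp_eq_tsum_div]

theorem norm_jostM_sub_one_le {ζ : ℂ} (hζ : 0 ≤ ζ.im) (x : ℝ) :
    ‖jostM V ζ x - 1‖ ≤ Real.exp (tailMoment V x) - 1 := by
  have hs := Real.summable_pow_div_factorial (tailMoment V x)
  have h1 : jostM V ζ x - 1 = ∑' k, jostTerm V ζ (k + 1) x := by
    rw [jostM, (hV.summable_jostTerm hζ x).tsum_eq_zero_add]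
    simp [jostTerm]
  have h2 : Real.exp (tailMoment V x) - 1 =
      ∑' k : ℕ, tailMoment V x ^ (k + 1) / (k + 1).factorial := by
    rw [Real.exp_eq_exp_ℝ, NormedSpace.exp_eq_tsum_div]
    simp only
    rw [hs.tsum_eq_zero_add]
    simp
  rw [h1, h2]
  exact tsum_of_norm_bounded ((summable_nat_add_iff 1).2 hs).hasSum
    fun k => hV.norm_jostTerm_le hζ (k + 1) le_rfl

theorem norm_jostM_le_of_le {ζ : ℂ} (hζ : 0 ≤ ζ.im) {x t : ℝ} (h : x ≤ t) :
    ‖jostM V ζ t‖ ≤ Real.exp (tailMoment V x) :=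
  (hV.norm_jostM_le hζ t).trans (Real.exp_le_exp.2 (hV.tailMoment_antitone h))

theorem tailBounded_jostM {ζ : ℂ} (hζ : 0 ≤ ζ.im) : TailBounded (jostM V ζ) :=
  fun _ => ⟨_, fun _ ht => hV.norm_jostM_le_of_le hζ ht.le⟩

theorem hasSum_volterraInner {ζ : ℂ} (hζ : 0 ≤ ζ.im) (s : ℝ) :
    HasSum (fun k => volterraInner V ζ (jostTerm V ζ k) s) (volterraInner V ζ (jostM V ζ) s) := by
  have hs := Real.summable_pow_div_factorial (tailMoment V s)
  refine hasSum_integral_of_dominated_convergence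
    (fun k t => ‖V t‖ * (tailMoment V s ^ k / k.factorial)) (fun k => ?_) (fun k => ?_)
    (Eventually.of_forall fun t => hs.mul_left _) ?_ (Eventually.of_forall fun t => ?_)
  · exact (hV.integrableOn_kernel hζ (hV.jostTerm_spec hζ k).1
      (hV.tailBounded_jostTerm hζ k) s s).aestronglyMeasurable
  · filter_upwards [ae_restrict_mem measurableSet_Ioi] with t ht
    rw [norm_mul, norm_mul]
    have h1 := norm_kernel_le hζ (le_of_lt ht)
    have h2 := hV.norm_jostTerm_le hζ k (le_of_lt ht)
    calc _ ≤ 1 * (‖V t‖ * (tailMoment V s ^ k / k.factorial)) := by gcongr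
      _ = _ := one_mul _
  · simp only [tsum_mul_left]
    exact (hV.int s).norm.mul_const _
  · exact ((hV.summable_jostTerm hζ t).hasSum.mul_left _).mul_left _

/-- Dominated convergence moves the sum of the series through both integrals, giving the Volterra
equation. -/
theorem jostM_eq {ζ : ℂ} (hζ : 0 ≤ ζ.im) (x : ℝ) :
    jostM V ζ x = 1 + ∫ s in Ioi x, volterraInner V ζ (jostM V ζ) s := by
  have hs := Real.summable_pow_div_factorial (tailMoment V x)
  have h1 : HasSum (fun k => jostTerm V ζ (k + 1) x)
      (∫ s in Ioi x, volterraInner V ζ (jostM V ζ) s) := by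
    refine hasSum_integral_of_dominated_convergence
      (fun k s => tailNorm V s * (tailMoment V x ^ k / k.factorial)) (fun k => ?_) (fun k => ?_)
      (Eventually.of_forall fun s => hs.mul_left _) ?_
      (Eventually.of_forall fun s => hV.hasSum_volterraInner hζ s)
    · exact (hV.continuous_volterraInner hζ (hV.jostTerm_spec hζ k).1
        (hV.tailBounded_jostTerm hζ k)).aestronglyMeasurable
    · filter_upwards [ae_restrict_mem measurableSet_Ioi] with s hs
      exact hV.norm_volterraInner_jostTerm_le hζ k (le_of_lt hs)
    · simp only [tsum_mul_left]
      exact (hV.tailNorm_integrableOn x).mul_const _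
  rw [jostM, (hV.summable_jostTerm hζ x).tsum_eq_zero_add, h1.tsum_eq]
  simp [jostTerm]

theorem continuous_jostN {ζ : ℂ} (hζ : 0 ≤ ζ.im) : Continuous (jostN V ζ) :=
  (hV.continuous_volterraInner hζ (hV.continuous_jostM hζ) (hV.tailBounded_jostM hζ)).neg

theorem norm_jostN_le {ζ : ℂ} (hζ : 0 ≤ ζ.im) (x : ℝ) :
    ‖jostN V ζ x‖ ≤ tailNorm V x * Real.exp (tailMoment V x) := by
  rw [jostN, norm_neg]
  exact hV.norm_volterraInner_le hζ fun t ht => hV.norm_jostM_le_of_le hζ ht.le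

theorem hasDerivAt_jostM {ζ : ℂ} (hζ : 0 ≤ ζ.im) (x : ℝ) :
    HasDerivAt (jostM V ζ) (jostN V ζ x) x := by
  rw [funext (hV.jostM_eq hζ)]
  exact (hasDerivAt_tail (hV.integrableOn_volterraInner hζ (hV.continuous_jostM hζ)
    (hV.tailBounded_jostM hζ)) (hV.continuous_volterraInner hζ (hV.continuous_jostM hζ)
    (hV.tailBounded_jostM hζ)) x).const_add 1

theorem aci_jostN {ζ : ℂ} (hζ : 0 ≤ ζ.im) (a b : ℝ) :
    AbsolutelyContinuousOnInterval (jostN V ζ) a b := by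
  have h1 : AbsolutelyContinuousOnInterval
      (fun s : ℝ => Complex.exp (-(2 * Complex.I * ζ) * s)) a b :=
    aci_of_hasDerivAt (fun x _ => hasDerivAt_exp_linear _ x) (by fun_prop)
  refine aci_congr (aci_mul h1 (aci_tail (hV.integrableOn_kernel hζ (hV.continuous_jostM hζ)
    (hV.tailBounded_jostM hζ) 0) a b)).neg fun x _ => ?_
  rw [jostN, volterraInner_eq, ← neg_mul (2 * Complex.I * ζ)]
  rfl

/-- This is the equation `m'' + 2iζ m' = V m` satisfied by `m = e^{-iζx} f`. -/
theorem ae_hasDerivAt_jostN {ζ : ℂ} (hζ : 0 ≤ ζ.im) :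
    ∀ᵐ x, HasDerivAt (jostN V ζ) (V x * jostM V ζ x - 2 * Complex.I * ζ * jostN V ζ x) x := by
  filter_upwards [ae_hasDerivAt_tail (hV.integrableOn_kernel hζ (hV.continuous_jostM hζ)
    (hV.tailBounded_jostM hζ) 0)] with x hx
  have h1 := ((hasDerivAt_exp_linear (-(2 * Complex.I * ζ)) x).mul hx).neg
  have e : jostN V ζ = -((fun s : ℝ => Complex.exp (-(2 * Complex.I * ζ) * s)) *
      fun s : ℝ => ∫ t : ℝ in Ioi s, Complex.exp (2 * Complex.I * ζ * (t - (0 : ℝ))) *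
        (V t * jostM V ζ t)) := by
    funext s
    rw [jostN, volterraInner_eq, ← neg_mul (2 * Complex.I * ζ)]
    rfl
  rw [e]
  refine h1.congr_deriv ?_
  have h2 : Complex.exp (-(2 * Complex.I * ζ) * x) *
      Complex.exp (2 * Complex.I * ζ * (x - (0 : ℝ))) = 1 := by
    rw [← Complex.exp_add, Complex.exp_eq_one_iff]
    exact ⟨0, by push_cast; ring⟩
  simp only [Pi.neg_apply, Pi.mul_apply]
  linear_combination (V x * jostM V ζ x) * h2

theorem tendsto_jostM {ζ : ℂ} (hζ : 0 ≤ ζ.im) : Tendsto (jostM V ζ) atTop (𝓝 1) := by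
  rw [tendsto_iff_norm_sub_tendsto_zero]
  refine squeeze_zero (fun _ => norm_nonneg _) (fun x => hV.norm_jostM_sub_one_le hζ x) ?_
  simpa using ((Real.continuous_exp.tendsto _).comp hV.tendsto_tailMoment).sub_const 1

theorem tendsto_jostN {ζ : ℂ} (hζ : 0 ≤ ζ.im) : Tendsto (jostN V ζ) atTop (𝓝 0) := by
  rw [tendsto_zero_iff_norm_tendsto_zero]
  refine squeeze_zero (fun _ => norm_nonneg _) (fun x => hV.norm_jostN_le hζ x) ?_
  simpa using hV.tendsto_tailNorm.mul ((Real.continuous_exp.tendsto _).comp hV.tendsto_tailMoment)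

/-! ### The Jost solution -/

theorem hasDerivAt_jostSol {ζ : ℂ} (hζ : 0 ≤ ζ.im) (x : ℝ) :
    HasDerivAt (jostSol V ζ) (jostDer V ζ x) x := by
  refine ((hasDerivAt_exp_linear (Complex.I * ζ) x).mul (hV.hasDerivAt_jostM hζ x)).congr_deriv ?_
  rw [jostDer]
  ring

theorem aci_jostDer {ζ : ℂ} (hζ : 0 ≤ ζ.im) (a b : ℝ) :
    AbsolutelyContinuousOnInterval (jostDer V ζ) a b := by
  have h1 : AbsolutelyContinuousOnInterval
      (fun s : ℝ => Complex.exp (Complex.I * ζ * s)) a b :=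
    aci_of_hasDerivAt (fun x _ => hasDerivAt_exp_linear _ x) (by fun_prop)
  have h2 : AbsolutelyContinuousOnInterval (jostM V ζ) a b :=
    aci_of_hasDerivAt (fun x _ => hV.hasDerivAt_jostM hζ x) (hV.continuous_jostN hζ).continuousOn
  exact aci_mul h1 ((aci_mul (aci_const (Complex.I * ζ) a b) h2).add (hV.aci_jostN hζ a b))

theorem ae_hasDerivAt_jostDer {ζ : ℂ} (hζ : 0 ≤ ζ.im) :
    ∀ᵐ x, HasDerivAt (jostDer V ζ) ((V x - ζ ^ 2) * jostSol V ζ x) x := by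
  filter_upwards [hV.ae_hasDerivAt_jostN hζ] with x hx
  refine ((hasDerivAt_exp_linear (Complex.I * ζ) x).mul
    (((hV.hasDerivAt_jostM hζ x).const_mul (Complex.I * ζ)).add hx)).congr_deriv ?_
  simp only [Pi.add_apply, jostSol]
  linear_combination (Complex.exp (Complex.I * ζ * x) * ζ ^ 2 * jostM V ζ x) * Complex.I_sq

theorem deriv_jostSol {ζ : ℂ} (hζ : 0 ≤ ζ.im) : deriv (jostSol V ζ) = jostDer V ζ :=
  funext fun x => (hV.hasDerivAt_jostSol hζ x).deriv

theorem continuous_jostDer {ζ : ℂ} (hζ : 0 ≤ ζ.im) : Continuous (jostDer V ζ) := by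
  have := hV.continuous_jostM hζ
  have := hV.continuous_jostN hζ
  unfold jostDer
  fun_prop

theorem continuous_jostSol {ζ : ℂ} (hζ : 0 ≤ ζ.im) : Continuous (jostSol V ζ) := by
  have := hV.continuous_jostM hζ
  unfold jostSol
  fun_prop

theorem halfSol_jostSol {ζ : ℂ} (hζ : 0 ≤ ζ.im) :
    HalfSol (fun x => V x - ζ ^ 2) (jostSol V ζ) := by
  refine ⟨fun x _ => (hV.hasDerivAt_jostSol hζ x).differentiableAt, fun a b _ _ =>
    aci_of_hasDerivAt (fun x _ => hV.hasDerivAt_jostSol hζ x)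
      (hV.continuous_jostDer hζ).continuousOn, fun a b _ _ => ?_, ?_⟩
  · rw [hV.deriv_jostSol hζ]
    exact hV.aci_jostDer hζ a b
  · rw [hV.deriv_jostSol hζ]
    filter_upwards [hV.ae_hasDerivAt_jostDer hζ] with x hx _ using hx.deriv

theorem deriv_jostSol_neg {ζ : ℂ} (hζ : 0 ≤ ζ.im) :
    deriv (fun x => jostSol V ζ (-x)) = fun x => -jostDer V ζ (-x) :=
  funext fun x => by rw [deriv_comp_neg, hV.deriv_jostSol hζ]

theorem halfSol_jostSol_neg {ζ : ℂ} (hζ : 0 ≤ ζ.im) :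
    HalfSol (fun x => V (-x) - ζ ^ 2) (fun x => jostSol V ζ (-x)) := by
  refine ⟨fun x _ => (hV.hasDerivAt_jostSol hζ (-x)).differentiableAt.comp x differentiableAt_id.neg,
    fun a b _ _ => ?_, fun a b _ _ => ?_, ?_⟩
  · have : AbsolutelyContinuousOnInterval (jostSol V ζ) (-a) (-b) :=
      aci_of_hasDerivAt (fun x _ => hV.hasDerivAt_jostSol hζ x)
        (hV.continuous_jostDer hζ).continuousOn
    simpa using aci_comp_neg this
  · rw [hV.deriv_jostSol_neg hζ]
    have := (aci_comp_neg (hV.aci_jostDer hζ (-a) (-b))).neg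
    simpa using! this
  · rw [hV.deriv_jostSol_neg hζ]
    have h1 : ∀ᵐ x, HasDerivAt (jostDer V ζ) ((V (-x) - ζ ^ 2) * jostSol V ζ (-x)) (-x) :=
      (Measure.measurePreserving_neg (volume : Measure ℝ)).quasiMeasurePreserving.ae
        (hV.ae_hasDerivAt_jostDer hζ)
    filter_upwards [h1] with x hx _
    have := (hx.scomp x (hasDerivAt_neg x)).neg.deriv
    simpa [Function.comp_def] using this

theorem continuousOn_jostM (x : ℝ) :
    ContinuousOn (fun ζ => jostM V ζ x) {ζ : ℂ | 0 ≤ ζ.im} :=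
  continuousOn_tsum (fun k => hV.continuousOn_jostTerm k x)
    (Real.summable_pow_div_factorial (tailMoment V x))
    fun k _ hζ => hV.norm_jostTerm_le hζ k le_rfl

theorem differentiableOn_jostM (x : ℝ) :
    DifferentiableOn ℂ (fun ζ => jostM V ζ x) {ζ : ℂ | 0 < ζ.im} :=
  Complex.differentiableOn_tsum_of_summable_norm (Real.summable_pow_div_factorial (tailMoment V x))
    (fun k => hV.differentiableOn_jostTerm k x) (isOpen_lt continuous_const Complex.continuous_im)
    fun k _ hζ => hV.norm_jostTerm_le (le_of_lt hζ) k le_rfl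

theorem continuousOn_jostN (x : ℝ) :
    ContinuousOn (fun ζ => jostN V ζ x) {ζ : ℂ | 0 ≤ ζ.im} :=
  (hV.continuousOn_volterraInner (fun _ hζ => hV.continuous_jostM hζ)
    (fun _ hζ _ ht => hV.norm_jostM_le_of_le hζ ht.le) hV.continuousOn_jostM).neg

theorem differentiableOn_jostN (x : ℝ) :
    DifferentiableOn ℂ (fun ζ => jostN V ζ x) {ζ : ℂ | 0 < ζ.im} :=
  (hV.differentiableOn_volterraInner (fun _ hζ => hV.continuous_jostM hζ)
    (fun _ hζ _ ht => hV.norm_jostM_le_of_le hζ ht.le) hV.differentiableOn_jostM).neg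

theorem continuousOn_jostSol (x : ℝ) :
    ContinuousOn (fun ζ => jostSol V ζ x) {ζ : ℂ | 0 ≤ ζ.im} :=
  (by fun_prop : Continuous fun ζ : ℂ => Complex.exp (Complex.I * ζ * x)).continuousOn.mul
    (hV.continuousOn_jostM x)

theorem differentiableOn_jostSol (x : ℝ) :
    DifferentiableOn ℂ (fun ζ => jostSol V ζ x) {ζ : ℂ | 0 < ζ.im} :=
  (by fun_prop : Differentiable ℂ fun ζ : ℂ => Complex.exp (Complex.I * ζ * x)).differentiableOn.mul
    (hV.differentiableOn_jostM x)

theorem continuousOn_jostDer (x : ℝ) :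
    ContinuousOn (fun ζ => jostDer V ζ x) {ζ : ℂ | 0 ≤ ζ.im} :=
  (by fun_prop : Continuous fun ζ : ℂ => Complex.exp (Complex.I * ζ * x)).continuousOn.mul
    (((by fun_prop : Continuous fun ζ : ℂ => Complex.I * ζ).continuousOn.mul
      (hV.continuousOn_jostM x)).add (hV.continuousOn_jostN x))

theorem differentiableOn_jostDer (x : ℝ) :
    DifferentiableOn ℂ (fun ζ => jostDer V ζ x) {ζ : ℂ | 0 < ζ.im} :=
  (by fun_prop : Differentiable ℂ fun ζ : ℂ => Complex.exp (Complex.I * ζ * x)).differentiableOn.mul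
    (((by fun_prop : Differentiable ℂ fun ζ : ℂ => Complex.I * ζ).differentiableOn.mul
      (hV.differentiableOn_jostM x)).add (hV.differentiableOn_jostN x))

/-- The behaviour of `jostM` at the origin for large spectral parameter. -/
theorem mul_one_sub_jostM {ζ : ℂ} (hζ : 0 ≤ ζ.im) :
    2 * Complex.I * ζ * (1 - jostM V ζ 0) = jostN V ζ 0 + ∫ t in Ioi (0 : ℝ), V t * jostM V ζ t := by
  have hi := hV.integrableOn_mul (hV.continuous_jostM hζ) (hV.tailBounded_jostM hζ)
  -- The function `m' + 2iζ m` has derivative `V m`; it is integrated over `(0,X)` and then `X → ∞`,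
  -- using `m → 1` and `m' → 0`.
  have h1 : ∀ X : ℝ, ∫ t in (0 : ℝ)..X, V t * jostM V ζ t =
      (jostN V ζ X + 2 * Complex.I * ζ * jostM V ζ X) -
        (jostN V ζ 0 + 2 * Complex.I * ζ * jostM V ζ 0) := by
    intro X
    refine aci_integral_eq_sub (f := fun x => jostN V ζ x + 2 * Complex.I * ζ * jostM V ζ x) ?_ ?_ ?_
    · exact (hV.aci_jostN hζ 0 X).add (aci_mul (aci_const _ 0 X) (aci_of_hasDerivAt
        (fun x _ => hV.hasDerivAt_jostM hζ x) (hV.continuous_jostN hζ).continuousOn))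
    · filter_upwards [hV.ae_hasDerivAt_jostN hζ] with x hx _
      refine (hx.add ((hV.hasDerivAt_jostM hζ x).const_mul _)).congr_deriv ?_
      ring
    · exact intervalIntegrable_of_tail hi 0 X
  have h2 := intervalIntegral_tendsto_integral_Ioi 0 (hi 0) tendsto_id
  have h3 := ((hV.tendsto_jostN hζ).add ((hV.tendsto_jostM hζ).const_mul
    (2 * Complex.I * ζ))).sub_const (jostN V ζ 0 + 2 * Complex.I * ζ * jostM V ζ 0)
  have := tendsto_nhds_unique h2 (h3.congr fun X => (h1 X).symm)
  rw [this]
  ring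

end TailIntegrable

/-! ### Real potentials with integrable first moment -/

structure FirstMoment (p : ℝ → ℝ) : Prop where
  meas : AEStronglyMeasurable p volume
  int : Integrable (fun x : ℝ => (1 + |x|) * |p x|) volume

theorem FirstMoment.comp_neg {p : ℝ → ℝ} (hp : FirstMoment p) : FirstMoment fun x => p (-x) := by
  refine ⟨hp.meas.comp_measurePreserving (Measure.measurePreserving_neg volume), ?_⟩
  simpa using hp.int.comp_neg

theorem FirstMoment.integrable {p : ℝ → ℝ} (hp : FirstMoment p) : Integrable p volume := by
  refine hp.int.mono' hp.meas (Eventually.of_forall fun x => ?_)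
  rw [Real.norm_eq_abs]
  nlinarith [abs_nonneg x, abs_nonneg (p x)]

theorem FirstMoment.tailIntegrable {p : ℝ → ℝ} (hp : FirstMoment p) :
    TailIntegrable fun x => (p x : ℂ) := by
  refine ⟨fun x => hp.integrable.ofReal.integrableOn, fun x => Integrable.integrableOn ?_⟩
  refine hp.int.mono' (continuous_id.aestronglyMeasurable.mul hp.integrable.ofReal.norm.aestronglyMeasurable)
    (Eventually.of_forall fun x => ?_)
  simp only [Complex.norm_real, Real.norm_eq_abs, abs_mul, abs_abs]
  nlinarith [abs_nonneg x, abs_nonneg (p x)]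

/-! ### The initial value problem at the origin -/

/-- The one-sided limits of `y` and `y'` at `0⁺`. -/
def HasData (y : ℝ → ℂ) (v₀ v₁ : ℂ) : Prop :=
  Tendsto y (𝓝[>] 0) (𝓝 v₀) ∧ Tendsto (deriv y) (𝓝[>] 0) (𝓝 v₁)

theorem HasData.congr {y z : ℝ → ℂ} {v₀ v₁ : ℂ} (h : HasData y v₀ v₁)
    (hz : ∀ x, 0 < x → y x = z x) : HasData z v₀ v₁ := by
  refine ⟨h.1.congr' ?_, h.2.congr' ?_⟩
  · filter_upwards [self_mem_nhdsWithin] with x hx using hz x hx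
  · filter_upwards [self_mem_nhdsWithin] with x hx
    refine EventuallyEq.deriv_eq ?_
    filter_upwards [Ioi_mem_nhds hx] with t ht using hz t ht

theorem HasData.add {V : ℝ → ℂ} {y z : ℝ → ℂ} {v₀ v₁ w₀ w₁ : ℂ} (h : HasData y v₀ v₁)
    (h' : HasData z w₀ w₁) (hy : HalfSol V y) (hz : HalfSol V z) :
    HasData (fun x => y x + z x) (v₀ + w₀) (v₁ + w₁) := by
  refine ⟨h.1.add h'.1, (h.2.add h'.2).congr' ?_⟩
  filter_upwards [self_mem_nhdsWithin] with x hx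
  exact (deriv_add (hy.diff x hx) (hz.diff x hx)).symm

theorem HasData.const_mul {y : ℝ → ℂ} {v₀ v₁ : ℂ} (h : HasData y v₀ v₁) (c : ℂ) :
    HasData (fun x => c * y x) (c * v₀) (c * v₁) := by
  refine ⟨h.1.const_mul c, (h.2.const_mul c).congr fun x => ?_⟩
  exact (deriv_const_mul_field c).symm

theorem HasData.conj {y : ℝ → ℂ} {v₀ v₁ : ℂ} (h : HasData y v₀ v₁) :
    HasData (fun x => (starRingEnd ℂ) (y x)) ((starRingEnd ℂ) v₀) ((starRingEnd ℂ) v₁) := by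
  refine ⟨(Complex.continuous_conj.tendsto _).comp h.1,
    ((Complex.continuous_conj.tendsto _).comp h.2).congr fun x => ?_⟩
  exact (deriv.star (f := y)).symm

theorem HasData.unique {y : ℝ → ℂ} {v₀ v₁ w₀ w₁ : ℂ} (h : HasData y v₀ v₁)
    (h' : HasData y w₀ w₁) : v₀ = w₀ ∧ v₁ = w₁ :=
  ⟨tendsto_nhds_unique h.1 h'.1, tendsto_nhds_unique h.2 h'.2⟩

theorem HalfSol.wronskian_eq_data {V : ℝ → ℂ} {y z : ℝ → ℂ} {v₀ v₁ w₀ w₁ : ℂ} (hy : HalfSol V y)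
    (hz : HalfSol V z) (h : HasData y v₀ v₁) (h' : HasData z w₀ w₁) {x : ℝ} (hx : 0 < x) :
    wronskian y z x = v₀ * w₁ - v₁ * w₀ := by
  have h1 : Tendsto (wronskian y z) (𝓝[>] 0) (𝓝 (v₀ * w₁ - v₁ * w₀)) :=
    (h.1.mul h'.2).sub (h.2.mul h'.1)
  have h2 : Tendsto (wronskian y z) (𝓝[>] 0) (𝓝 (wronskian y z x)) := by
    refine tendsto_const_nhds.congr' ?_
    filter_upwards [self_mem_nhdsWithin] with t ht using hy.wronskian_eq hz hx ht
  exact tendsto_nhds_unique h2 h1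

/-- The initial value problem is solved by the Jost construction. The reflected potential, shifted
by `κ² - lam`, is kept on `(-∞,0)` and replaced by zero on the right. The tails then vanish at `0`,
so the Neumann bounds force `m = 1` and `m' = 0` there. Thus the Jost solution at `κ` has data `(1,
iκ)`, and reflecting back changes the sign of the derivative. -/
theorem exists_halfSol_one {p : ℝ → ℝ} (hp : FirstMoment p) (lam : ℂ) (κ : ℝ) :
    ∃ y, HalfSol (fun x => (p x : ℂ) - lam) y ∧ HasData y 1 (-(Complex.I * κ)) := by
  set V : ℝ → ℂ := (Iio 0).indicator fun t => (p (-t) : ℂ) - lam + κ ^ 2 with hVdef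
  have hi : ∀ x, IntegrableOn (fun t => (p (-t) : ℂ) - lam + κ ^ 2) (Ioo x 0) := fun x =>
    (hp.comp_neg.integrable.ofReal.integrableOn.sub (by simp)).add (by simp)
  have hint : ∀ x, IntegrableOn V (Ioi x) := by
    intro x
    rw [IntegrableOn, hVdef, integrable_indicator_iff measurableSet_Iio, IntegrableOn,
      Measure.restrict_restrict measurableSet_Iio, inter_comm, Ioi_inter_Iio]
    exact hi x
  have hV : TailIntegrable V := by
    refine ⟨hint, fun x => ?_⟩
    refine ((hint x).norm.const_mul |x|).mono'
      (continuous_id.aestronglyMeasurable.mul (hint x).norm.aestronglyMeasurable) ?_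
    filter_upwards [ae_restrict_mem measurableSet_Ioi] with t ht
    have ht : x < t := ht
    rw [norm_mul, norm_norm]
    by_cases h0 : t < 0
    · gcongr
      rw [Real.norm_eq_abs, abs_of_neg h0, abs_of_neg (ht.trans h0)]
      linarith
    · have : V t = 0 := indicator_of_notMem (s := Iio (0 : ℝ)) (a := t) h0 _
      simp [this]
  have hκ : 0 ≤ (κ : ℂ).im := by simp
  have hr : tailNorm V 0 = 0 := by
    refine setIntegral_eq_zero_of_forall_eq_zero fun t ht => ?_
    have : V t = 0 := indicator_of_notMem (s := Iio (0 : ℝ)) (a := t) (fun h => lt_asymm (mem_Iio.1 h) ht) _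
    simp [this]
  have hQ : tailMoment V 0 = 0 := by
    refine setIntegral_eq_zero_of_forall_eq_zero fun t ht => ?_
    exact le_antisymm (hr ▸ hV.tailNorm_antitone (le_of_lt ht)) (tailNorm_nonneg V t)
  have hm : jostM V κ 0 = 1 := by
    have := hV.norm_jostM_sub_one_le hκ 0
    rw [hQ, Real.exp_zero, sub_self] at this
    exact sub_eq_zero.1 (norm_le_zero_iff.1 this)
  have hn : jostN V κ 0 = 0 := by
    have := hV.norm_jostN_le hκ 0
    rw [hr, zero_mul] at this
    exact norm_le_zero_iff.1 this
  refine ⟨fun x => jostSol V κ (-x), (hV.halfSol_jostSol_neg hκ).congr_potential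
    (Eventually.of_forall fun x hx => ?_), ?_, ?_⟩
  · have : -x ∈ Iio (0 : ℝ) := by simpa using hx
    rw [hVdef, indicator_of_mem this, neg_neg]
    ring
  · have h1 : Continuous fun x => jostSol V κ (-x) := (hV.continuous_jostSol hκ).comp continuous_neg
    have h2 := (h1.tendsto 0).mono_left (nhdsWithin_le_nhds (s := Ioi 0))
    simpa [jostSol, hm] using h2
  · rw [hV.deriv_jostSol_neg hκ]
    have h1 : Continuous fun x => -jostDer V κ (-x) :=
      ((hV.continuous_jostDer hκ).comp continuous_neg).neg
    have h2 := (h1.tendsto 0).mono_left (nhdsWithin_le_nhds (s := Ioi 0))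
    simpa [jostDer, hm, hn] using h2

theorem exists_halfSol {p : ℝ → ℝ} (hp : FirstMoment p) (lam v₀ v₁ : ℂ) :
    ∃ y, HalfSol (fun x => (p x : ℂ) - lam) y ∧ HasData y v₀ v₁ := by
  -- The values `κ = 0` and `κ = 1` give the independent data `(1, 0)` and `(1, -i)`.
  obtain ⟨y, hy, dy⟩ := exists_halfSol_one hp lam 0
  obtain ⟨z, hz, dz⟩ := exists_halfSol_one hp lam 1
  refine ⟨_, (hy.const_mul (v₀ - Complex.I * v₁)).add (hz.const_mul (Complex.I * v₁)), ?_⟩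
  convert (dy.const_mul (v₀ - Complex.I * v₁)).add (dz.const_mul (Complex.I * v₁))
    (hy.const_mul _) (hz.const_mul _) using 1
  · ring
  · simp only [Complex.ofReal_zero, mul_zero, neg_zero, Complex.ofReal_one, mul_one, zero_add]
    linear_combination v₁ * Complex.I_sq

/-- With `z, w` a fundamental system of Wronskian one, `y` is a combination of `z` and `w` whose
coefficients are, up to sign, its Wronskians with `w` and `z`. All uniqueness statements on the
half-line follow from this. -/
theorem HalfSol.eq_zero_of_wronskian {p : ℝ → ℝ} (hp : FirstMoment p) {lam : ℂ} {y : ℝ → ℂ}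
    (hy : HalfSol (fun x => (p x : ℂ) - lam) y)
    (h : ∀ z v₀ v₁, HalfSol (fun x => (p x : ℂ) - lam) z → HasData z v₀ v₁ →
      ∃ a, 0 < a ∧ wronskian y z a = 0) {x : ℝ} (hx : 0 < x) : y x = 0 := by
  obtain ⟨z, hz, dz⟩ := exists_halfSol hp lam 1 0
  obtain ⟨w, hw, dw⟩ := exists_halfSol hp lam 0 1
  obtain ⟨a, ha, hza⟩ := h z _ _ hz dz
  obtain ⟨b, hb, hwb⟩ := h w _ _ hw dw
  have h1 : wronskian z w x = 1 := by rw [hz.wronskian_eq_data hw dz dw hx]; ring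
  rw [hy.wronskian_eq hz ha hx] at hza
  rw [hy.wronskian_eq hw hb hx] at hwb
  simp only [wronskian] at h1 hza hwb
  linear_combination (-y x) * h1 + z x * hwb - w x * hza

theorem HalfSol.eq_zero_of_data {p : ℝ → ℝ} (hp : FirstMoment p) {lam : ℂ} {y : ℝ → ℂ}
    (hy : HalfSol (fun x => (p x : ℂ) - lam) y) (h : HasData y 0 0) {x : ℝ} (hx : 0 < x) :
    y x = 0 :=
  hy.eq_zero_of_wronskian hp (fun z v₀ v₁ hz dz => ⟨1, one_pos, by
    rw [hy.wronskian_eq_data hz h dz one_pos]; ring⟩) hx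

theorem HalfSol.eq_of_data {p : ℝ → ℝ} (hp : FirstMoment p) {lam v₀ v₁ : ℂ} {y z : ℝ → ℂ}
    (hy : HalfSol (fun x => (p x : ℂ) - lam) y) (hz : HalfSol (fun x => (p x : ℂ) - lam) z)
    (h : HasData y v₀ v₁) (h' : HasData z v₀ v₁) {x : ℝ} (hx : 0 < x) : y x = z x := by
  have h1 := (hy.add (hz.const_mul (-1))).eq_zero_of_data hp (by
    simpa using h.add (h'.const_mul (-1)) hy (hz.const_mul (-1))) hx
  linear_combination h1

theorem HalfSol.eq_zero_of_point {p : ℝ → ℝ} (hp : FirstMoment p) {lam : ℂ} {y : ℝ → ℂ}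
    (hy : HalfSol (fun x => (p x : ℂ) - lam) y) {a : ℝ} (ha : 0 < a) (h0 : y a = 0)
    (h1 : deriv y a = 0) {x : ℝ} (hx : 0 < x) : y x = 0 :=
  hy.eq_zero_of_wronskian hp (fun z _ _ _ _ => ⟨a, ha, by simp [wronskian, h0, h1]⟩) hx

theorem HalfSol.eq_const_mul {p : ℝ → ℝ} (hp : FirstMoment p) {lam : ℂ} {f y : ℝ → ℂ}
    (hf : HalfSol (fun x => (p x : ℂ) - lam) f) (hy : HalfSol (fun x => (p x : ℂ) - lam) y)
    {a : ℝ} (ha : 0 < a) (hfa : f a ≠ 0) (hw : wronskian f y a = 0) :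
    ∃ c, ∀ x, 0 < x → y x = c * f x := by
  refine ⟨y a / f a, fun x hx => ?_⟩
  have key := (hy.add (hf.const_mul (-(y a / f a)))).eq_zero_of_point hp ha
    (by field_simp; ring) (by
      have e : deriv (fun x => y x + -(y a / f a) * f x) a =
          deriv y a + -(y a / f a) * deriv f a := by
        refine (deriv_add (hy.diff a ha) ((hf.diff a ha).const_mul _)).trans ?_
        rw [deriv_const_mul_field]
      rw [e]
      simp only [wronskian] at hw
      field_simp
      linear_combination hw) hx
  linear_combination key

/-! ### The Jost solution of a half-line -/

/-- The Jost solution for a real potential, without a point interaction. -/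
noncomputable def halfJost (p : ℝ → ℝ) (ζ : ℂ) : ℝ → ℂ := jostSol (fun x => (p x : ℂ)) ζ

/-- The derivative of `halfJost`. -/
noncomputable def halfJostDer (p : ℝ → ℝ) (ζ : ℂ) : ℝ → ℂ := jostDer (fun x => (p x : ℂ)) ζ

namespace FirstMoment

variable {p : ℝ → ℝ} (hp : FirstMoment p) {ζ : ℂ} (hζ : 0 ≤ ζ.im)
include hp hζ

theorem halfSol_halfJost : HalfSol (fun x => (p x : ℂ) - ζ ^ 2) (halfJost p ζ) :=
  hp.tailIntegrable.halfSol_jostSol hζ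

theorem hasDerivAt_halfJost (x : ℝ) : HasDerivAt (halfJost p ζ) (halfJostDer p ζ x) x :=
  hp.tailIntegrable.hasDerivAt_jostSol hζ x

theorem deriv_halfJost : deriv (halfJost p ζ) = halfJostDer p ζ :=
  hp.tailIntegrable.deriv_jostSol hζ

theorem continuous_halfJost : Continuous (halfJost p ζ) := hp.tailIntegrable.continuous_jostSol hζ

theorem continuous_halfJostDer : Continuous (halfJostDer p ζ) :=
  hp.tailIntegrable.continuous_jostDer hζ

theorem hasData_halfJost : HasData (halfJost p ζ) (halfJost p ζ 0) (halfJostDer p ζ 0) := by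
  refine ⟨(hp.continuous_halfJost hζ).tendsto 0 |>.mono_left nhdsWithin_le_nhds, ?_⟩
  rw [hp.deriv_halfJost hζ]
  exact (hp.continuous_halfJostDer hζ).tendsto 0 |>.mono_left nhdsWithin_le_nhds

theorem tendsto_exp_mul_halfJost :
    Tendsto (fun x : ℝ => Complex.exp (-(Complex.I * ζ * x)) * halfJost p ζ x) atTop (𝓝 1) := by
  refine (hp.tailIntegrable.tendsto_jostM hζ).congr fun x => ?_
  rw [halfJost, jostSol, ← mul_assoc, ← Complex.exp_add, neg_add_cancel, Complex.exp_zero, one_mul]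

theorem exists_halfJost_ne_zero : ∃ a, 0 < a ∧ halfJost p ζ a ≠ 0 := by
  have h := (hp.tendsto_exp_mul_halfJost hζ).eventually_ne one_ne_zero
  obtain ⟨a, h1, h2⟩ := (h.and (eventually_gt_atTop 0)).exists
  exact ⟨a, h2, right_ne_zero_of_mul h1⟩

theorem halfJost_data_ne_zero : ¬ (halfJost p ζ 0 = 0 ∧ halfJostDer p ζ 0 = 0) := by
  rintro ⟨h0, h1⟩
  obtain ⟨a, ha, hne⟩ := hp.exists_halfJost_ne_zero hζ
  have hd := hp.hasData_halfJost hζ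
  rw [h0, h1] at hd
  exact hne ((hp.halfSol_halfJost hζ).eq_zero_of_data hp hd ha)

/-- A multiple of the Jost solution is recognized by a vanishing Wronskian. -/
theorem eq_const_mul_halfJost {y : ℝ → ℂ} (hy : HalfSol (fun x => (p x : ℂ) - ζ ^ 2) y) {a : ℝ}
    (ha : 0 < a) (hw : wronskian (halfJost p ζ) y a = 0) :
    ∃ c, ∀ x, 0 < x → y x = c * halfJost p ζ x := by
  obtain ⟨b, hb, hne⟩ := hp.exists_halfJost_ne_zero hζ
  rw [(hp.halfSol_halfJost hζ).wronskian_eq hy ha hb] at hw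
  exact (hp.halfSol_halfJost hζ).eq_const_mul hp hy hb hne hw

/-- Uniqueness of the Jost solution. -/
theorem eq_zero_of_tendsto (h0 : ζ ≠ 0) {y : ℝ → ℂ}
    (hy : HalfSol (fun x => (p x : ℂ) - ζ ^ 2) y)
    (hlim : Tendsto (fun x : ℝ => Complex.exp (-(Complex.I * ζ * x)) * y x) atTop (𝓝 0))
    {x : ℝ} (hx : 0 < x) : y x = 0 := by
  have hV := hp.tailIntegrable
  set m := jostM (fun x => (p x : ℂ)) ζ
  set n := jostN (fun x => (p x : ℂ)) ζ
  set e : ℝ → ℂ := fun x => Complex.exp (-(Complex.I * ζ) * x) * y x with he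
  have hlim : Tendsto e atTop (𝓝 0) := by simpa [he, neg_mul] using hlim
  set w := wronskian (halfJost p ζ) y 1 with hw
  set c : ℂ := -(2 * Complex.I * ζ) with hc
  have hc0 : c ≠ 0 := by simp [hc, h0, Complex.I_ne_zero]
  -- With `e = e^{-iζx} y` and the constant Wronskian `w`, one has `(m e)' = 2 m' e + w e^{cx}`;
  -- subtracting a primitive of the last term leaves a function whose derivative tends to zero.
  set g : ℝ → ℂ := fun x => m x * e x - w / c * Complex.exp (c * x) with hg
  have hder : ∀ x, 0 < x → HasDerivAt g (2 * (n x * e x)) x := by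
    intro x hx
    have h1 := (hasDerivAt_exp_linear (-(Complex.I * ζ)) x).mul (hy.diff x hx).hasDerivAt
    have h2 := ((hV.hasDerivAt_jostM hζ x).mul h1).sub
      ((hasDerivAt_exp_linear c x).const_mul (w / c))
    refine h2.congr_deriv ?_
    have hwx : w = halfJost p ζ x * deriv y x - halfJostDer p ζ x * y x := by
      rw [hw, (hp.halfSol_halfJost hζ).wronskian_eq hy one_pos hx, wronskian,
        hp.deriv_halfJost hζ]
    have hexp : Complex.exp (c * x) * Complex.exp (Complex.I * ζ * x) =
        Complex.exp (-(Complex.I * ζ) * x) := by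
      rw [← Complex.exp_add]
      congr 1
      rw [hc]
      ring
    have hwc : w / c * (Complex.exp (c * x) * c) = Complex.exp (-(Complex.I * ζ) * x) *
        (m x * deriv y x - (Complex.I * ζ * m x + n x) * y x) := by
      rw [← hexp]
      field_simp
      rw [hwx, halfJost, halfJostDer, jostSol, jostDer]
      simp only [m, n]
      ring_nf
    rw [hwc, he]
    simp only [Pi.mul_apply]
    ring
  have hne : Tendsto (fun x => 2 * (n x * e x)) atTop (𝓝 0) := by
    simpa using ((hV.tendsto_jostN hζ).mul hlim).const_mul 2
  have hme : Tendsto (fun x => m x * e x) atTop (𝓝 0) := by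
    simpa using (hV.tendsto_jostM hζ).mul hlim
  -- Over a step of length `δ` the increments of `g` and of `m e` both tend to zero, hence so do
  -- those of `(w/c) e^{cx}`. As `|e^{cx}| ≥ 1` for `x ≥ 0`, this forces `w = 0` unless `e^{cδ} =
  -- 1`. The choice of `δ` makes `|cδ| = 2`, which is less than `2π` and rules that out.
  set δ : ℝ := 1 / ‖ζ‖ with hδ
  have hδ0 : 0 < δ := by positivity
  have hdiff : Tendsto (fun x => g (x + δ) - g x) atTop (𝓝 0) := by
    rw [Metric.tendsto_atTop]
    intro ε hε
    obtain ⟨X, hX⟩ := (Metric.tendsto_atTop.1 hne) (ε / (2 * δ)) (by positivity)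
    refine ⟨max X 1, fun x hx => ?_⟩
    have hx1 : 1 ≤ x := (le_max_right _ _).trans hx
    have hxX : X ≤ x := (le_max_left _ _).trans hx
    have := (convex_Icc x (x + δ)).norm_image_sub_le_of_norm_hasDerivWithin_le
      (f := g) (f' := fun x => 2 * (n x * e x)) (C := ε / (2 * δ))
      (fun t ht => (hder t (by linarith [ht.1])).hasDerivWithinAt)
      (fun t ht => by simpa using (hX t (hxX.trans ht.1)).le)
      (left_mem_Icc.2 (by linarith)) (right_mem_Icc.2 (by linarith))
    rw [dist_zero_right]
    refine this.trans_lt ?_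
    rw [add_sub_cancel_left, Real.norm_of_nonneg hδ0.le]
    field_simp
    linarith
  have hexp : Tendsto (fun x : ℝ => w / c * (Complex.exp (c * δ) - 1) * Complex.exp (c * x))
      atTop (𝓝 0) := by
    have h1 := ((hme.comp (tendsto_atTop_add_const_right atTop δ tendsto_id)).sub hme).sub hdiff
    simp only [sub_zero] at h1
    refine h1.congr fun x => ?_
    simp only [hg, Function.comp_apply, id]
    push_cast
    rw [mul_add, Complex.exp_add]
    ring
  have hw0 : w = 0 := by
    by_contra hwne
    have hE : Complex.exp (c * δ) - 1 ≠ 0 := by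
      rw [sub_ne_zero, Ne, Complex.exp_eq_one_iff]
      rintro ⟨k, hk⟩
      have h2 : ‖c * δ‖ = 2 := by
        rw [norm_mul, hc, norm_neg, norm_mul, norm_mul, Complex.norm_I, Complex.norm_real,
          Real.norm_of_nonneg hδ0.le, hδ]
        have : ‖ζ‖ ≠ 0 := norm_ne_zero_iff.2 h0
        field_simp
        simp
      rw [hk, norm_mul, norm_mul, norm_mul, Complex.norm_I, Complex.norm_real,
        Real.norm_of_nonneg Real.pi_pos.le, Complex.norm_intCast] at h2
      have h3 : |(k : ℝ)| * Real.pi = 1 := by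
        simp at h2
        linarith
      rcases eq_or_ne k 0 with rfl | hk0
      · simp at h3
      · have h4 : (1 : ℝ) ≤ |(k : ℝ)| := by exact_mod_cast Int.one_le_abs hk0
        nlinarith [Real.pi_gt_three]
    have h1 := (tendsto_norm_zero.comp hexp)
    have h2 : ∀ᶠ x : ℝ in atTop, ‖w / c * (Complex.exp (c * δ) - 1)‖ ≤
        ‖w / c * (Complex.exp (c * δ) - 1) * Complex.exp (c * x)‖ := by
      filter_upwards [eventually_ge_atTop 0] with x hx
      rw [norm_mul _ (Complex.exp (c * x))]
      refine le_mul_of_one_le_right (norm_nonneg _) ?_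
      rw [Complex.norm_exp, hc, Real.one_le_exp_iff]
      have := mul_nonneg hζ hx
      simp [Complex.mul_re, Complex.mul_im]
      linarith
    have h3 := ge_of_tendsto h1 h2
    have h4 : 0 < ‖w / c * (Complex.exp (c * δ) - 1)‖ :=
      norm_pos_iff.2 (mul_ne_zero (div_ne_zero hwne hc0) hE)
    linarith
  obtain ⟨k, hk⟩ := hp.eq_const_mul_halfJost hζ hy one_pos (hw ▸ hw0)
  have hk0 : k = 0 := by
    have h1 : Tendsto (fun x => k * m x) atTop (𝓝 (k * 1)) :=
      (hV.tendsto_jostM hζ).const_mul k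
    have h2 : Tendsto (fun x => k * m x) atTop (𝓝 0) := by
      refine hlim.congr' ?_
      filter_upwards [eventually_gt_atTop 0] with x hx
      rw [he]
      simp only
      rw [hk x hx, halfJost, jostSol]
      have : Complex.exp (-(Complex.I * ζ) * x) * Complex.exp (Complex.I * ζ * x) = 1 := by
        rw [← Complex.exp_add, Complex.exp_eq_one_iff]
        exact ⟨0, by push_cast; ring⟩
      linear_combination (k * m x) * this
    simpa using tendsto_nhds_unique h1 h2
  rw [hk x hx, hk0, zero_mul]

/-! ### Square integrable solutions -/

theorem norm_halfJost_le {x : ℝ} (hx : 0 ≤ x) :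
    ‖halfJost p ζ x‖ ≤
      Real.exp (-(ζ.im * x)) * Real.exp (tailMoment (fun x => (p x : ℂ)) 0) := by
  rw [halfJost, jostSol, norm_mul, Complex.norm_exp]
  refine mul_le_mul (le_of_eq ?_) (hp.tailIntegrable.norm_jostM_le_of_le hζ hx) (norm_nonneg _)
    (Real.exp_pos _).le
  simp [Complex.mul_re, Complex.mul_im]

theorem norm_halfJostDer_le {x : ℝ} (hx : 0 ≤ x) :
    ‖halfJostDer p ζ x‖ ≤ Real.exp (-(ζ.im * x)) * ((‖ζ‖ + tailNorm (fun x => (p x : ℂ)) 0) *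
      Real.exp (tailMoment (fun x => (p x : ℂ)) 0)) := by
  have hV := hp.tailIntegrable
  rw [halfJostDer, jostDer, norm_mul, Complex.norm_exp]
  have h0 := tailNorm_nonneg (fun x => (p x : ℂ)) x
  refine mul_le_mul (le_of_eq ?_) ?_ (norm_nonneg _) (Real.exp_pos _).le
  · simp [Complex.mul_re, Complex.mul_im]
  · rw [add_mul]
    refine (norm_add_le _ _).trans (add_le_add ?_ ?_)
    · rw [norm_mul, norm_mul, Complex.norm_I, one_mul]
      gcongr
      exact hV.norm_jostM_le_of_le hζ hx
    · refine (hV.norm_jostN_le hζ x).trans ?_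
      gcongr
      · exact tailNorm_nonneg _ _
      · exact hV.tailNorm_antitone hx
      · exact hV.tailMoment_antitone hx

/-- A square integrable solution is a multiple of the Jost solution. -/
theorem eq_const_mul_of_memLp {y : ℝ → ℂ} (hy : HalfSol (fun x => (p x : ℂ) - ζ ^ 2) y)
    (h2 : MemLp y 2 volume) : ∃ c, ∀ x, 0 < x → y x = c * halfJost p ζ x := by
  set f := halfJost p ζ
  refine hp.eq_const_mul_halfJost hζ hy one_pos ?_
  by_contra hw
  set w := wronskian f y 1
  have hf := hp.halfSol_halfJost hζ
  set K : ℝ := max (Real.exp (tailMoment (fun x => (p x : ℂ)) 0))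
    ((‖ζ‖ + tailNorm (fun x => (p x : ℂ)) 0) * Real.exp (tailMoment (fun x => (p x : ℂ)) 0))
  have hK0 : 0 < K := lt_max_of_lt_left (Real.exp_pos _)
  have hexp : ∀ x : ℝ, 0 ≤ x → Real.exp (-(ζ.im * x)) ≤ 1 := fun x hx =>
    Real.exp_le_one_iff.2 (neg_nonpos.2 (mul_nonneg hζ hx))
  have hfK : ∀ x, 0 ≤ x → ‖f x‖ ≤ K := fun x hx => by
    refine (hp.norm_halfJost_le hζ hx).trans ?_
    refine (mul_le_of_le_one_left (Real.exp_pos _).le (hexp x hx)).trans (le_max_left _ _)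
  have hdK : ∀ x, 0 ≤ x → ‖deriv f x‖ ≤ K := fun x hx => by
    rw [hp.deriv_halfJost hζ]
    refine (hp.norm_halfJostDer_le hζ hx).trans ?_
    have h0 := tailNorm_nonneg (fun x => (p x : ℂ)) 0
    refine (mul_le_of_le_one_left (by positivity) (hexp x hx)).trans (le_max_right _ _)
  have hy2 : Integrable (fun x => ‖y x‖ ^ 2) volume := h2.integrable_norm_pow (by norm_num)
  set J := ∫ x, ‖y x‖ ^ 2
  have hw0 : 0 < ‖w‖ := norm_pos_iff.2 hw
  set B : ℝ := 4 * K ^ 2 / ‖w‖ * J + ‖f 1 * y 1‖ with hB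
  -- If the Wronskian `w` is nonzero, then `(f y)' = w + 2 f' y`. As `f'` is bounded and `y` is in
  -- `L²`, Young's inequality lets the last term absorb at most half of the linear growth. So `f y`
  -- grows linearly; since `f` is bounded, `|y| ≥ 1` eventually, contradicting square integrability.
  have key : ∀ x, 1 ≤ x → ‖w‖ / 2 * (x - 1) - B ≤ ‖f x * y x‖ := by
    intro x hx
    have hpos : ∀ t ∈ uIcc 1 x, 0 < t := fun t ht => by
      rw [uIcc_of_le hx] at ht; linarith [ht.1]
    have hcont : ContinuousOn (fun t => deriv f t * y t) (uIcc 1 x) :=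
      (hf.continuousOn_deriv.mono hpos).mul (hy.continuousOn.mono hpos)
    have h3 : ∫ t in (1 : ℝ)..x, (w + 2 * (deriv f t * y t)) = f x * y x - f 1 * y 1 := by
      refine intervalIntegral.integral_eq_sub_of_hasDerivAt (f := fun t => f t * y t)
        (fun t ht => ?_) (ContinuousOn.intervalIntegrable (by fun_prop))
      have ht := hpos t ht
      refine ((hf.diff t ht).hasDerivAt.mul (hy.diff t ht).hasDerivAt).congr_deriv ?_
      have : w = f t * deriv y t - deriv f t * y t := hf.wronskian_eq hy one_pos ht
      rw [this]
      ring
    rw [intervalIntegral.integral_add (by simp) (hcont.intervalIntegrable.const_mul 2),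
      intervalIntegral.integral_const, intervalIntegral.integral_const_mul] at h3
    have h4 : ‖∫ t in (1 : ℝ)..x, deriv f t * y t‖ ≤ ‖w‖ / 4 * (x - 1) + 2 * K ^ 2 / ‖w‖ * J := by
      have hyi : IntervalIntegrable (fun t => ‖y t‖ ^ 2) volume 1 x := hy2.intervalIntegrable
      calc ‖∫ t in (1 : ℝ)..x, deriv f t * y t‖
          ≤ ∫ t in (1 : ℝ)..x, ‖deriv f t * y t‖ :=
            intervalIntegral.norm_integral_le_integral_norm hx
        _ ≤ ∫ t in (1 : ℝ)..x, (‖w‖ / 4 + 2 * K ^ 2 / ‖w‖ * ‖y t‖ ^ 2) := by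
            refine intervalIntegral.integral_mono_on hx hcont.norm.intervalIntegrable
              ((by simp : IntervalIntegrable (fun _ : ℝ => ‖w‖ / 4) volume 1 x).add
                (hyi.const_mul _)) fun t ht => ?_
            rw [norm_mul]
            have h5 := hdK t (by linarith [ht.1])
            have h6 : ‖deriv f t‖ * ‖y t‖ ≤ K * ‖y t‖ := by gcongr
            refine h6.trans ?_
            rw [← sub_nonneg]
            have : ‖w‖ / 4 + 2 * K ^ 2 / ‖w‖ * ‖y t‖ ^ 2 - K * ‖y t‖ =
              ((‖w‖ - 2 * K * ‖y t‖) ^ 2 + 4 * K ^ 2 * ‖y t‖ ^ 2) / (4 * ‖w‖) := by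
              field_simp
              ring
            rw [this]
            positivity
        _ = ‖w‖ / 4 * (x - 1) + 2 * K ^ 2 / ‖w‖ * ∫ t in (1 : ℝ)..x, ‖y t‖ ^ 2 := by
            rw [intervalIntegral.integral_add (by simp) (hyi.const_mul _),
              intervalIntegral.integral_const, intervalIntegral.integral_const_mul, smul_eq_mul,
              mul_comm (x - 1)]
        _ ≤ _ := by
            gcongr
            rw [intervalIntegral.integral_of_le hx]
            exact setIntegral_le_integral hy2 (Eventually.of_forall fun t => by positivity)
    have h5 : (x - 1) • w = f x * y x - f 1 * y 1 - 2 * ∫ t in (1 : ℝ)..x, deriv f t * y t := by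
      rw [← h3]; ring
    have h6 := congrArg norm h5
    rw [norm_smul, Real.norm_of_nonneg (by linarith)] at h6
    have h7 := norm_sub_le (f x * y x - f 1 * y 1) (2 * ∫ t in (1 : ℝ)..x, deriv f t * y t)
    have h8 := norm_sub_le (f x * y x) (f 1 * y 1)
    rw [norm_mul (2 : ℂ), Complex.norm_two] at h7
    have h9 : 4 * K ^ 2 / ‖w‖ * J = 2 * (2 * K ^ 2 / ‖w‖ * J) := by ring
    rw [hB, h9]
    linarith
  set X : ℝ := 1 + (K + |B|) * 2 / ‖w‖ with hX
  have hX1 : 1 ≤ X := by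
    have : 0 ≤ (K + |B|) * 2 / ‖w‖ := by positivity
    linarith
  have hy1 : ∀ x ∈ Ioi X, (1 : ℝ) ≤ ‖y x‖ ^ 2 := by
    intro x hx
    have hx : X < x := hx
    have h3 := key x (by linarith)
    have h4 : ‖w‖ / 2 * (X - 1) ≤ ‖w‖ / 2 * (x - 1) := by gcongr
    have h5 : ‖w‖ / 2 * (X - 1) = K + |B| := by
      rw [hX]; field_simp; ring
    rw [norm_mul] at h3
    have h6 : ‖f x‖ * ‖y x‖ ≤ K * ‖y x‖ := by
      gcongr
      exact hfK x (by linarith)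
    have h7 : 1 ≤ ‖y x‖ := by
      have := le_abs_self B
      by_contra h
      have : K * ‖y x‖ < K * 1 := by
        gcongr
        exact not_le.1 h
      linarith
    nlinarith
  have h8 : IntegrableOn (fun _ : ℝ => (1 : ℝ)) (Ioi X) := by
    refine hy2.integrableOn.mono' aestronglyMeasurable_const ?_
    filter_upwards [ae_restrict_mem measurableSet_Ioi] with x hx
    simpa using hy1 x hx
  rw [integrableOn_const_iff] at h8
  simp at h8

/-- For real `ζ` there is no square integrable solution on the half-line. -/
theorem eq_zero_of_memLp (him : ζ.im = 0) {y : ℝ → ℂ}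
    (hy : HalfSol (fun x => (p x : ℂ) - ζ ^ 2) y) (h2 : MemLp y 2 volume) {x : ℝ} (hx : 0 < x) :
    y x = 0 := by
  obtain ⟨c, hc⟩ := hp.eq_const_mul_of_memLp hζ hy h2
  suffices c = 0 by rw [hc x hx, this, zero_mul]
  by_contra hc0
  have h1 : Tendsto (fun x => ‖y x‖) atTop (𝓝 ‖c‖) := by
    have := ((hp.tailIntegrable.tendsto_jostM hζ).norm).const_mul ‖c‖
    rw [norm_one, mul_one] at this
    refine this.congr' ?_
    filter_upwards [eventually_gt_atTop 0] with x hx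
    rw [hc x hx, norm_mul, halfJost, jostSol, norm_mul, Complex.norm_exp]
    simp [Complex.mul_re, Complex.mul_im, him]
  have hcpos : 0 < ‖c‖ := norm_pos_iff.2 hc0
  obtain ⟨X, hX⟩ := eventually_atTop.1 (h1.eventually (lt_mem_nhds (half_lt_self hcpos)))
  have hy2 : Integrable (fun x => ‖y x‖ ^ 2) volume := h2.integrable_norm_pow (by norm_num)
  have h8 : IntegrableOn (fun _ : ℝ => (‖c‖ / 2) ^ 2) (Ioi X) := by
    refine hy2.integrableOn.mono' aestronglyMeasurable_const ?_
    filter_upwards [ae_restrict_mem measurableSet_Ioi] with x hx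
    rw [Real.norm_of_nonneg (by positivity)]
    have := hX x (le_of_lt hx)
    gcongr
  rw [integrableOn_const_iff] at h8
  simp [hc0] at h8

end FirstMoment

/-! ### Laplace integrals at small parameter -/

theorem tendsto_exp_neg_mul_atTop {a : ℝ} (ha : 0 < a) :
    Tendsto (fun x : ℝ => Real.exp (-(a * x))) atTop (𝓝 0) :=
  Real.tendsto_exp_neg_atTop_nhds_zero.comp (tendsto_id.const_mul_atTop ha)

theorem mul_integral_exp {ζ : ℂ} (hζ : 0 < ζ.im) :
    ζ * ∫ x in Ioi (0 : ℝ), Complex.exp (Complex.I * ζ * x) = Complex.I := by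
  have h0 : ζ ≠ 0 := by rintro rfl; simp at hζ
  rw [integral_exp_mul_complex_Ioi (by simpa using hζ)]
  simp only [Complex.ofReal_zero, mul_zero, Complex.exp_zero]
  field_simp
  simp

/-- An Abelian mean of a bounded function vanishing at infinity: substitute `u = η x`, then apply
dominated convergence. -/
theorem tendsto_mul_integral_exp_mul {h : ℝ → ℝ} (hc : Continuous h)
    (hlim : Tendsto h atTop (𝓝 0)) {K : ℝ} (hK : ∀ x, 0 ≤ x → |h x| ≤ K) :
    Tendsto (fun η : ℝ => η * ∫ x in Ioi (0 : ℝ), Real.exp (-(η * x)) * h x) (𝓝[>] 0) (𝓝 0) := by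
  have h1 : Tendsto (fun η : ℝ => ∫ u in Ioi (0 : ℝ), Real.exp (-u) * h (η⁻¹ * u)) (𝓝[>] 0)
      (𝓝 (∫ u in Ioi (0 : ℝ), (0 : ℝ))) := by
    refine tendsto_integral_filter_of_dominated_convergence (fun u => Real.exp (-u) * K)
      (Eventually.of_forall fun η => (by fun_prop : Continuous fun u =>
        Real.exp (-u) * h (η⁻¹ * u)).aestronglyMeasurable) ?_ ?_ ?_
    · filter_upwards [self_mem_nhdsWithin] with η hη
      filter_upwards [ae_restrict_mem measurableSet_Ioi] with u hu
      rw [norm_mul, Real.norm_of_nonneg (Real.exp_pos _).le, Real.norm_eq_abs]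
      have : 0 ≤ η⁻¹ * u := mul_nonneg (inv_nonneg.2 (le_of_lt hη)) (le_of_lt hu)
      gcongr
      exact hK _ this
    · have := (integrableOn_exp_mul_Ioi (a := -1) (by norm_num) 0).mul_const K
      simpa using this
    · filter_upwards [ae_restrict_mem measurableSet_Ioi] with u hu
      have h2 : Tendsto (fun η : ℝ => η⁻¹ * u) (𝓝[>] 0) atTop :=
        tendsto_inv_nhdsGT_zero.atTop_mul_const hu
      simpa using (hlim.comp h2).const_mul (Real.exp (-u))
  rw [integral_zero] at h1
  refine h1.congr' ?_
  filter_upwards [self_mem_nhdsWithin] with η hη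
  have hη : 0 < η := hη
  have h3 := integral_comp_mul_left_Ioi (fun u => Real.exp (-u) * h (η⁻¹ * u)) 0 hη
  simp only [mul_zero, smul_eq_mul] at h3
  have h4 : ∀ x, η⁻¹ * (η * x) = x := fun x => by field_simp
  simp only [h4] at h3
  rw [h3]
  field_simp

namespace FirstMoment

variable {p : ℝ → ℝ} (hp : FirstMoment p)
include hp

/-! ### Integral identities on the half-line -/

theorem tendsto_halfJost {ζ : ℂ} (hζ : 0 < ζ.im) : Tendsto (halfJost p ζ) atTop (𝓝 0) := by
  refine squeeze_zero_norm' (a := fun x => Real.exp (-(ζ.im * x)) *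
    Real.exp (tailMoment (fun x => (p x : ℂ)) 0)) ?_ ?_
  · filter_upwards [eventually_ge_atTop 0] with x hx using hp.norm_halfJost_le hζ.le hx
  · simpa using (tendsto_exp_neg_mul_atTop hζ).mul_const _

theorem tendsto_halfJostDer {ζ : ℂ} (hζ : 0 < ζ.im) : Tendsto (halfJostDer p ζ) atTop (𝓝 0) := by
  refine squeeze_zero_norm' (a := fun x => Real.exp (-(ζ.im * x)) *
    ((‖ζ‖ + tailNorm (fun x => (p x : ℂ)) 0) * Real.exp (tailMoment (fun x => (p x : ℂ)) 0))) ?_ ?_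
  · filter_upwards [eventually_ge_atTop 0] with x hx using hp.norm_halfJostDer_le hζ.le hx
  · simpa using (tendsto_exp_neg_mul_atTop hζ).mul_const _

theorem integrableOn_halfJost_mul {ζ : ℂ} (hζ : 0 < ζ.im) {g : ℝ → ℂ} {K : ℝ} (hg : Continuous g)
    (hK : ∀ x, 0 ≤ x → ‖g x‖ ≤ K) : IntegrableOn (fun x => halfJost p ζ x * g x) (Ioi 0) := by
  have h1 := ((integrableOn_exp_mul_Ioi (neg_neg_of_pos hζ) 0).mul_const
    (Real.exp (tailMoment (fun x => (p x : ℂ)) 0))).mul_const K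
  refine h1.mono' ((hp.continuous_halfJost hζ.le).mul hg).aestronglyMeasurable ?_
  filter_upwards [ae_restrict_mem measurableSet_Ioi] with x hx
  have hx : (0 : ℝ) ≤ x := le_of_lt hx
  rw [norm_mul, neg_mul]
  exact mul_le_mul (hp.norm_halfJost_le hζ.le hx) (hK x hx) (norm_nonneg _) (by positivity)

theorem norm_halfJost_le_const {ζ : ℂ} (hζ : 0 ≤ ζ.im) {x : ℝ} (hx : 0 ≤ x) :
    ‖halfJost p ζ x‖ ≤ Real.exp (tailMoment (fun x => (p x : ℂ)) 0) := by
  refine (hp.norm_halfJost_le hζ hx).trans (mul_le_of_le_one_left (Real.exp_pos _).le ?_)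
  exact Real.exp_le_one_iff.2 (neg_nonpos.2 (mul_nonneg hζ hx))

theorem norm_halfJostDer_le_const {ζ : ℂ} (hζ : 0 ≤ ζ.im) {x : ℝ} (hx : 0 ≤ x) :
    ‖halfJostDer p ζ x‖ ≤ (‖ζ‖ + tailNorm (fun x => (p x : ℂ)) 0) *
      Real.exp (tailMoment (fun x => (p x : ℂ)) 0) := by
  have h0 := tailNorm_nonneg (fun x => (p x : ℂ)) 0
  refine (hp.norm_halfJostDer_le hζ hx).trans (mul_le_of_le_one_left (by positivity) ?_)
  exact Real.exp_le_one_iff.2 (neg_nonpos.2 (mul_nonneg hζ hx))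

/-- Lagrange's identity on `(0,∞)` against the zero energy solution. -/
theorem sq_mul_integral_halfJost {ζ : ℂ} (hζ : 0 < ζ.im) :
    ζ ^ 2 * ∫ x in Ioi (0 : ℝ), halfJost p ζ x * halfJost p 0 x =
      halfJostDer p ζ 0 * halfJost p 0 0 - halfJost p ζ 0 * halfJostDer p 0 0 := by
  have h0 : 0 ≤ (0 : ℂ).im := by simp
  have hi := hp.integrableOn_halfJost_mul hζ (hp.continuous_halfJost h0)
    fun x hx => hp.norm_halfJost_le_const h0 hx
  set w : ℝ → ℂ := fun x => halfJost p ζ x * halfJostDer p 0 x - halfJostDer p ζ x * halfJost p 0 x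
  have hd : ∀ z : ℂ, 0 ≤ z.im → ∀ a b, AbsolutelyContinuousOnInterval (halfJost p z) a b :=
    fun z hz a b => aci_of_hasDerivAt (fun x _ => hp.hasDerivAt_halfJost hz x)
      (hp.continuous_halfJostDer hz).continuousOn
  have hd' : ∀ z : ℂ, 0 ≤ z.im → ∀ a b, AbsolutelyContinuousOnInterval (halfJostDer p z) a b :=
    fun z hz a b => hp.tailIntegrable.aci_jostDer hz a b
  have h1 : ∀ X : ℝ, ∫ x in (0 : ℝ)..X, ζ ^ 2 * (halfJost p ζ x * halfJost p 0 x) = w X - w 0 := by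
    intro X
    refine aci_integral_eq_sub (f := w) ?_ ?_ ?_
    · exact (aci_mul (hd _ hζ.le 0 X) (hd' _ h0 0 X)).sub (aci_mul (hd' _ hζ.le 0 X) (hd _ h0 0 X))
    · filter_upwards [hp.tailIntegrable.ae_hasDerivAt_jostDer hζ.le,
        hp.tailIntegrable.ae_hasDerivAt_jostDer h0] with x hx hx' _
      refine (((hp.hasDerivAt_halfJost hζ.le x).mul hx').sub
        (hx.mul (hp.hasDerivAt_halfJost h0 x))).congr_deriv ?_
      simp only [halfJost, halfJostDer]
      ring
    · exact (((hp.continuous_halfJost hζ.le).mul (hp.continuous_halfJost h0)).const_mul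
        (ζ ^ 2)).intervalIntegrable _ _
  have h2 := intervalIntegral_tendsto_integral_Ioi 0 (hi.const_mul (ζ ^ 2)) tendsto_id
  have hb : ∀ f g : ℝ → ℂ, ∀ K, Tendsto f atTop (𝓝 0) → (∀ x, 0 ≤ x → ‖g x‖ ≤ K) →
      Tendsto (fun x => f x * g x) atTop (𝓝 0) := by
    intro f g K hf hg
    refine squeeze_zero_norm' (a := fun x => ‖f x‖ * K) ?_ ?_
    · filter_upwards [eventually_ge_atTop 0] with x hx
      rw [norm_mul]
      exact mul_le_mul_of_nonneg_left (hg x hx) (norm_nonneg _)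
    · simpa using hf.norm.mul_const K
  have h3 : Tendsto w atTop (𝓝 (0 - 0)) :=
    (hb _ _ _ (hp.tendsto_halfJost hζ) fun x hx => hp.norm_halfJostDer_le_const h0 hx).sub
      (hb _ _ _ (hp.tendsto_halfJostDer hζ) fun x hx => hp.norm_halfJost_le_const h0 hx)
  have h4 := tendsto_nhds_unique h2 ((h3.sub_const (w 0)).congr fun X => (h1 X).symm)
  rw [integral_const_mul] at h4
  rw [h4]
  simp only [w]
  ring

/-- The energy identity on `(0,∞)`. -/
theorem im_sq_mul_integral_norm_sq {ζ : ℂ} (hζ : 0 < ζ.im) :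
    (ζ ^ 2).im * ∫ x in Ioi (0 : ℝ), ‖halfJost p ζ x‖ ^ 2 =
      (halfJostDer p ζ 0 * (starRingEnd ℂ) (halfJost p ζ 0)).im := by
  set f := halfJost p ζ
  set f' := halfJostDer p ζ
  have hcf : Continuous f := hp.continuous_halfJost hζ.le
  have hcf' : Continuous f' := hp.continuous_halfJostDer hζ.le
  have hK : ∀ x, 0 ≤ x → ‖(starRingEnd ℂ) (f x)‖ ≤
      Real.exp (tailMoment (fun x => (p x : ℂ)) 0) := fun x hx => by
    rw [RCLike.norm_conj]; exact hp.norm_halfJost_le_const hζ.le hx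
  have hcc : Continuous fun x => (starRingEnd ℂ) (f x) := Complex.continuous_conj.comp hcf
  have hi := hp.integrableOn_halfJost_mul hζ hcc hK
  have hf : ∀ a b, AbsolutelyContinuousOnInterval f a b :=
    fun a b => aci_of_hasDerivAt (fun x _ => hp.hasDerivAt_halfJost hζ.le x) hcf'.continuousOn
  set c : ℂ := (starRingEnd ℂ) (ζ ^ 2) - ζ ^ 2 with hc
  set w : ℝ → ℂ := fun x => f' x * (starRingEnd ℂ) (f x) - f x * (starRingEnd ℂ) (f' x)
  have h1 : ∀ X : ℝ, ∫ x in (0 : ℝ)..X, c * (f x * (starRingEnd ℂ) (f x)) = w X - w 0 := by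
    intro X
    refine aci_integral_eq_sub (f := w) ?_ ?_ ?_
    · have h2 := aci_clm (Complex.conjCLE : ℂ →L[ℝ] ℂ) (hf 0 X)
      have h3 := aci_clm (Complex.conjCLE : ℂ →L[ℝ] ℂ) (hp.tailIntegrable.aci_jostDer hζ.le 0 X)
      exact (aci_mul (hp.tailIntegrable.aci_jostDer hζ.le 0 X) h2).sub (aci_mul (hf 0 X) h3)
    · filter_upwards [hp.tailIntegrable.ae_hasDerivAt_jostDer hζ.le] with x hx _
      have e1 := hp.hasDerivAt_halfJost hζ.le x
      refine ((hx.mul e1.star).sub (e1.mul hx.star)).congr_deriv ?_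
      simp only [← starRingEnd_apply, map_mul, map_sub, Complex.conj_ofReal, hc]
      simp only [f, halfJost, halfJostDer]
      ring
    · exact ((hcf.mul hcc).const_mul c).intervalIntegrable _ _
  have h2 := intervalIntegral_tendsto_integral_Ioi 0 (hi.const_mul c) tendsto_id
  have h3 : Tendsto w atTop (𝓝 0) := by
    have a1 : Tendsto f atTop (𝓝 0) := hp.tendsto_halfJost hζ
    have a2 : Tendsto f' atTop (𝓝 0) := hp.tendsto_halfJostDer hζ
    have a3 : Tendsto (fun x => (starRingEnd ℂ) (f x)) atTop (𝓝 0) := by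
      simpa [Function.comp_def] using (Complex.continuous_conj.tendsto 0).comp a1
    have a4 : Tendsto (fun x => (starRingEnd ℂ) (f' x)) atTop (𝓝 0) := by
      simpa [Function.comp_def] using (Complex.continuous_conj.tendsto 0).comp a2
    simpa using (a2.mul a3).sub (a1.mul a4)
  have h4 := tendsto_nhds_unique h2 ((h3.sub_const (w 0)).congr fun X => (h1 X).symm)
  rw [integral_const_mul] at h4
  have h5 : ∫ x in Ioi (0 : ℝ), f x * (starRingEnd ℂ) (f x) =
      ((∫ x in Ioi (0 : ℝ), ‖f x‖ ^ 2 : ℝ) : ℂ) := by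
    rw [← integral_complex_ofReal]
    refine integral_congr_ae (Eventually.of_forall fun x => ?_)
    simp only [Complex.mul_conj, Complex.normSq_eq_norm_sq]
  rw [h5] at h4
  have h6 := congrArg Complex.im h4
  simp only [hc, w, Complex.mul_im, Complex.sub_im, Complex.conj_im, Complex.conj_re,
    Complex.ofReal_im, Complex.ofReal_re, Complex.sub_re, zero_sub, Complex.neg_im,
    mul_zero, zero_add] at h6 ⊢
  linarith

theorem integrableOn_norm_sq_halfJost {ζ : ℂ} (hζ : 0 < ζ.im) :
    IntegrableOn (fun x => ‖halfJost p ζ x‖ ^ 2) (Ioi 0) := by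
  have hi := hp.integrableOn_halfJost_mul hζ (hp.continuous_halfJost hζ.le)
    fun x hx => hp.norm_halfJost_le_const hζ.le hx
  refine hi.norm.congr (Eventually.of_forall fun x => ?_)
  simp only [norm_mul, sq]

/-- A lower bound of the `L²` norm, uniform in the spectral parameter. -/
theorem exists_le_integral_norm_sq : ∃ X : ℝ, 0 ≤ X ∧ ∀ ζ : ℂ, 0 < ζ.im →
    Real.exp (-(2 * ζ.im * X)) / (8 * ζ.im) ≤ ∫ x in Ioi (0 : ℝ), ‖halfJost p ζ x‖ ^ 2 := by
  have hV := hp.tailIntegrable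
  -- Beyond `X` one has `|m - 1| ≤ 1/2` for every `ζ` at once, because the Neumann bound does not
  -- depend on `ζ`; there `|f|² ≥ e^{-2 Im ζ x}/4`.
  have h1 : Tendsto (fun x => Real.exp (tailMoment (fun x => (p x : ℂ)) x) - 1) atTop (𝓝 0) := by
    simpa using ((Real.continuous_exp.tendsto _).comp hV.tendsto_tailMoment).sub_const 1
  obtain ⟨X, hX0, hX⟩ := ((eventually_ge_atTop (0 : ℝ)).and
    (h1.eventually (gt_mem_nhds (by norm_num : (0 : ℝ) < 1 / 2)))).exists
  refine ⟨X, hX0, fun ζ hζ => ?_⟩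
  have hneg : -(2 * ζ.im) < 0 := by linarith
  have e1 : ∫ x in Ioi X, Real.exp (-(2 * ζ.im) * x) / 4 =
      Real.exp (-(2 * ζ.im * X)) / (8 * ζ.im) := by
    rw [integral_div, integral_exp_mul_Ioi hneg, ← neg_mul]
    field_simp
    ring
  rw [← e1]
  have hsub : Ioi X ⊆ Ioi (0 : ℝ) := Ioi_subset_Ioi hX0
  refine le_trans ?_ (setIntegral_mono_set (hp.integrableOn_norm_sq_halfJost hζ)
    (Eventually.of_forall fun x => by positivity) hsub.eventuallyLE)
  refine setIntegral_mono_on ((integrableOn_exp_mul_Ioi hneg X).div_const 4)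
    ((hp.integrableOn_norm_sq_halfJost hζ).mono_set hsub) measurableSet_Ioi fun x hx => ?_
  have h2 : ‖jostM (fun x => (p x : ℂ)) ζ x - 1‖ ≤ 1 / 2 := by
    refine (hV.norm_jostM_sub_one_le hζ.le x).trans ((sub_le_sub_right ?_ 1).trans hX.le)
    exact Real.exp_le_exp.2 (hV.tailMoment_antitone (le_of_lt hx))
  have h3 : 1 / 2 ≤ ‖jostM (fun x => (p x : ℂ)) ζ x‖ := by
    have h4 := norm_sub_norm_le (1 : ℂ) (jostM (fun x => (p x : ℂ)) ζ x)
    rw [norm_sub_rev, norm_one] at h4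
    linarith
  have h5 : ‖halfJost p ζ x‖ ^ 2 =
      Real.exp (-(2 * ζ.im) * x) * ‖jostM (fun x => (p x : ℂ)) ζ x‖ ^ 2 := by
    rw [halfJost, jostSol, norm_mul, Complex.norm_exp, mul_pow, ← Real.exp_nat_mul]
    congr 2
    simp [Complex.mul_re, Complex.mul_im]
    ring
  rw [h5, div_eq_mul_inv]
  gcongr
  nlinarith

end FirstMoment

/-- The sector `|Re ζ| ≤ Im ζ`, `ζ ≠ 0`. -/
def sector : Set ℂ := {ζ | 0 < ζ.im ∧ |ζ.re| ≤ ζ.im}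

namespace FirstMoment

variable {p : ℝ → ℝ} (hp : FirstMoment p)
include hp

/-- To leading order the product is `e^{iζx}`, for which `ζ ∫ e^{iζx} = i` exactly. The error is at
most `e^{-Im ζ x} h(x)` with `h → 0` at infinity. In the sector `|ζ| ≤ 2 Im ζ`, so the error term is
controlled by the Abelian mean of `h`. -/
theorem tendsto_mul_integral_halfJost :
    Tendsto (fun ζ : ℂ => ζ * ∫ x in Ioi (0 : ℝ), halfJost p ζ x * halfJost p 0 x)
      (𝓝[sector] 0) (𝓝 Complex.I) := by
  have hV := hp.tailIntegrable
  have h0 : 0 ≤ (0 : ℂ).im := by simp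
  set V : ℝ → ℂ := fun x => (p x : ℂ)
  -- With `E = exp (tailMoment V x)`, the expansion `(m_ζ - 1) m_0 + (m_0 - 1)` is bounded by `(E -
  -- 1) E + (E - 1) = E² - 1`.
  set h : ℝ → ℝ := fun x => Real.exp (tailMoment V x) ^ 2 - 1 with hh
  have hc : Continuous h := by
    have := hV.continuous_tailMoment
    fun_prop
  have hlim : Tendsto h atTop (𝓝 0) := by
    simpa using (((Real.continuous_exp.tendsto _).comp hV.tendsto_tailMoment).pow 2).sub_const 1
  have hge : ∀ x, 0 ≤ h x := fun x => by
    have : 1 ≤ Real.exp (tailMoment V x) := Real.one_le_exp (tailMoment_nonneg V x)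
    simp only [hh]
    nlinarith
  have hK : ∀ x, 0 ≤ x → |h x| ≤ h 0 := fun x hx => by
    rw [abs_of_nonneg (hge x)]
    simp only [hh]
    gcongr
    exact hV.tailMoment_antitone hx
  have him : Tendsto (fun ζ : ℂ => ζ.im) (𝓝[sector] 0) (𝓝[>] 0) := by
    refine tendsto_nhdsWithin_iff.2 ⟨?_, ?_⟩
    · exact (Complex.continuous_im.tendsto' 0 0 rfl).mono_left nhdsWithin_le_nhds
    · filter_upwards [self_mem_nhdsWithin] with ζ hζ using hζ.1
  have hT := ((tendsto_mul_integral_exp_mul hc hlim hK).comp him).const_mul 2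
  rw [mul_zero] at hT
  rw [tendsto_iff_norm_sub_tendsto_zero]
  refine squeeze_zero' (Eventually.of_forall fun _ => norm_nonneg _) ?_ hT
  filter_upwards [self_mem_nhdsWithin] with ζ hζ
  have hζ0 : 0 < ζ.im := hζ.1
  have hi1 := hp.integrableOn_halfJost_mul hζ0 (hp.continuous_halfJost h0)
    fun x hx => hp.norm_halfJost_le_const h0 hx
  have hi2 : IntegrableOn (fun x : ℝ => Complex.exp (Complex.I * ζ * x)) (Ioi 0) :=
    integrableOn_exp_mul_complex_Ioi (by simpa using hζ0) 0
  have hi3 : IntegrableOn (fun x => Real.exp (-(ζ.im * x)) * h x) (Ioi 0) := by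
    have h1 := (integrableOn_exp_mul_Ioi (neg_neg_of_pos hζ0) 0).mul_const (h 0)
    refine h1.mono' (by fun_prop : Continuous fun x =>
      Real.exp (-(ζ.im * x)) * h x).aestronglyMeasurable ?_
    filter_upwards [ae_restrict_mem measurableSet_Ioi] with x hx
    rw [norm_mul, Real.norm_of_nonneg (Real.exp_pos _).le, neg_mul]
    gcongr
    exact hK x (le_of_lt hx)
  rw [← mul_integral_exp hζ0, ← mul_sub, ← integral_sub hi1 hi2, norm_mul]
  have hz : ‖ζ‖ ≤ 2 * ζ.im := by
    have := Complex.norm_le_abs_re_add_abs_im ζ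
    rw [abs_of_pos hζ0] at this
    linarith [hζ.2]
  have hb : ‖∫ x in Ioi (0 : ℝ), (halfJost p ζ x * halfJost p 0 x -
      Complex.exp (Complex.I * ζ * x))‖ ≤ ∫ x in Ioi (0 : ℝ), Real.exp (-(ζ.im * x)) * h x := by
    refine norm_integral_le_of_norm_le hi3 (Eventually.of_forall fun x => ?_)
    have e1 : halfJost p ζ x * halfJost p 0 x - Complex.exp (Complex.I * ζ * x) =
        Complex.exp (Complex.I * ζ * x) * ((jostM V ζ x - 1) * jostM V 0 x + (jostM V 0 x - 1)) := by
      simp only [halfJost, jostSol, mul_zero, zero_mul, Complex.exp_zero, one_mul]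
      ring
    rw [e1, norm_mul, Complex.norm_exp]
    refine mul_le_mul (le_of_eq ?_) ?_ (norm_nonneg _) (Real.exp_pos _).le
    · simp [Complex.mul_re, Complex.mul_im]
    · refine (norm_add_le _ _).trans ?_
      rw [norm_mul]
      have a1 := hV.norm_jostM_sub_one_le hζ0.le x
      have a2 := hV.norm_jostM_le h0 x
      have a3 := hV.norm_jostM_sub_one_le h0 x
      have a4 : ‖jostM V ζ x - 1‖ * ‖jostM V 0 x‖ ≤
          (Real.exp (tailMoment V x) - 1) * Real.exp (tailMoment V x) :=
        mul_le_mul a1 a2 (norm_nonneg _) ((norm_nonneg _).trans a1)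
      simp only [hh]
      linarith
  have hnn : 0 ≤ ∫ x in Ioi (0 : ℝ), Real.exp (-(ζ.im * x)) * h x :=
    (norm_nonneg _).trans hb
  calc _ ≤ (2 * ζ.im) * ∫ x in Ioi (0 : ℝ), Real.exp (-(ζ.im * x)) * h x := by gcongr
    _ = _ := by simp only [Function.comp_apply]; ring

/-- At zero energy the Jost solution is real. -/
theorem conj_halfJost_zero (x : ℝ) :
    (starRingEnd ℂ) (halfJost p 0 x) = halfJost p 0 x ∧
      (starRingEnd ℂ) (halfJostDer p 0 x) = halfJostDer p 0 x := by
  have h1 : ∀ x, (starRingEnd ℂ) (halfJost p 0 x) = halfJost p 0 x := fun x => by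
    simp only [halfJost, jostSol, mul_zero, zero_mul, Complex.exp_zero, one_mul]
    exact conj_jostM_zero (fun x => Complex.conj_ofReal _) x
  refine ⟨h1 x, ?_⟩
  have h2 := (hp.hasDerivAt_halfJost (ζ := 0) (by simp) x)
  have h3 := h2.star
  exact (h3.unique (h2.congr_of_eventuallyEq (Eventually.of_forall h1)))

/-! ### High energy behaviour -/

/-- In `mul_one_sub_jostM` the right-hand side is bounded uniformly in `ζ`, so `m(0,ζ) - 1 =
O(1/|ζ|)`. -/
theorem tendsto_halfJost_cobounded :
    Tendsto (fun ζ : ℂ => halfJost p ζ 0) (Bornology.cobounded ℂ ⊓ 𝓟 {ζ | 0 ≤ ζ.im}) (𝓝 1) := by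
  have hV := hp.tailIntegrable
  set V : ℝ → ℂ := fun x => (p x : ℂ)
  set K : ℝ := tailNorm V 0 * Real.exp (tailMoment V 0)
  have h1 : Tendsto (fun ζ : ℂ => K * ‖ζ‖⁻¹) (Bornology.cobounded ℂ ⊓ 𝓟 {ζ | 0 ≤ ζ.im}) (𝓝 0) := by
    simpa using ((tendsto_inv_atTop_zero.comp (tendsto_norm_cobounded_atTop (E := ℂ))).mono_left
      inf_le_left).const_mul K
  rw [tendsto_iff_norm_sub_tendsto_zero]
  refine squeeze_zero' (Eventually.of_forall fun _ => norm_nonneg _) ?_ h1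
  filter_upwards [mem_inf_of_right (mem_principal_self _),
    mem_inf_of_left (Bornology.eventually_ne_cobounded (0 : ℂ))] with ζ hζ hne
  have hζ : 0 ≤ ζ.im := hζ
  have hne : ζ ≠ 0 := hne
  have h2 := congrArg norm (hV.mul_one_sub_jostM hζ)
  have h3 : ‖∫ t in Ioi (0 : ℝ), V t * jostM V ζ t‖ ≤ K := by
    simp only [K, tailNorm]
    rw [← integral_mul_const]
    refine norm_integral_le_of_norm_le ((hV.int 0).norm.mul_const _) ?_
    filter_upwards [ae_restrict_mem measurableSet_Ioi] with t ht
    rw [norm_mul]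
    gcongr
    exact hV.norm_jostM_le_of_le hζ (le_of_lt ht)
  have h4 := norm_add_le (jostN V ζ 0) (∫ t in Ioi (0 : ℝ), V t * jostM V ζ t)
  have h5 := hV.norm_jostN_le hζ 0
  have h6 : halfJost p ζ 0 = jostM V ζ 0 := by simp [halfJost, jostSol, V]
  have h7 : 0 < ‖ζ‖ := norm_pos_iff.2 hne
  rw [norm_mul, norm_mul, norm_mul, Complex.norm_I, Complex.norm_two, norm_sub_rev] at h2
  rw [h6, ← div_eq_mul_inv, le_div_iff₀ h7]
  nlinarith

theorem tendsto_halfJostDer_cobounded :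
    Tendsto (fun ζ : ℂ => halfJostDer p ζ 0 / (Complex.I * ζ))
      (Bornology.cobounded ℂ ⊓ 𝓟 {ζ | 0 ≤ ζ.im}) (𝓝 1) := by
  have hV := hp.tailIntegrable
  set V : ℝ → ℂ := fun x => (p x : ℂ)
  set K : ℝ := tailNorm V 0 * Real.exp (tailMoment V 0)
  have h1 : Tendsto (fun ζ : ℂ => jostN V ζ 0 / (Complex.I * ζ))
      (Bornology.cobounded ℂ ⊓ 𝓟 {ζ | 0 ≤ ζ.im}) (𝓝 0) := by
    have h2 : Tendsto (fun ζ : ℂ => K * ‖ζ‖⁻¹) (Bornology.cobounded ℂ ⊓ 𝓟 {ζ | 0 ≤ ζ.im}) (𝓝 0) := by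
      simpa using ((tendsto_inv_atTop_zero.comp (tendsto_norm_cobounded_atTop (E := ℂ))).mono_left
        inf_le_left).const_mul K
    refine squeeze_zero_norm' ?_ h2
    filter_upwards [mem_inf_of_right (mem_principal_self _)] with ζ hζ
    rw [norm_div, norm_mul, Complex.norm_I, one_mul, div_eq_mul_inv]
    gcongr
    exact hV.norm_jostN_le hζ 0
  have h2 := hp.tendsto_halfJost_cobounded.add h1
  rw [add_zero] at h2
  refine h2.congr' ?_
  filter_upwards [mem_inf_of_left (Bornology.eventually_ne_cobounded (0 : ℂ))] with ζ hne
  have hne : ζ ≠ 0 := hne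
  have h3 : Complex.I * ζ ≠ 0 := mul_ne_zero Complex.I_ne_zero hne
  have h6 : halfJost p ζ 0 = jostM V ζ 0 := by simp [halfJost, jostSol, V]
  have h7 : halfJostDer p ζ 0 = Complex.I * ζ * jostM V ζ 0 + jostN V ζ 0 := by
    simp [halfJostDer, jostDer, V]
  rw [h6, h7]
  field_simp

end FirstMoment

/-! ### Solutions on the two half-lines, coupled at the origin -/

theorem ae_neg {P : ℝ → Prop} (h : ∀ᵐ x : ℝ, P x) : ∀ᵐ x : ℝ, P (-x) :=
  (Measure.measurePreserving_neg (volume : Measure ℝ)).quasiMeasurePreserving.ae h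

/-- `-y'' + q y = lam y` off the origin together with the transfer condition. -/
structure TransferSol (q : ℝ → ℝ) (M : Matrix (Fin 2) (Fin 2) ℝ) (lam : ℂ) (y : ℝ → ℂ) : Prop where
  right : HalfSol (fun x => (q x : ℂ) - lam) y
  left : HalfSol (fun x => (q (-x) : ℂ) - lam) (fun x => y (-x))
  transfer : ∃ u₀ u₁ : ℂ, HasData (fun x => y (-x)) u₀ (-u₁) ∧
    HasData y (M 0 0 * u₀ + M 0 1 * u₁) (M 1 0 * u₀ + M 1 1 * u₁)

theorem hasData_comp_neg_iff {y : ℝ → ℂ} {u₀ u₁ : ℂ} :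
    HasData (fun x => y (-x)) u₀ (-u₁) ↔
      Tendsto y (𝓝[<] 0) (𝓝 u₀) ∧ Tendsto (deriv y) (𝓝[<] 0) (𝓝 u₁) := by
  have e : deriv (fun x => y (-x)) = fun x => -deriv y (-x) := funext fun x => deriv_comp_neg y x
  have hn : Tendsto (fun x : ℝ => -x) (𝓝[>] 0) (𝓝[<] 0) := by
    simpa using (tendsto_neg_nhdsGT (a := (0 : ℝ)))
  have hn' : Tendsto (fun x : ℝ => -x) (𝓝[<] 0) (𝓝[>] 0) := by
    simpa using (tendsto_neg_nhdsLT (a := (0 : ℝ)))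
  rw [HasData, e]
  constructor
  · rintro ⟨h1, h2⟩
    refine ⟨by simpa [Function.comp_def] using h1.comp hn', ?_⟩
    simpa [Function.comp_def] using (h2.comp hn').neg
  · rintro ⟨h1, h2⟩
    exact ⟨h1.comp hn, (h2.comp hn).neg⟩

theorem transferSol_iff {q : ℝ → ℝ} {M : Matrix (Fin 2) (Fin 2) ℝ} {lam : ℂ} {y : ℝ → ℂ} :
    TransferSol q M lam y ↔
      IsACOffZero y ∧ TransferCondition M y ∧ ∀ᵐ x ∂volume, ell q y x = lam * y x := by
  have e : deriv (fun x => y (-x)) = fun x => -deriv y (-x) := funext fun x => deriv_comp_neg y x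
  have e2 : ∀ x, deriv (deriv fun x => y (-x)) x = deriv (deriv y) (-x) := fun x => by
    rw [e, deriv.fun_neg, deriv_comp_neg (deriv y), neg_neg]
  have hT : TransferCondition M y ↔ ∃ u₀ u₁ : ℂ, HasData (fun x => y (-x)) u₀ (-u₁) ∧
    HasData y (M 0 0 * u₀ + M 0 1 * u₁) (M 1 0 * u₀ + M 1 1 * u₁) := by
    simp only [hasData_comp_neg_iff]
    constructor
    · rintro ⟨u₀, u₁, v₀, v₁, h1, h2, h3, h4, rfl, rfl⟩
      exact ⟨u₀, u₁, ⟨h1, h2⟩, h3, h4⟩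
    · rintro ⟨u₀, u₁, ⟨h1, h2⟩, h3, h4⟩
      exact ⟨u₀, u₁, _, _, h1, h2, h3, h4, rfl, rfl⟩
  constructor
  · rintro ⟨hr, hl, ht⟩
    refine ⟨⟨fun x hx => ?_, fun a b hab h0 => ?_⟩, hT.2 ht, ?_⟩
    · rcases hx.lt_or_gt with h | h
      · have h1 := (hl.diff (-x) (neg_pos.2 h)).comp x differentiableAt_id.neg
        simpa [Function.comp_def] using h1
      · exact hr.diff x h
    · rcases h0 with h0 | h0
      · exact ⟨hr.ac a b h0 hab, hr.ac_deriv a b h0 hab⟩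
      · have h1 := aci_comp_neg (hl.ac (-b) (-a) (by linarith) (by linarith)).symm
        have h2 := (aci_comp_neg (hl.ac_deriv (-b) (-a) (by linarith) (by linarith)).symm).neg
        rw [e] at h2
        exact ⟨by simpa using h1, by simpa using aci_congr h2 fun x _ => by simp⟩
    · have h0 : ∀ᵐ x : ℝ, x ≠ 0 := by simp [ae_iff, measure_singleton]
      filter_upwards [hr.eq, ae_neg hl.eq, h0] with x h1 h2 h3
      have key : deriv (deriv y) x = ((q x : ℂ) - lam) * y x := by
        rcases h3.lt_or_gt with h | h
        · have := h2 (neg_pos.2 h)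
          rw [e2] at this
          simpa using this
        · exact h1 h
      rw [ell, key]
      ring
  · rintro ⟨⟨hd, hac⟩, ht, heq⟩
    refine ⟨⟨fun x hx => hd x hx.ne', fun a b ha hab => (hac a b hab (Or.inl ha)).1,
      fun a b ha hab => (hac a b hab (Or.inl ha)).2, ?_⟩, ⟨fun x hx => ?_, fun a b ha hab => ?_,
      fun a b ha hab => ?_, ?_⟩, hT.1 ht⟩
    · filter_upwards [heq] with x h1 _
      rw [ell] at h1
      linear_combination -h1
    · exact (hd (-x) (neg_ne_zero.2 hx.ne')).comp x differentiableAt_id.neg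
    · simpa using aci_comp_neg (hac (-b) (-a) (by linarith) (Or.inr (by linarith))).1.symm
    · rw [e]
      have := (aci_comp_neg (hac (-b) (-a) (by linarith) (Or.inr (by linarith))).2.symm).neg
      simpa using! this
    · filter_upwards [ae_neg heq] with x h1 _
      rw [e2]
      rw [ell] at h1
      linear_combination -h1

theorem isSolution_iff {q : ℝ → ℝ} {M : Matrix (Fin 2) (Fin 2) ℝ} {ζ : ℂ} {y : ℝ → ℂ} :
    IsSolution q M ζ y ↔ TransferSol q M (ζ ^ 2) y := transferSol_iff.symm

/-- The function equal to `y₊` on the right and to the reflection of `y₋` on the left. -/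
noncomputable def glue (yp ym : ℝ → ℂ) (x : ℝ) : ℂ := if 0 < x then yp x else ym (-x)

theorem glue_pos {yp ym : ℝ → ℂ} {x : ℝ} (hx : 0 < x) : glue yp ym x = yp x := if_pos hx

theorem glue_neg {yp ym : ℝ → ℂ} {x : ℝ} (hx : 0 < x) : glue yp ym (-x) = ym x := by
  rw [glue, if_neg (by linarith), neg_neg]

theorem transferSol_glue {q : ℝ → ℝ} {M : Matrix (Fin 2) (Fin 2) ℝ} {lam : ℂ} {yp ym : ℝ → ℂ}
    (hr : HalfSol (fun x => (q x : ℂ) - lam) yp) (hl : HalfSol (fun x => (q (-x) : ℂ) - lam) ym)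
    {u₀ u₁ v₀ v₁ : ℂ} (hdl : HasData ym u₀ (-u₁)) (hdr : HasData yp v₀ v₁)
    (h0 : v₀ = M 0 0 * u₀ + M 0 1 * u₁) (h1 : v₁ = M 1 0 * u₀ + M 1 1 * u₁) :
    TransferSol q M lam (glue yp ym) :=
  ⟨hr.congr fun _ hx => (glue_pos hx).symm, hl.congr fun _ hx => (glue_neg hx).symm, u₀, u₁,
    hdl.congr fun _ hx => (glue_neg hx).symm, h0 ▸ h1 ▸ hdr.congr fun _ hx => (glue_pos hx).symm⟩

namespace TransferSol

variable {q : ℝ → ℝ} {M : Matrix (Fin 2) (Fin 2) ℝ} {lam : ℂ} {y z : ℝ → ℂ}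

theorem add (h : TransferSol q M lam y) (h' : TransferSol q M lam z) :
    TransferSol q M lam (fun x => y x + z x) := by
  obtain ⟨u₀, u₁, hl, hr⟩ := h.transfer
  obtain ⟨w₀, w₁, hl', hr'⟩ := h'.transfer
  refine ⟨h.right.add h'.right, h.left.add h'.left, u₀ + w₀, u₁ + w₁, ?_, ?_⟩
  · convert hl.add hl' h.left h'.left using 1
    ring
  · convert hr.add hr' h.right h'.right using 1 <;> ring

theorem const_mul (h : TransferSol q M lam y) (c : ℂ) :
    TransferSol q M lam (fun x => c * y x) := by
  obtain ⟨u₀, u₁, hl, hr⟩ := h.transfer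
  refine ⟨h.right.const_mul c, h.left.const_mul c, c * u₀, c * u₁, ?_, ?_⟩
  · convert hl.const_mul c using 1
    ring
  · convert hr.const_mul c using 1 <;> ring

theorem conj (h : TransferSol q M lam y) :
    TransferSol q M ((starRingEnd ℂ) lam) (fun x => (starRingEnd ℂ) (y x)) := by
  obtain ⟨u₀, u₁, hl, hr⟩ := h.transfer
  refine ⟨by simpa using h.right.conj, by simpa using h.left.conj, (starRingEnd ℂ) u₀,
    (starRingEnd ℂ) u₁, by simpa using hl.conj, by simpa using hr.conj⟩

/-- The left data of a solution are determined by its right data. -/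
theorem left_data (h : TransferSol q M lam y) (hM : M.det = 1) {v₀ v₁ : ℂ} (hd : HasData y v₀ v₁) :
    HasData (fun x => y (-x)) (M 1 1 * v₀ - M 0 1 * v₁) (M 1 0 * v₀ - M 0 0 * v₁) := by
  obtain ⟨u₀, u₁, hl, hr⟩ := h.transfer
  obtain ⟨h0, h1⟩ := hd.unique hr
  have hdet : (M 0 0 : ℂ) * M 1 1 - M 0 1 * M 1 0 = 1 := by
    rw [Matrix.det_fin_two] at hM
    exact_mod_cast congrArg (fun r : ℝ => (r : ℂ)) hM
  convert hl using 1
  · rw [h0, h1]; linear_combination u₀ * hdet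
  · rw [h0, h1]; linear_combination (-u₁) * hdet

theorem right_data (h : TransferSol q M lam y) {u₀ u₁ : ℂ}
    (hd : HasData (fun x => y (-x)) u₀ u₁) :
    HasData y (M 0 0 * u₀ - M 0 1 * u₁) (M 1 0 * u₀ - M 1 1 * u₁) := by
  obtain ⟨w₀, w₁, hl, hr⟩ := h.transfer
  obtain ⟨rfl, rfl⟩ := hd.unique hl
  convert hr using 1 <;> ring

/-- A solution which vanishes on the right vanishes. -/
theorem eq_zero (h : TransferSol q M lam y) (hq : FirstMoment q) (hM : M.det = 1)
    (h0 : ∀ x, 0 < x → y x = 0) {x : ℝ} (hx : x ≠ 0) : y x = 0 := by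
  rcases hx.lt_or_gt with hx | hx
  · have hd : HasData y 0 0 := by
      refine HasData.congr (y := fun _ => 0) ⟨tendsto_const_nhds, ?_⟩ fun x hx => (h0 x hx).symm
      simp
    have hd' := h.left_data hM hd
    simp only [mul_zero, sub_zero] at hd'
    have := h.left.eq_zero_of_data hq.comp_neg hd' (neg_pos.2 hx)
    simpa using this
  · exact h0 x hx

end TransferSol

/-! ### The Jost solutions of the full problem -/

section Jost

variable {q : ℝ → ℝ} {M : Matrix (Fin 2) (Fin 2) ℝ} (hq : FirstMoment q) (hM : M.det = 1)
include hq hM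

omit hq in
theorem det_cast : (M 0 0 : ℂ) * M 1 1 - M 0 1 * M 1 0 = 1 := by
  rw [Matrix.det_fin_two] at hM
  exact_mod_cast congrArg (fun r : ℝ => (r : ℂ)) hM

/-- The choice defining `jostPlus` is meaningful once one Jost solution exists: `halfJost` on the
right is continued to the left by solving the initial value problem with data `M⁻¹` applied to its
data at `0⁺`. -/
theorem isJostPlus_jostPlus {ζ : ℂ} (hζ : 0 ≤ ζ.im) : IsJostPlus q M ζ (jostPlus q M ζ) := by
  apply Classical.epsilon_spec (p := IsJostPlus q M ζ)
  have hdet := det_cast hM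
  set F₀ := halfJost q ζ 0
  set F₁ := halfJostDer q ζ 0
  obtain ⟨y, hy, dy⟩ := exists_halfSol hq.comp_neg (ζ ^ 2) (M 1 1 * F₀ - M 0 1 * F₁)
    (-(-(M 1 0 * F₀) + M 0 0 * F₁))
  refine ⟨glue (halfJost q ζ) y, isSolution_iff.2 (transferSol_glue (hq.halfSol_halfJost hζ) hy dy
    (hq.hasData_halfJost hζ) ?_ ?_), ?_⟩
  · linear_combination (-F₀) * hdet
  · linear_combination (-F₁) * hdet
  · refine (hq.tendsto_exp_mul_halfJost hζ).congr' ?_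
    filter_upwards [eventually_gt_atTop 0] with x hx
    rw [glue_pos hx]

omit hM in
theorem isJostMinus_jostMinus {ζ : ℂ} (hζ : 0 ≤ ζ.im) : IsJostMinus q M ζ (jostMinus q M ζ) := by
  apply Classical.epsilon_spec (p := IsJostMinus q M ζ)
  have hq' := hq.comp_neg
  set q' : ℝ → ℝ := fun x => q (-x)
  set G₀ := halfJost q' ζ 0
  set G₁ := halfJostDer q' ζ 0
  obtain ⟨y, hy, dy⟩ := exists_halfSol hq (ζ ^ 2) (M 0 0 * G₀ + M 0 1 * (-G₁))
    (M 1 0 * G₀ + M 1 1 * (-G₁))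
  refine ⟨glue y (halfJost q' ζ), isSolution_iff.2 (transferSol_glue hy (hq'.halfSol_halfJost hζ)
    (u₀ := G₀) (u₁ := -G₁) ?_ dy rfl rfl), ?_⟩
  · rw [neg_neg]
    exact hq'.hasData_halfJost hζ
  · refine ((hq'.tendsto_exp_mul_halfJost hζ).comp tendsto_neg_atBot_atTop).congr' ?_
    filter_upwards [eventually_lt_atBot 0] with x hx
    have := glue_neg (yp := y) (ym := halfJost q' ζ) (neg_pos.2 hx)
    rw [neg_neg] at this
    rw [this]
    simp

theorem transferSol_jostPlus {ζ : ℂ} (hζ : 0 ≤ ζ.im) :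
    TransferSol q M (ζ ^ 2) (jostPlus q M ζ) :=
  isSolution_iff.1 (isJostPlus_jostPlus hq hM hζ).1

omit hM in
theorem transferSol_jostMinus {ζ : ℂ} (hζ : 0 ≤ ζ.im) :
    TransferSol q M (ζ ^ 2) (jostMinus q M ζ) :=
  isSolution_iff.1 (isJostMinus_jostMinus hq hζ).1

theorem jostPlus_eq {ζ : ℂ} (hζ : 0 ≤ ζ.im) (h0 : ζ ≠ 0) {x : ℝ} (hx : 0 < x) :
    jostPlus q M ζ x = halfJost q ζ x := by
  have h1 := (isJostPlus_jostPlus hq hM hζ).2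
  have h2 := hq.tendsto_exp_mul_halfJost hζ
  have := hq.eq_zero_of_tendsto hζ h0 ((transferSol_jostPlus hq hM hζ).right.add
    ((hq.halfSol_halfJost hζ).const_mul (-1))) (by
      have h3 := h1.sub h2
      rw [sub_self] at h3
      refine h3.congr fun x => ?_
      ring) hx
  linear_combination this

omit hM in
theorem jostMinus_eq {ζ : ℂ} (hζ : 0 ≤ ζ.im) (h0 : ζ ≠ 0) {x : ℝ} (hx : 0 < x) :
    jostMinus q M ζ (-x) = halfJost (fun x => q (-x)) ζ x := by
  have hq' := hq.comp_neg
  have h1 := (isJostMinus_jostMinus (M := M) hq hζ).2.comp tendsto_neg_atTop_atBot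
  have h2 := hq'.tendsto_exp_mul_halfJost hζ
  have := hq'.eq_zero_of_tendsto hζ h0 ((transferSol_jostMinus (M := M) hq hζ).left.add
    ((hq'.halfSol_halfJost hζ).const_mul (-1))) (by
      have h3 := h1.sub h2
      rw [sub_self] at h3
      refine h3.congr fun x => ?_
      simp only [Function.comp_apply, Complex.ofReal_neg, mul_neg]
      ring) hx
  linear_combination this

end Jost

/-! ### Connection coefficients in terms of data at the origin -/

/-- The value at `0⁺` of the left Jost solution. -/
noncomputable def minusData₀ (q : ℝ → ℝ) (M : Matrix (Fin 2) (Fin 2) ℝ) (ζ : ℂ) : ℂ :=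
  M 0 0 * halfJost (fun x => q (-x)) ζ 0 - M 0 1 * halfJostDer (fun x => q (-x)) ζ 0

/-- The derivative at `0⁺` of the left Jost solution. -/
noncomputable def minusData₁ (q : ℝ → ℝ) (M : Matrix (Fin 2) (Fin 2) ℝ) (ζ : ℂ) : ℂ :=
  M 1 0 * halfJost (fun x => q (-x)) ζ 0 - M 1 1 * halfJostDer (fun x => q (-x)) ζ 0

/-- The Wronskian of the Jost solutions, evaluated at `0⁺`. -/
noncomputable def jostW (q : ℝ → ℝ) (M : Matrix (Fin 2) (Fin 2) ℝ) (ζ : ℂ) : ℂ :=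
  minusData₀ q M ζ * halfJostDer q ζ 0 - minusData₁ q M ζ * halfJost q ζ 0

section Scattering

variable {q : ℝ → ℝ} {M : Matrix (Fin 2) (Fin 2) ℝ} (hq : FirstMoment q) (hM : M.det = 1)
include hq hM

theorem hasData_jostPlus {ζ : ℂ} (hζ : 0 ≤ ζ.im) (h0 : ζ ≠ 0) :
    HasData (jostPlus q M ζ) (halfJost q ζ 0) (halfJostDer q ζ 0) :=
  (hq.hasData_halfJost hζ).congr fun _ hx => (jostPlus_eq hq hM hζ h0 hx).symm

omit hM in
theorem hasData_jostMinus {ζ : ℂ} (hζ : 0 ≤ ζ.im) (h0 : ζ ≠ 0) :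
    HasData (jostMinus q M ζ) (minusData₀ q M ζ) (minusData₁ q M ζ) :=
  (transferSol_jostMinus hq hζ).right_data
    ((hq.comp_neg.hasData_halfJost hζ).congr fun _ hx => (jostMinus_eq hq hζ h0 hx).symm)

theorem coeffA_eq_of_im_pos {ζ : ℂ} (hζ : 0 < ζ.im) :
    coeffA q M ζ = jostW q M ζ / (2 * Complex.I * ζ) := by
  have h0 : ζ ≠ 0 := by rintro rfl; simp at hζ
  rw [coeffA, if_neg hζ.ne', (transferSol_jostMinus hq hζ.le).right.wronskian_eq_data
    (transferSol_jostPlus hq hM hζ.le).right (hasData_jostMinus hq hζ.le h0)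
    (hasData_jostPlus hq hM hζ.le h0) one_pos, jostW]

omit hq hM in
-- For solution data `a`, `b` the two moduli are those of the Wronskians of `a` with `b` and with
-- its conjugate, and the last term is the product of their fluxes. This produces both `|A|² = 1 +
-- |B|²` and the lower bound on `jostW`.
theorem norm_sq_wedge (a₀ a₁ b₀ b₁ : ℂ) : ‖a₀ * b₁ - a₁ * b₀‖ ^ 2 =
    ‖a₀ * (starRingEnd ℂ) b₁ - a₁ * (starRingEnd ℂ) b₀‖ ^ 2 -
      4 * (a₁ * (starRingEnd ℂ) a₀).im * (b₁ * (starRingEnd ℂ) b₀).im := by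
  simp only [← Complex.normSq_eq_norm_sq, Complex.normSq_apply, Complex.sub_re, Complex.sub_im,
    Complex.mul_re, Complex.mul_im, Complex.conj_re, Complex.conj_im]
  ring

omit hq in
-- A real transfer matrix multiplies the flux `Im(y' ȳ)` by its determinant; the minus sign comes
-- from the reflection of the left half-line.
theorem im_minusData (ζ : ℂ) : (minusData₁ q M ζ * (starRingEnd ℂ) (minusData₀ q M ζ)).im =
    -(halfJostDer (fun x => q (-x)) ζ 0 *
      (starRingEnd ℂ) (halfJost (fun x => q (-x)) ζ 0)).im := by
  rw [Matrix.det_fin_two] at hM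
  simp only [minusData₀, minusData₁, map_sub, map_mul, Complex.conj_ofReal, Complex.sub_im,
    Complex.sub_re, Complex.mul_im, Complex.mul_re, Complex.conj_re, Complex.conj_im,
    Complex.ofReal_re, Complex.ofReal_im]
  set a := (halfJost (fun x => q (-x)) ζ 0).re
  set b := (halfJost (fun x => q (-x)) ζ 0).im
  set c := (halfJostDer (fun x => q (-x)) ζ 0).re
  set d := (halfJostDer (fun x => q (-x)) ζ 0).im
  linear_combination (-(a * d) + b * c) * hM

omit hM in
-- The Wronskian of `f` and its conjugate is constant; at infinity, where `m → 1` and `m' → 0`, it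
-- equals `-2iξ`.
theorem im_halfJost_real (ξ : ℝ) :
    (halfJostDer q ξ 0 * (starRingEnd ℂ) (halfJost q ξ 0)).im = ξ := by
  have hξ : 0 ≤ (ξ : ℂ).im := by simp
  have hV := hq.tailIntegrable
  have hf := hq.halfSol_halfJost hξ
  have hfc : HalfSol (fun x => (q x : ℂ) - ξ ^ 2) fun x => (starRingEnd ℂ) (halfJost q ξ x) := by
    simpa using hf.conj
  set c := halfJost q ξ 0 * (starRingEnd ℂ) (halfJostDer q ξ 0) -
    halfJostDer q ξ 0 * (starRingEnd ℂ) (halfJost q ξ 0) with hc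
  have h1 : ∀ x : ℝ, 0 < x → wronskian (halfJost q ξ)
      (fun x => (starRingEnd ℂ) (halfJost q ξ x)) x = c := fun x hx =>
    hf.wronskian_eq_data hfc (hq.hasData_halfJost hξ) (hq.hasData_halfJost hξ).conj hx
  set V : ℝ → ℂ := fun x => (q x : ℂ)
  have hm := hV.tendsto_jostM hξ
  have hn := hV.tendsto_jostN hξ
  have hmc := (Complex.continuous_conj.tendsto _).comp hm
  have hnc := (Complex.continuous_conj.tendsto _).comp hn
  have h2 := (hm.mul (((hmc.const_mul (-(Complex.I * ξ)))).add hnc)).sub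
    (((hm.const_mul (Complex.I * ξ)).add hn).mul hmc)
  have h3 : Tendsto (fun _ : ℝ => c) atTop (𝓝 (-(2 * Complex.I * ξ))) := by
    convert h2.congr' ?_ using 2
    · simp; ring
    · filter_upwards [eventually_gt_atTop 0] with x hx
      rw [← h1 x hx, wronskian, hq.deriv_halfJost hξ]
      have e1 : deriv (fun x => (starRingEnd ℂ) (halfJost q ξ x)) x =
          (starRingEnd ℂ) (halfJostDer q ξ x) := by
        rw [← hq.deriv_halfJost hξ]
        exact deriv.star (f := halfJost q ξ)
      rw [e1]
      have e2 : Complex.exp (Complex.I * ξ * x) *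
          (starRingEnd ℂ) (Complex.exp (Complex.I * ξ * x)) = 1 := by
        rw [← Complex.exp_conj, ← Complex.exp_add, Complex.exp_eq_one_iff]
        exact ⟨0, by simp⟩
      simp only [halfJost, halfJostDer, jostSol, jostDer, map_mul, map_add, Complex.conj_I,
        Complex.conj_ofReal, Function.comp_apply]
      simp only [V]
      linear_combination (-(jostM (fun x => (q x : ℂ)) ξ x * (-(Complex.I * ξ) *
        (starRingEnd ℂ) (jostM (fun x => (q x : ℂ)) ξ x) +
        (starRingEnd ℂ) (jostN (fun x => (q x : ℂ)) ξ x)) - (Complex.I * ξ *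
        jostM (fun x => (q x : ℂ)) ξ x + jostN (fun x => (q x : ℂ)) ξ x) *
        (starRingEnd ℂ) (jostM (fun x => (q x : ℂ)) ξ x))) * e2
  have h4 := congrArg Complex.im (tendsto_nhds_unique tendsto_const_nhds h3)
  simp only [hc, Complex.sub_im, Complex.mul_im, Complex.conj_im, Complex.conj_re, Complex.neg_im,
    Complex.mul_re, Complex.I_re, Complex.I_im, Complex.ofReal_re, Complex.ofReal_im,
    Complex.re_ofNat, Complex.im_ofNat] at h4 ⊢
  linarith

/-- The connection coefficients on the real line. -/
theorem scatteringPair_eq {ξ : ℝ} (hξ : ξ ≠ 0) :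
    scatteringPair q M ξ = (jostW q M ξ / (2 * Complex.I * ξ),
      (minusData₀ q M ξ * (starRingEnd ℂ) (halfJostDer q ξ 0) -
        minusData₁ q M ξ * (starRingEnd ℂ) (halfJost q ξ 0)) / (-(2 * Complex.I * ξ))) := by
  have him : 0 ≤ (ξ : ℂ).im := by simp
  have h0 : (ξ : ℂ) ≠ 0 := by exact_mod_cast hξ
  have hI : 2 * Complex.I * ξ ≠ 0 := by simp [h0, Complex.I_ne_zero]
  set F₀ := halfJost q ξ 0 with hF₀
  set F₁ := halfJostDer q ξ 0 with hF₁
  have hdP := hasData_jostPlus hq hM him h0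
  have hdM := hasData_jostMinus (M := M) hq him h0
  have sP := transferSol_jostPlus hq hM him
  have sM := transferSol_jostMinus (M := M) hq him
  have sPc : TransferSol q M ((ξ : ℂ) ^ 2) fun x => (starRingEnd ℂ) (jostPlus q M ξ x) := by
    simpa using sP.conj
  have hF : F₀ * (starRingEnd ℂ) F₁ - F₁ * (starRingEnd ℂ) F₀ = -(2 * Complex.I * ξ) := by
    have h1 := im_halfJost_real hq ξ
    rw [← hF₀, ← hF₁] at h1
    apply Complex.ext
    · simp [Complex.mul_re]; ring
    · simp only [Complex.mul_im, Complex.conj_re, Complex.conj_im] at h1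
      simp [Complex.mul_im]
      linarith
  set v₀ := minusData₀ q M ξ with hv₀
  set v₁ := minusData₁ q M ξ with hv₁
  have hspec : ∀ x : ℝ, x ≠ 0 → jostMinus q M ξ x =
      (scatteringPair q M ξ).1 * (starRingEnd ℂ) (jostPlus q M ξ x) +
        (scatteringPair q M ξ).2 * jostPlus q M ξ x := by
    apply Classical.epsilon_spec (p := fun p : ℂ × ℂ => ∀ x : ℝ, x ≠ 0 →
      jostMinus q M ξ x = p.1 * (starRingEnd ℂ) (jostPlus q M ξ x) + p.2 * jostPlus q M ξ x)
    -- Cramer's rule at `0⁺` for the system with columns `F̄` and `F`, of determinant `±2iξ`;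
    -- matching data there propagates to the whole line by uniqueness.
    set A := (v₀ * F₁ - v₁ * F₀) / (2 * Complex.I * ξ) with hA
    set B := (v₀ * (starRingEnd ℂ) F₁ - v₁ * (starRingEnd ℂ) F₀) / (-(2 * Complex.I * ξ)) with hB
    refine ⟨(A, B), fun x hx => ?_⟩
    have hc := (sPc.const_mul A).add (sP.const_mul B)
    have e0 : A * (starRingEnd ℂ) F₀ + B * F₀ = v₀ := by
      rw [hA, hB]
      field_simp
      linear_combination (-v₀) * hF
    have e1 : A * (starRingEnd ℂ) F₁ + B * F₁ = v₁ := by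
      rw [hA, hB]
      field_simp
      linear_combination (-v₁) * hF
    have hr : ∀ x, 0 < x → jostMinus q M ξ x =
        A * (starRingEnd ℂ) (jostPlus q M ξ x) + B * jostPlus q M ξ x := fun x hx => by
      refine sM.right.eq_of_data hq hc.right hdM ?_ hx
      have := (hdP.conj.const_mul A).add (hdP.const_mul B) (sPc.const_mul A).right
        (sP.const_mul B).right
      rwa [e0, e1] at this
    have := (sM.add (hc.const_mul (-1))).eq_zero hq hM (fun x hx => by rw [hr x hx]; ring) hx
    linear_combination this
  -- Conversely any pair satisfying the connection formula is determined by the data at `0⁺`, which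
  -- identifies the chosen pair.
  set P := scatteringPair q M ξ
  have hcomb := ((sPc.const_mul P.1).add (sP.const_mul P.2)).right
  have hd := (hdP.conj.const_mul P.1).add (hdP.const_mul P.2) (sPc.const_mul P.1).right
    (sP.const_mul P.2).right
  obtain ⟨e0, e1⟩ := hdM.unique (hd.congr fun x hx => (hspec x hx.ne').symm)
  rw [← hF₀] at e0
  rw [← hF₁] at e1
  apply Prod.ext
  · simp only
    rw [jostW, ← hF₀, ← hF₁, ← hv₀, ← hv₁, eq_div_iff hI, e0, e1]
    linear_combination P.1 * hF
  · simp only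
    rw [eq_div_iff (neg_ne_zero.2 hI), e0, e1]
    linear_combination (-P.2) * hF

theorem coeffA_eq {ζ : ℂ} (hζ : 0 ≤ ζ.im) (h0 : ζ ≠ 0) :
    coeffA q M ζ = jostW q M ζ / (2 * Complex.I * ζ) := by
  rcases hζ.eq_or_lt with h | h
  · have e : ζ = (ζ.re : ℂ) := Complex.ext rfl (by simp [← h])
    have hre : ζ.re ≠ 0 := fun h' => h0 (by rw [e, h', Complex.ofReal_zero])
    rw [coeffA, if_pos h.symm, scatteringPair_eq hq hM hre, ← e]
  · exact coeffA_eq_of_im_pos hq hM h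

theorem coeffB_eq {ξ : ℝ} (hξ : ξ ≠ 0) : coeffB q M ξ =
    (minusData₀ q M ξ * (starRingEnd ℂ) (halfJostDer q ξ 0) -
      minusData₁ q M ξ * (starRingEnd ℂ) (halfJost q ξ 0)) / (-(2 * Complex.I * ξ)) := by
  rw [coeffB, scatteringPair_eq hq hM hξ]

theorem norm_coeffA_sq {ξ : ℝ} (hξ : ξ ≠ 0) :
    ‖coeffA q M ξ‖ ^ 2 = 1 + ‖coeffB q M ξ‖ ^ 2 := by
  have h0 : (ξ : ℂ) ≠ 0 := by exact_mod_cast hξ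
  rw [coeffA_eq hq hM (by simp) h0, coeffB_eq hq hM hξ, norm_div, norm_div, norm_neg, div_pow,
    div_pow, jostW, norm_sq_wedge, im_minusData hM, im_halfJost_real hq,
    im_halfJost_real hq.comp_neg]
  have : ‖2 * Complex.I * (ξ : ℂ)‖ ^ 2 = 4 * ξ ^ 2 := by
    simp [mul_pow]; norm_num
  rw [this]
  field_simp
  ring

end Scattering

/-! ### The Wronskian of the Jost solutions as a function of the spectral parameter -/

theorem tendsto_ofReal_cobounded : Tendsto (fun ξ : ℝ => (ξ : ℂ)) atTop
    (Bornology.cobounded ℂ ⊓ 𝓟 {ζ : ℂ | 0 ≤ ζ.im}) := by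
  refine tendsto_inf.2 ⟨?_, tendsto_principal.2 (Eventually.of_forall fun ξ => by simp)⟩
  rw [← tendsto_norm_atTop_iff_cobounded]
  simpa using tendsto_abs_atTop_atTop

section JostW

variable {q : ℝ → ℝ} {M : Matrix (Fin 2) (Fin 2) ℝ} (hq : FirstMoment q)
include hq

theorem continuousOn_minusData :
    ContinuousOn (minusData₀ q M) {ζ : ℂ | 0 ≤ ζ.im} ∧
      ContinuousOn (minusData₁ q M) {ζ : ℂ | 0 ≤ ζ.im} := by
  have h := hq.comp_neg.tailIntegrable
  have h0 := h.continuousOn_jostSol 0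
  have h1 := h.continuousOn_jostDer 0
  exact ⟨(continuousOn_const.mul h0).sub (continuousOn_const.mul h1),
    (continuousOn_const.mul h0).sub (continuousOn_const.mul h1)⟩

theorem continuousOn_halfJost : ContinuousOn (fun ζ => halfJost q ζ 0) {ζ : ℂ | 0 ≤ ζ.im} ∧
    ContinuousOn (fun ζ => halfJostDer q ζ 0) {ζ : ℂ | 0 ≤ ζ.im} :=
  ⟨hq.tailIntegrable.continuousOn_jostSol 0, hq.tailIntegrable.continuousOn_jostDer 0⟩

theorem continuousOn_jostW : ContinuousOn (jostW q M) {ζ : ℂ | 0 ≤ ζ.im} :=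
  ((continuousOn_minusData hq).1.mul (continuousOn_halfJost hq).2).sub
    ((continuousOn_minusData hq).2.mul (continuousOn_halfJost hq).1)

theorem differentiableOn_jostW : DifferentiableOn ℂ (jostW q M) {ζ : ℂ | 0 < ζ.im} := by
  have h := hq.comp_neg.tailIntegrable
  have h0 := h.differentiableOn_jostSol 0
  have h1 := h.differentiableOn_jostDer 0
  have hv₀ : DifferentiableOn ℂ (minusData₀ q M) {ζ : ℂ | 0 < ζ.im} :=
    ((differentiableOn_const _).mul h0).sub ((differentiableOn_const _).mul h1)
  have hv₁ : DifferentiableOn ℂ (minusData₁ q M) {ζ : ℂ | 0 < ζ.im} :=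
    ((differentiableOn_const _).mul h0).sub ((differentiableOn_const _).mul h1)
  exact (hv₀.mul (hq.tailIntegrable.differentiableOn_jostDer 0)).sub
    (hv₁.mul (hq.tailIntegrable.differentiableOn_jostSol 0))

/-- A lower bound for the Wronskian off the imaginary axis, expressing self-adjointness. -/
theorem exists_le_norm_jostW (hM : M.det = 1) : ∃ X : ℝ, 0 ≤ X ∧ ∀ ζ : ℂ, 0 < ζ.im →
    |ζ.re| * Real.exp (-(ζ.im * X)) / 2 ≤ ‖jostW q M ζ‖ := by
  obtain ⟨X, hX, hXb⟩ := hq.exists_le_integral_norm_sq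
  obtain ⟨Y, hY, hYb⟩ := hq.comp_neg.exists_le_integral_norm_sq
  refine ⟨X + Y, by positivity, fun ζ hζ => ?_⟩
  have h1 := hq.im_sq_mul_integral_norm_sq hζ
  have h2 := hq.comp_neg.im_sq_mul_integral_norm_sq hζ
  have hX' := hXb ζ hζ
  have hY' := hYb ζ hζ
  set I₁ := ∫ x in Ioi (0 : ℝ), ‖halfJost q ζ x‖ ^ 2
  set I₂ := ∫ x in Ioi (0 : ℝ), ‖halfJost (fun x => q (-x)) ζ x‖ ^ 2
  -- The square of the conjugate Wronskian is discarded in `norm_sq_wedge`; the product of the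
  -- fluxes, which have opposite signs, contributes positively.
  have h3 : 4 * (ζ ^ 2).im ^ 2 * (I₁ * I₂) ≤ ‖jostW q M ζ‖ ^ 2 := by
    rw [jostW, norm_sq_wedge, im_minusData hM, ← h1, ← h2]
    nlinarith [sq_nonneg ‖minusData₀ q M ζ * (starRingEnd ℂ) (halfJostDer q ζ 0) -
      minusData₁ q M ζ * (starRingEnd ℂ) (halfJost q ζ 0)‖]
  have h4 : (ζ ^ 2).im = 2 * ζ.re * ζ.im := by
    rw [sq, Complex.mul_im]; ring
  have h5 : Real.exp (-(2 * ζ.im * X)) / (8 * ζ.im) * (Real.exp (-(2 * ζ.im * Y)) / (8 * ζ.im)) ≤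
      I₁ * I₂ := mul_le_mul hX' hY' (by positivity) ((by positivity : (0 : ℝ) ≤ _).trans hX')
  refine abs_le_of_sq_le_sq' ?_ (norm_nonneg _) |>.2
  refine le_trans ?_ h3
  refine le_trans (le_of_eq ?_) (mul_le_mul_of_nonneg_left h5 (by positivity))
  rw [h4, div_pow, mul_pow, sq_abs]
  have e1 : Real.exp (-(ζ.im * (X + Y))) ^ 2 =
      Real.exp (-(2 * ζ.im * X)) * Real.exp (-(2 * ζ.im * Y)) := by
    rw [← Real.exp_add, ← Real.exp_nat_mul]
    congr 1
    push_cast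
    ring
  rw [e1]
  field_simp
  ring

/-- When `W(0) = 0` the left data at zero energy are a real multiple `c` of the right data `(a, b)`.
Writing `v`, `F` for the left and right data at `ζ` and `e = (a, b)`, one has `(a² + b²)(v ∧ F) = (v
∧ e)(F · e) - (v · e)(F ∧ e)`. Lagrange's identity against zero energy gives `(F ∧ e)/ζ → -i` and
`(v ∧ e)/ζ → i/c`, so the limit is `i(c + 1/c)`, nonzero because `c` is real. -/
theorem tendsto_jostW_div_sector (hM : M.det = 1) (h0 : jostW q M 0 = 0) :
    ∃ L : ℂ, L ≠ 0 ∧ Tendsto (fun ζ => jostW q M ζ / ζ) (𝓝[sector] 0) (𝓝 L) := by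
  have him : 0 ≤ (0 : ℂ).im := by simp
  have hq' := hq.comp_neg
  have hdet := det_cast hM
  set a := halfJost q 0 0 with ha
  set b := halfJostDer q 0 0 with hb
  have hac : (starRingEnd ℂ) a = a := (hq.conj_halfJost_zero 0).1
  have hbc : (starRingEnd ℂ) b = b := (hq.conj_halfJost_zero 0).2
  have hab : ¬ (a = 0 ∧ b = 0) := hq.halfJost_data_ne_zero him
  have hvc₀ : (starRingEnd ℂ) (minusData₀ q M 0) = minusData₀ q M 0 := by
    simp [minusData₀, (hq'.conj_halfJost_zero 0).1, (hq'.conj_halfJost_zero 0).2]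
  have hvc₁ : (starRingEnd ℂ) (minusData₁ q M 0) = minusData₁ q M 0 := by
    simp [minusData₁, (hq'.conj_halfJost_zero 0).1, (hq'.conj_halfJost_zero 0).2]
  have hv : ¬ (minusData₀ q M 0 = 0 ∧ minusData₁ q M 0 = 0) := by
    rintro ⟨e0, e1⟩
    refine hq'.halfJost_data_ne_zero him ⟨?_, ?_⟩
    · simp only [minusData₀, minusData₁] at e0 e1
      linear_combination M 1 1 * e0 - M 0 1 * e1 -
        halfJost (fun x => q (-x)) 0 0 * hdet
    · simp only [minusData₀, minusData₁] at e0 e1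
      linear_combination M 1 0 * e0 - M 0 0 * e1 -
        halfJostDer (fun x => q (-x)) 0 0 * hdet
  have hw : minusData₀ q M 0 * b = minusData₁ q M 0 * a := sub_eq_zero.1 h0
  obtain ⟨c, hcc, hc0, hc1⟩ : ∃ c : ℂ, (starRingEnd ℂ) c = c ∧ minusData₀ q M 0 = c * a ∧
      minusData₁ q M 0 = c * b := by
    by_cases ha0 : a = 0
    · have hb0 : b ≠ 0 := fun h => hab ⟨ha0, h⟩
      refine ⟨minusData₁ q M 0 / b, by simp [hvc₁, hbc], ?_, by field_simp⟩
      rw [ha0, mul_zero] at hw ⊢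
      exact (mul_eq_zero.1 hw).resolve_right hb0
    · refine ⟨minusData₀ q M 0 / a, by simp [hvc₀, hac], by field_simp, ?_⟩
      field_simp
      linear_combination -hw
  have hcne : c ≠ 0 := by
    rintro rfl
    exact hv ⟨by rw [hc0, zero_mul], by rw [hc1, zero_mul]⟩
  obtain ⟨a', ha'⟩ := Complex.conj_eq_iff_real.1 hac
  obtain ⟨b', hb'⟩ := Complex.conj_eq_iff_real.1 hbc
  obtain ⟨c', hc'⟩ := Complex.conj_eq_iff_real.1 hcc
  have hD : a ^ 2 + b ^ 2 ≠ 0 := by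
    rw [ha', hb']
    norm_cast
    intro h
    have e1 : a' = 0 := by nlinarith [sq_nonneg a', sq_nonneg b']
    have e2 : b' = 0 := by nlinarith [sq_nonneg a', sq_nonneg b']
    exact hab ⟨by rw [ha', e1, Complex.ofReal_zero], by rw [hb', e2, Complex.ofReal_zero]⟩
  have hL : Complex.I * (c + 1 / c) ≠ 0 := by
    refine mul_ne_zero Complex.I_ne_zero ?_
    have hc'0 : c' ≠ 0 := by
      rintro rfl
      exact hcne (by rw [hc', Complex.ofReal_zero])
    rw [hc']
    norm_cast
    have : c' + 1 / c' = (c' ^ 2 + 1) / c' := by field_simp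
    rw [this]
    positivity
  refine ⟨Complex.I * (c + 1 / c), hL, ?_⟩
  have hsub : sector ⊆ {ζ : ℂ | 0 ≤ ζ.im} := fun ζ hζ => le_of_lt hζ.1
  have hlim : ∀ {g : ℂ → ℂ}, ContinuousOn g {ζ : ℂ | 0 ≤ ζ.im} →
      Tendsto g (𝓝[sector] 0) (𝓝 (g 0)) := fun hg =>
    (hg 0 (by simp)).mono_left (nhdsWithin_mono _ hsub)
  have l1 := hlim (continuousOn_halfJost hq).1
  have l2 := hlim (continuousOn_halfJost hq).2
  have l3 := hlim (continuousOn_minusData (M := M) hq).1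
  have l4 := hlim (continuousOn_minusData (M := M) hq).2
  have r1 : Tendsto (fun ζ => (halfJost q ζ 0 * b - halfJostDer q ζ 0 * a) / ζ) (𝓝[sector] 0)
      (𝓝 (-Complex.I)) := by
    refine hq.tendsto_mul_integral_halfJost.neg.congr' ?_
    filter_upwards [self_mem_nhdsWithin] with ζ hζ
    have hζ0 : ζ ≠ 0 := by rintro rfl; simpa using hζ.1
    rw [eq_div_iff hζ0]
    linear_combination -(hq.sq_mul_integral_halfJost hζ.1)
  have r2 : Tendsto (fun ζ => (minusData₀ q M ζ * b - minusData₁ q M ζ * a) / ζ) (𝓝[sector] 0)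
      (𝓝 (Complex.I * (1 / c))) := by
    refine (hq'.tendsto_mul_integral_halfJost.mul_const (1 / c)).congr' ?_
    filter_upwards [self_mem_nhdsWithin] with ζ hζ
    have hζ0 : ζ ≠ 0 := by rintro rfl; simpa using hζ.1
    have e1 := hq'.sq_mul_integral_halfJost hζ.1
    have e2 : c * (minusData₀ q M ζ * b - minusData₁ q M ζ * a) =
        halfJostDer (fun x => q (-x)) ζ 0 * halfJost (fun x => q (-x)) 0 0 -
        halfJost (fun x => q (-x)) ζ 0 * halfJostDer (fun x => q (-x)) 0 0 := by
      have : c * (minusData₀ q M ζ * b - minusData₁ q M ζ * a) =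
          minusData₀ q M ζ * (c * b) - minusData₁ q M ζ * (c * a) := by ring
      rw [this, ← hc0, ← hc1]
      simp only [minusData₀, minusData₁]
      linear_combination (halfJostDer (fun x => q (-x)) ζ 0 * halfJost (fun x => q (-x)) 0 0 -
        halfJost (fun x => q (-x)) ζ 0 * halfJostDer (fun x => q (-x)) 0 0) * hdet
    field_simp
    linear_combination e1 - e2
  have key := ((r2.mul ((l1.mul_const a).add (l2.mul_const b))).sub
    (((l3.mul_const a).add (l4.mul_const b)).mul r1)).div_const (a ^ 2 + b ^ 2)
  have e : (Complex.I * (1 / c) * (halfJost q 0 0 * a + halfJostDer q 0 0 * b) -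
      (minusData₀ q M 0 * a + minusData₁ q M 0 * b) * -Complex.I) / (a ^ 2 + b ^ 2) =
      Complex.I * (c + 1 / c) := by
    rw [← ha, ← hb, hc0, hc1, div_eq_iff hD]
    ring
  rw [e] at key
  refine key.congr' ?_
  filter_upwards [self_mem_nhdsWithin] with ζ hζ
  have hζ0 : ζ ≠ 0 := by rintro rfl; simpa using hζ.1
  rw [jostW]
  field_simp
  ring

/-- The Wronskian vanishes at most to first order at zero energy. -/
theorem exists_low_energy_bound (hM : M.det = 1) : ∃ c : ℝ, 0 < c ∧ ∃ δ : ℝ, 0 < δ ∧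
    ∀ ζ : ℂ, 0 < ζ.im → ‖ζ‖ < δ → c * ‖ζ‖ ≤ ‖jostW q M ζ‖ := by
  by_cases h0 : jostW q M 0 = 0
  · obtain ⟨L, hL, hlim⟩ := tendsto_jostW_div_sector hq hM h0
    have hLpos : 0 < ‖L‖ := norm_pos_iff.2 hL
    have hev := hlim.norm.eventually (lt_mem_nhds (half_lt_self hLpos))
    obtain ⟨δ, hδ, hsub⟩ := Metric.mem_nhdsWithin_iff.1 hev
    obtain ⟨X, hX, hXb⟩ := exists_le_norm_jostW hq hM
    refine ⟨min (‖L‖ / 2) (Real.exp (-X) / 4), by positivity, min δ 1, by positivity,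
      fun ζ hζ hn => ?_⟩
    -- Inside the sector the limit of `W/ζ` gives the bound; outside it `‖ζ‖ ≤ 2|Re ζ|` and
    -- `exists_le_norm_jostW` suffices.
    by_cases hs : |ζ.re| ≤ ζ.im
    · have h1 := hsub ⟨by simpa using hn.trans_le (min_le_left _ _), hζ, hs⟩
      have h1 : ‖L‖ / 2 < ‖jostW q M ζ / ζ‖ := h1
      have hζ0 : 0 < ‖ζ‖ := norm_pos_iff.2 (by rintro rfl; simp at hζ)
      rw [norm_div, lt_div_iff₀ hζ0] at h1
      exact (mul_le_mul_of_nonneg_right (min_le_left _ _) hζ0.le).trans h1.le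
    · refine le_trans ?_ (hXb ζ hζ)
      have h2 : ‖ζ‖ ≤ 2 * |ζ.re| := by
        have := Complex.norm_le_abs_re_add_abs_im ζ
        rw [abs_of_pos hζ] at this
        linarith [not_le.1 hs]
      have h3 : ζ.im ≤ 1 := by
        have := Complex.abs_im_le_norm ζ
        rw [abs_of_pos hζ] at this
        linarith [hn.trans_le (min_le_right _ _)]
      have h4 : Real.exp (-X) ≤ Real.exp (-(ζ.im * X)) := by
        rw [Real.exp_le_exp]
        nlinarith
      calc min (‖L‖ / 2) (Real.exp (-X) / 4) * ‖ζ‖ ≤ Real.exp (-X) / 4 * (2 * |ζ.re|) := by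
            gcongr
            exact min_le_right _ _
        _ = |ζ.re| * Real.exp (-X) / 2 := by ring
        _ ≤ _ := by gcongr
  · have hpos : 0 < ‖jostW q M 0‖ := norm_pos_iff.2 h0
    have h1 := ((continuousOn_jostW (M := M) hq) 0 (by simp)).norm.eventually
      (lt_mem_nhds (half_lt_self hpos))
    obtain ⟨δ, hδ, hsub⟩ := Metric.mem_nhdsWithin_iff.1 h1
    refine ⟨‖jostW q M 0‖ / 2, by positivity, min δ 1, by positivity, fun ζ hζ hn => ?_⟩
    have h2 := hsub ⟨by simpa using hn.trans_le (min_le_left _ _), le_of_lt hζ⟩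
    have h2 : ‖jostW q M 0‖ / 2 < ‖jostW q M ζ‖ := h2
    have h3 : ‖ζ‖ ≤ 1 := (hn.trans_le (min_le_right _ _)).le
    nlinarith

/-! ### High energy -/

/-- The derivatives at `0` of both half-line solutions behave like `iζ`, and their values like `1`;
the only quadratic term is `-m₁₂ (iζ)²`. -/
theorem tendsto_jostW_div_sq : Tendsto (fun ζ : ℂ => jostW q M ζ / ζ ^ 2)
    (Bornology.cobounded ℂ ⊓ 𝓟 {ζ | 0 ≤ ζ.im}) (𝓝 (M 0 1)) := by
  have f0 := hq.tendsto_halfJost_cobounded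
  have f1 := hq.tendsto_halfJostDer_cobounded
  have g0 := hq.comp_neg.tendsto_halfJost_cobounded
  have g1 := hq.comp_neg.tendsto_halfJostDer_cobounded
  have hinv : Tendsto (fun ζ : ℂ => (Complex.I * ζ)⁻¹)
      (Bornology.cobounded ℂ ⊓ 𝓟 {ζ | 0 ≤ ζ.im}) (𝓝 0) := by
    have : Tendsto (fun ζ : ℂ => Complex.I⁻¹ * ζ⁻¹) (Bornology.cobounded ℂ) (𝓝 (Complex.I⁻¹ * 0)) :=
      (tendsto_inv₀_cobounded (α := ℂ)).const_mul Complex.I⁻¹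
    rw [mul_zero] at this
    exact (this.congr fun ζ => by rw [mul_inv]).mono_left inf_le_left
  have key := ((((g0.const_mul (M 0 0 : ℂ)).mul hinv).sub (g1.const_mul (M 0 1 : ℂ))).mul f1).sub
    (((((g0.const_mul (M 1 0 : ℂ)).mul hinv).sub (g1.const_mul (M 1 1 : ℂ))).mul hinv).mul f0)
  have key2 := key.neg
  simp only [mul_zero, mul_one, zero_sub, sub_zero, neg_neg] at key2
  refine key2.congr' ?_
  filter_upwards [mem_inf_of_left (Bornology.eventually_ne_cobounded (0 : ℂ))] with ζ hne
  have hne : ζ ≠ 0 := hne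
  have h2 : Complex.I ^ 2 = -1 := Complex.I_sq
  rw [jostW, minusData₀, minusData₁]
  have hI : (Complex.I * ζ) ^ 2 = -ζ ^ 2 := by rw [mul_pow, h2]; ring
  have hIne : Complex.I * ζ ≠ 0 := mul_ne_zero Complex.I_ne_zero hne
  rw [eq_div_iff (pow_ne_zero 2 hne)]
  have : ζ ^ 2 = -(Complex.I * ζ) ^ 2 := by rw [hI, neg_neg]
  rw [this]
  generalize Complex.I * ζ = z at hIne
  field_simp

theorem tendsto_minusData (h01 : M 0 1 = 0) :
    Tendsto (minusData₀ q M) (Bornology.cobounded ℂ ⊓ 𝓟 {ζ | 0 ≤ ζ.im}) (𝓝 (M 0 0)) ∧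
    Tendsto (fun ζ => minusData₁ q M ζ / (Complex.I * ζ))
      (Bornology.cobounded ℂ ⊓ 𝓟 {ζ | 0 ≤ ζ.im}) (𝓝 (-M 1 1)) := by
  have g0 := hq.comp_neg.tendsto_halfJost_cobounded
  have g1 := hq.comp_neg.tendsto_halfJostDer_cobounded
  have hinv : Tendsto (fun ζ : ℂ => (Complex.I * ζ)⁻¹)
      (Bornology.cobounded ℂ ⊓ 𝓟 {ζ | 0 ≤ ζ.im}) (𝓝 0) := by
    have : Tendsto (fun ζ : ℂ => Complex.I⁻¹ * ζ⁻¹) (Bornology.cobounded ℂ) (𝓝 (Complex.I⁻¹ * 0)) :=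
      (tendsto_inv₀_cobounded (α := ℂ)).const_mul Complex.I⁻¹
    rw [mul_zero] at this
    exact (this.congr fun ζ => by rw [mul_inv]).mono_left inf_le_left
  constructor
  · have := g0.const_mul (M 0 0 : ℂ)
    rw [mul_one] at this
    refine this.congr fun ζ => ?_
    simp [minusData₀, h01]
  · have := ((g0.const_mul (M 1 0 : ℂ)).mul hinv).sub (g1.const_mul (M 1 1 : ℂ))
    simp only [mul_zero, mul_one, zero_sub] at this
    refine this.congr fun ζ => ?_
    simp only [minusData₁]
    ring

theorem tendsto_jostW_div (h01 : M 0 1 = 0) : Tendsto (fun ζ : ℂ => jostW q M ζ / (2 * Complex.I * ζ))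
    (Bornology.cobounded ℂ ⊓ 𝓟 {ζ | 0 ≤ ζ.im}) (𝓝 (((M 0 0 + M 1 1) / 2 : ℝ) : ℂ)) := by
  obtain ⟨v0, v1⟩ := tendsto_minusData (M := M) hq h01
  have key := ((v0.mul hq.tendsto_halfJostDer_cobounded).sub
    (v1.mul hq.tendsto_halfJost_cobounded)).div_const 2
  have e : (((M 0 0 + M 1 1) / 2 : ℝ) : ℂ) = ((M 0 0 : ℂ) * 1 - -(M 1 1 : ℂ) * 1) / 2 := by
    push_cast; ring
  rw [e]
  refine key.congr fun ζ => ?_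
  rw [jostW]
  ring

/-- Compared with the limit for `A`, conjugation replaces `iξ` by `-iξ` in the right data, which
turns `m₁₁ + m₂₂` into `m₁₁ - m₂₂`. -/
theorem tendsto_coeffB (hM : M.det = 1) (h01 : M 0 1 = 0) :
    Tendsto (coeffB q M) atTop (𝓝 (((M 0 0 - M 1 1) / 2 : ℝ) : ℂ)) := by
  obtain ⟨v0, v1⟩ := tendsto_minusData (M := M) hq h01
  have hre := tendsto_ofReal_cobounded
  have c0 := (Complex.continuous_conj.tendsto _).comp (hq.tendsto_halfJost_cobounded.comp hre)
  have c1 := (Complex.continuous_conj.tendsto _).comp (hq.tendsto_halfJostDer_cobounded.comp hre)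
  have key := (((v0.comp hre).mul c1).add ((v1.comp hre).mul c0)).div_const 2
  have e : (((M 0 0 - M 1 1) / 2 : ℝ) : ℂ) = ((M 0 0 : ℂ) * (starRingEnd ℂ) 1 +
      -(M 1 1 : ℂ) * (starRingEnd ℂ) 1) / 2 := by
    rw [map_one]; push_cast; ring
  rw [e]
  refine key.congr' ?_
  filter_upwards [eventually_ne_atTop 0] with ξ hξ
  rw [coeffB_eq hq hM hξ]
  have hξ' : (ξ : ℂ) ≠ 0 := by exact_mod_cast hξ
  simp only [Function.comp_apply, map_div₀, map_mul, Complex.conj_I, Complex.conj_ofReal]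
  field_simp
  ring

end JostW

/-! ### Eigenvalues -/

section Eigenvalues

variable {q : ℝ → ℝ} {M : Matrix (Fin 2) (Fin 2) ℝ} (hq : FirstMoment q) (hM : M.det = 1)
include hq hM

theorem re_eq_zero_of_jostW {ζ : ℂ} (hζ : 0 < ζ.im) (hW : jostW q M ζ = 0) : ζ.re = 0 := by
  obtain ⟨X, -, hX⟩ := exists_le_norm_jostW hq hM
  have h := hX ζ hζ
  rw [hW, norm_zero] at h
  have h1 := Real.exp_pos (-(ζ.im * X))
  by_contra h0
  have h2 : 0 < |ζ.re| := abs_pos.2 h0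
  have h3 : 0 < |ζ.re| * Real.exp (-(ζ.im * X)) := mul_pos h2 h1
  linarith

theorem isEigenvalueL_of_jostW {η : ℝ} (hη : 0 < η) (hW : jostW q M (Complex.I * η) = 0) :
    IsEigenvalueL q M (-(η : ℂ) ^ 2) := by
  have hq' := hq.comp_neg
  have hdet := det_cast hM
  set q' : ℝ → ℝ := fun x => q (-x)
  set ζ : ℂ := Complex.I * η with hζdef
  have hζ : 0 < ζ.im := by simpa [hζdef] using hη
  have hlam : -(η : ℂ) ^ 2 = ζ ^ 2 := by rw [hζdef, mul_pow, Complex.I_sq]; ring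
  rw [hlam]
  have hF := hq.halfJost_data_ne_zero hζ.le
  -- A vanishing Wronskian makes the two data vectors parallel; the ratio is taken in a nonzero
  -- component of the right data. Gluing then yields a solution decaying at both ends.
  obtain ⟨c, hc0, hc1⟩ : ∃ c : ℂ, c * halfJost q ζ 0 = minusData₀ q M ζ ∧
      c * halfJostDer q ζ 0 = minusData₁ q M ζ := by
    rw [jostW] at hW
    by_cases h0 : halfJost q ζ 0 = 0
    · have h1 : halfJostDer q ζ 0 ≠ 0 := fun h => hF ⟨h0, h⟩
      refine ⟨minusData₁ q M ζ / halfJostDer q ζ 0, ?_, by field_simp⟩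
      rw [h0, mul_zero, sub_zero] at hW
      rw [h0, mul_zero]
      exact ((mul_eq_zero.1 hW).resolve_right h1).symm
    · refine ⟨minusData₀ q M ζ / halfJost q ζ 0, by field_simp, ?_⟩
      field_simp
      linear_combination hW
  set f := halfJost q ζ
  set g := halfJost q' ζ
  have hcf : Continuous f := hq.continuous_halfJost hζ.le
  have hcg : Continuous g := hq'.continuous_halfJost hζ.le
  set y := glue (fun x => c * f x) g with hy
  have hsol : TransferSol q M (ζ ^ 2) y :=
    transferSol_glue ((hq.halfSol_halfJost hζ.le).const_mul c) (hq'.halfSol_halfJost hζ.le)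
      (u₀ := g 0) (u₁ := -halfJostDer q' ζ 0) (by rw [neg_neg]; exact hq'.hasData_halfJost hζ.le)
      ((hq.hasData_halfJost hζ.le).const_mul c)
      (by rw [hc0, minusData₀]; ring) (by rw [hc1, minusData₁]; ring)
  obtain ⟨hac, htr, heq⟩ := transferSol_iff.1 hsol
  have hmeas : AEStronglyMeasurable y volume := by
    refine Measurable.aestronglyMeasurable ?_
    exact Measurable.ite measurableSet_Ioi (hcf.measurable.const_mul c)
      (hcg.measurable.comp measurable_neg)
  have hL2 : MemLp y 2 volume := by
    rw [memLp_two_iff_integrable_sq_norm hmeas, ← integrableOn_univ, ← Iic_union_Ioi (a := (0 : ℝ)),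
      integrableOn_union, integrableOn_Iic_iff_integrableOn_Iio]
    constructor
    · have h1 := (hq'.integrableOn_norm_sq_halfJost hζ)
      rw [← neg_zero] at h1
      refine h1.comp_neg_Iio.congr_fun (fun x hx => ?_) measurableSet_Iio
      have : y x = g (-x) := by
        have := glue_neg (yp := fun x => c * f x) (ym := g) (neg_pos.2 hx)
        rwa [neg_neg] at this
      rw [this]
    · have h1 : IntegrableOn (fun x => ‖c‖ ^ 2 * ‖f x‖ ^ 2) (Ioi 0) volume :=
        (hq.integrableOn_norm_sq_halfJost hζ).const_mul _
      refine h1.congr_fun (fun x hx => ?_) measurableSet_Ioi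
      have : y x = c * f x := glue_pos hx
      simp only [this, norm_mul, mul_pow]
  refine ⟨y, ⟨hL2, (hL2.const_mul (ζ ^ 2)).ae_eq (by filter_upwards [heq] with x hx using hx.symm),
    hac, htr⟩, fun h0 => ?_, heq⟩
  obtain ⟨a, ha, hga⟩ := hq'.exists_halfJost_ne_zero hζ.le
  have h1 : (fun x => y (-x)) =ᵐ[volume.restrict (Ioi 0)] fun _ => 0 :=
    ae_restrict_of_ae (ae_neg h0)
  have h2 := Measure.eqOn_open_of_ae_eq h1 isOpen_Ioi hsol.left.continuousOn continuousOn_const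
    (mem_Ioi.2 ha)
  exact hga ((glue_neg (yp := fun x => c * f x) (ym := g) ha).symm.trans h2)

theorem exists_of_isEigenvalueL {lam : ℂ} (h : IsEigenvalueL q M lam) :
    ∃ η : ℝ, 0 < η ∧ lam = -(η : ℂ) ^ 2 ∧ jostW q M (Complex.I * η) = 0 := by
  have hq' := hq.comp_neg
  obtain ⟨y, ⟨hL2, -, hac, htr⟩, hne, heq⟩ := h
  have hsol : TransferSol q M lam y := transferSol_iff.2 ⟨hac, htr, heq⟩
  have hL2' : MemLp (fun x => y (-x)) 2 volume :=
    hL2.comp_measurePreserving (Measure.measurePreserving_neg volume)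
  have hzero : ¬ ((∀ x, 0 < x → y x = 0) ∧ ∀ x, 0 < x → y (-x) = 0) := by
    rintro ⟨h1, h2⟩
    refine hne ?_
    have h0 : ∀ᵐ x : ℝ, x ≠ 0 := by simp [ae_iff, measure_singleton]
    filter_upwards [h0] with x hx
    rcases hx.lt_or_gt with hx | hx
    · simpa using h2 (-x) (neg_pos.2 hx)
    · exact h1 x hx
  -- Every `lam` has a square root in the closed upper half-plane. If that root is real, the
  -- solution vanishes on both sides. Otherwise it is `c f₊` on the right and `d f₋` on the left,
  -- and matching at the origin is a linear system in `c, d` with determinant `W` up to sign.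
  obtain ⟨ζ, hζ, rfl⟩ : ∃ ζ : ℂ, 0 ≤ ζ.im ∧ ζ ^ 2 = lam := by
    obtain ⟨z, hz⟩ := IsAlgClosed.exists_pow_nat_eq lam two_pos
    rcases le_total 0 z.im with h | h
    · exact ⟨z, h, hz⟩
    · exact ⟨-z, by simpa using h, by rw [neg_sq, hz]⟩
  rcases hζ.eq_or_lt with h0 | hpos
  · exact absurd ⟨fun x hx => hq.eq_zero_of_memLp hζ h0.symm hsol.right hL2 hx,
      fun x hx => hq'.eq_zero_of_memLp hζ h0.symm hsol.left hL2' hx⟩ hzero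
  obtain ⟨c, hc⟩ := hq.eq_const_mul_of_memLp hζ hsol.right hL2
  obtain ⟨d, hd⟩ := hq'.eq_const_mul_of_memLp hζ hsol.left hL2'
  have hW : jostW q M ζ = 0 := by
    by_contra hW
    have d1 := ((hq.hasData_halfJost hζ).const_mul c).congr fun x hx => (hc x hx).symm
    have d2 := hsol.right_data
      (((hq'.hasData_halfJost hζ).const_mul d).congr fun x hx => (hd x hx).symm)
    obtain ⟨e0, e1⟩ := d1.unique d2
    have e0 : c * halfJost q ζ 0 = d * minusData₀ q M ζ := by rw [e0, minusData₀]; ring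
    have e1 : c * halfJostDer q ζ 0 = d * minusData₁ q M ζ := by rw [e1, minusData₁]; ring
    have hd0 : d = 0 := by
      have : d * jostW q M ζ = 0 := by
        rw [jostW]; linear_combination halfJost q ζ 0 * e1 - halfJostDer q ζ 0 * e0
      exact (mul_eq_zero.1 this).resolve_right hW
    have hc0 : c = 0 := by
      have : c * jostW q M ζ = 0 := by
        rw [jostW]; linear_combination minusData₀ q M ζ * e1 - minusData₁ q M ζ * e0
      exact (mul_eq_zero.1 this).resolve_right hW
    exact hzero ⟨fun x hx => by rw [hc x hx, hc0, zero_mul], fun x hx => by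
      rw [hd x hx, hd0, zero_mul]⟩
  have hre := re_eq_zero_of_jostW hq hM hpos hW
  have e : ζ = Complex.I * (ζ.im : ℂ) := by
    apply Complex.ext <;> simp [hre]
  refine ⟨ζ.im, hpos, ?_, by rwa [← e]⟩
  nth_rewrite 1 [e]
  rw [mul_pow, Complex.I_sq]
  ring

theorem isEigenvalueL_iff {lam : ℂ} : IsEigenvalueL q M lam ↔
    ∃ η : ℝ, 0 < η ∧ lam = -(η : ℂ) ^ 2 ∧ jostW q M (Complex.I * η) = 0 := by
  refine ⟨exists_of_isEigenvalueL hq hM, ?_⟩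
  rintro ⟨η, hη, rfl, hW⟩
  exact isEigenvalueL_of_jostW hq hM hη hW

/-- The leading coefficient at infinity is `m₁₂`, or a multiple of `m₁₁ + m₂₂` when `m₁₂ = 0`; the
latter is nonzero because then `m₁₁ m₂₂ = 1`. -/
theorem exists_forall_jostW_ne_zero :
    ∃ R : ℝ, ∀ ζ : ℂ, 0 ≤ ζ.im → R < ‖ζ‖ → jostW q M ζ ≠ 0 := by
  have h : ∀ᶠ ζ in Bornology.cobounded ℂ ⊓ 𝓟 {ζ : ℂ | 0 ≤ ζ.im}, jostW q M ζ ≠ 0 := by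
    by_cases h01 : M 0 1 = 0
    · have h1 : (((M 0 0 + M 1 1) / 2 : ℝ) : ℂ) ≠ 0 := by
        rw [Matrix.det_fin_two, h01, zero_mul, sub_zero] at hM
        rw [Complex.ofReal_ne_zero]
        intro h
        have h11 : M 1 1 = -M 0 0 := by linarith
        rw [h11] at hM
        nlinarith [sq_nonneg (M 0 0)]
      filter_upwards [(tendsto_jostW_div hq h01).eventually_ne h1] with ζ hζ h0
      exact hζ (by rw [h0, zero_div])
    · have h1 : (M 0 1 : ℂ) ≠ 0 := by exact_mod_cast h01
      filter_upwards [(tendsto_jostW_div_sq hq).eventually_ne h1] with ζ hζ h0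
      exact hζ (by rw [h0, zero_div])
  rw [eventually_inf_principal, ← comap_norm_atTop, eventually_comap] at h
  obtain ⟨R, hR⟩ := eventually_atTop.1 h
  exact ⟨R, fun ζ hζ hn => hR ‖ζ‖ hn.le ζ rfl hζ⟩

/-- The zeros lie in a compact subset of the open upper half-plane by the low and high energy
bounds. An accumulation point would make `W` vanish identically there, contradicting `W ≠ 0` off the
imaginary axis, for instance at `1 + i`. -/
theorem finite_zeros_jostW : {η : ℝ | 0 < η ∧ jostW q M (Complex.I * η) = 0}.Finite := by
  obtain ⟨R, hR⟩ := exists_forall_jostW_ne_zero hq hM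
  obtain ⟨c, hc, δ, hδ, hlow⟩ := exists_low_energy_bound hq hM
  set S : Set ℂ := {ζ : ℂ | 0 < ζ.im ∧ jostW q M ζ = 0}
  have hsub : S ⊆ Metric.closedBall 0 R ∩ {ζ : ℂ | δ ≤ ζ.im} := by
    rintro ζ ⟨hζ, hW⟩
    have hre := re_eq_zero_of_jostW hq hM hζ hW
    have hn : ‖ζ‖ = ζ.im := by
      have e : ζ = Complex.I * (ζ.im : ℂ) := by apply Complex.ext <;> simp [hre]
      rw [e, norm_mul, Complex.norm_I, one_mul, Complex.norm_real, Real.norm_of_nonneg hζ.le]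
      simp
    constructor
    · rw [mem_closedBall_zero_iff]
      by_contra h
      exact hR ζ hζ.le (not_le.1 h) hW
    · by_contra h
      have h : ζ.im < δ := not_le.1 h
      have := hlow ζ hζ (by rwa [hn])
      rw [hW, norm_zero, hn] at this
      nlinarith
  have hK : IsCompact (Metric.closedBall (0 : ℂ) R ∩ {ζ : ℂ | δ ≤ ζ.im}) :=
    (isCompact_closedBall 0 R).inter_right (isClosed_le continuous_const Complex.continuous_im)
  have hfin : S.Finite := by
    by_contra hinf
    obtain ⟨z, hz, hacc⟩ := Set.Infinite.exists_accPt_of_subset_isCompact hinf hK hsub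
    have hz0 : 0 < z.im := hδ.trans_le hz.2
    have hU : IsOpen {ζ : ℂ | 0 < ζ.im} := isOpen_lt continuous_const Complex.continuous_im
    have hfreq : ∃ᶠ w in 𝓝[≠] z, jostW q M w = 0 :=
      (accPt_iff_frequently_nhdsNE.1 hacc).mono fun w hw => hw.2
    have := ((differentiableOn_jostW (M := M) hq).analyticOnNhd
      hU).eqOn_zero_of_preconnected_of_frequently_eq_zero
      (convex_halfSpace_im_gt 0).isPreconnected hz0 hfreq
    have h1 : (0 : ℝ) < (1 + Complex.I).im := by simp
    have h2 := re_eq_zero_of_jostW hq hM h1 (this h1)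
    simp at h2
  refine Set.Finite.of_finite_image (f := fun η : ℝ => Complex.I * (η : ℂ)) (hfin.subset ?_) ?_
  · rintro _ ⟨η, ⟨hη, hW⟩, rfl⟩
    exact ⟨by simpa using hη, hW⟩
  · intro a _ b _ h
    simpa using h

end Eigenvalues

/-! ### Holomorphic functions on the upper half-plane with boundary values of constant modulus -/

section HalfPlane

theorem norm_le_norm_add_I_mul {ζ : ℂ} (hζ : 0 ≤ ζ.im) {η : ℝ} (hη : 0 ≤ η) :
    ‖ζ‖ ≤ ‖ζ + Complex.I * η‖ := by
  rw [← sq_le_sq₀ (norm_nonneg _) (norm_nonneg _), Complex.sq_norm, Complex.sq_norm,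
    Complex.normSq_apply, Complex.normSq_apply]
  simp
  nlinarith [mul_nonneg hζ hη]

theorem norm_sub_le_norm_add_I_mul {ζ : ℂ} (hζ : 0 ≤ ζ.im) {η : ℝ} (hη : 0 ≤ η) :
    ‖ζ - Complex.I * η‖ ≤ ‖ζ + Complex.I * η‖ := by
  rw [← sq_le_sq₀ (norm_nonneg _) (norm_nonneg _), Complex.sq_norm, Complex.sq_norm,
    Complex.normSq_apply, Complex.normSq_apply]
  simp
  nlinarith [mul_nonneg hζ hη]

theorem norm_sub_eq_norm_add_I_mul (ξ η : ℝ) :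
    ‖(ξ : ℂ) - Complex.I * η‖ = ‖(ξ : ℂ) + Complex.I * η‖ := by
  rw [← sq_eq_sq₀ (norm_nonneg _) (norm_nonneg _), Complex.sq_norm, Complex.sq_norm,
    Complex.normSq_apply, Complex.normSq_apply]
  simp

theorem add_I_mul_ne_zero {ζ : ℂ} (hζ : 0 ≤ ζ.im) {η : ℝ} (hη : 0 < η) :
    ζ + Complex.I * η ≠ 0 := by
  intro h
  have := congrArg Complex.im h
  simp at this
  linarith

theorem closure_im_pos : closure {ζ : ℂ | 0 < ζ.im} = {ζ : ℂ | 0 ≤ ζ.im} :=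
  Complex.closure_setOfPred_lt_im 0

theorem isOpen_im_pos : IsOpen {ζ : ℂ | 0 < ζ.im} :=
  isOpen_lt continuous_const Complex.continuous_im

/-- The Phragmén–Lindelöf principle for a bounded function on the upper half-plane. -/
theorem norm_le_of_norm_le_on_real {g : ℂ → ℂ} {C : ℝ} (hc : ContinuousOn g {ζ | 0 ≤ ζ.im})
    (hd : DifferentiableOn ℂ g {ζ | 0 < ζ.im}) (hreal : ∀ ξ : ℝ, ‖g ξ‖ ≤ C)
    (hinf : g =O[Bornology.cobounded ℂ ⊓ 𝓟 {ζ : ℂ | 0 ≤ ζ.im}] fun _ => (1 : ℝ))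
    {ζ : ℂ} (hζ : 0 ≤ ζ.im) : ‖g ζ‖ ≤ C := by
  have hre : ∀ z : ℂ, (Complex.I * z).im = z.re := fun z => by simp
  have hclos : closure {z : ℂ | 0 < z.re} = {z : ℂ | 0 ≤ z.re} := Complex.closure_setOfPred_lt_re 0
  have hdc : DiffContOnCl ℂ (fun z => g (Complex.I * z)) {z | 0 < z.re} := by
    constructor
    · exact hd.comp (differentiable_id.const_mul Complex.I).differentiableOn
        fun z hz => by simpa only [mem_ofPred_eq, hre] using hz
    · rw [hclos]
      exact hc.comp (continuous_const.mul continuous_id).continuousOn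
        fun z hz => by simpa only [mem_ofPred_eq, hre] using hz
  have htend : Tendsto (fun z : ℂ => Complex.I * z) (Bornology.cobounded ℂ ⊓ 𝓟 {z | 0 < z.re})
      (Bornology.cobounded ℂ ⊓ 𝓟 {ζ : ℂ | 0 ≤ ζ.im}) := by
    refine tendsto_inf.2 ⟨?_, tendsto_principal.2 ?_⟩
    · refine Tendsto.mono_left ?_ inf_le_left
      rw [← tendsto_norm_atTop_iff_cobounded]
      simpa using tendsto_norm_cobounded_atTop
    · filter_upwards [mem_inf_of_right (mem_principal_self _)] with z hz
      exact (hre z).symm ▸ (le_of_lt hz)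
  have hO := hinf.comp_tendsto htend
  have hb : IsBoundedUnder (· ≤ ·) atTop fun x : ℝ => ‖g (Complex.I * (x : ℂ))‖ := by
    have ht : Tendsto (fun x : ℝ => (x : ℂ)) atTop (Bornology.cobounded ℂ ⊓ 𝓟 {z | 0 < z.re}) := by
      refine tendsto_inf.2 ⟨?_, tendsto_principal.2 ?_⟩
      · rw [← tendsto_norm_atTop_iff_cobounded]
        simpa using tendsto_abs_atTop_atTop
      · filter_upwards [eventually_gt_atTop 0] with x hx
        simpa using hx
    exact (Asymptotics.isBigO_one_iff ℝ).1 (hO.comp_tendsto ht)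
  -- The map `z ↦ iz` carries the right half-plane to the upper one. Boundedness is the growth
  -- condition with exponent and constant both zero.
  have key := PhragmenLindelof.right_half_plane_of_bounded_on_real (f := fun z => g (Complex.I * z))
    (C := C) (z := -Complex.I * ζ) hdc
    ⟨0, two_pos, 0, by simpa using (Asymptotics.isBigO_one_iff ℝ).1 hO⟩ hb
    (fun x => by
      have : Complex.I * ((x : ℂ) * Complex.I) = ((-x : ℝ) : ℂ) := by
        push_cast
        linear_combination (x : ℂ) * Complex.I_mul_I
      simpa only [this] using hreal (-x))
    (by simpa using hζ)
  have e : Complex.I * (-Complex.I * ζ) = ζ := by linear_combination -ζ * Complex.I_mul_I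
  simpa only [e] using key

/-- A version allowing a simple pole on the boundary. -/
theorem norm_le_of_norm_le_on_real_of_ne_zero {f : ℂ → ℂ} {C : ℝ}
    (hc : ContinuousOn f ({ζ | 0 ≤ ζ.im} \ {0})) (hd : DifferentiableOn ℂ f {ζ | 0 < ζ.im})
    (hreal : ∀ ξ : ℝ, ξ ≠ 0 → ‖f ξ‖ ≤ C)
    (hinf : f =O[Bornology.cobounded ℂ ⊓ 𝓟 {ζ : ℂ | 0 ≤ ζ.im}] fun _ => (1 : ℝ))
    (h0 : (fun ζ => ζ * f ζ) =O[𝓝[{ζ : ℂ | 0 ≤ ζ.im}] 0] fun _ => (1 : ℝ))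
    {ζ : ℂ} (hζ : 0 ≤ ζ.im) (hζ0 : ζ ≠ 0) : ‖f ζ‖ ≤ C := by
  have hC : 0 ≤ C := (norm_nonneg _).trans (hreal 1 one_ne_zero)
  -- The factor `(ζ/(ζ + iδ))²` has modulus at most one and tends to one as `δ → 0`. One power of
  -- `ζ` makes the product bounded at the origin, the second makes it continuous there with value
  -- zero.
  have key : ∀ δ : ℝ, 0 < δ → ‖f ζ * (ζ / (ζ + Complex.I * δ)) ^ 2‖ ≤ C := by
    intro δ hδ
    have hfac : ∀ z : ℂ, 0 ≤ z.im → ‖z / (z + Complex.I * δ)‖ ≤ 1 := fun z hz => by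
      rw [norm_div]
      exact div_le_one_of_le₀ (norm_le_norm_add_I_mul hz hδ.le) (norm_nonneg _)
    have hle : ∀ z : ℂ, 0 ≤ z.im → ‖f z * (z / (z + Complex.I * δ)) ^ 2‖ ≤ ‖f z‖ := fun z hz => by
      rw [norm_mul, norm_pow]
      exact mul_le_of_le_one_right (norm_nonneg _) (pow_le_one₀ (norm_nonneg _) (hfac z hz))
    have hfd : ∀ z : ℂ, 0 ≤ z.im →
        DifferentiableAt ℂ (fun z : ℂ => (z / (z + Complex.I * δ)) ^ 2) z := fun z hz => by
      have := add_I_mul_ne_zero hz hδ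
      fun_prop (disch := exact this)
    refine norm_le_of_norm_le_on_real (g := fun z => f z * (z / (z + Complex.I * δ)) ^ 2) (C := C)
      ?_ ?_ ?_ ?_ hζ
    · intro z hz
      by_cases hz0 : z = 0
      · subst hz0
        have hzero : Tendsto (fun z : ℂ => z / (z + Complex.I * δ) ^ 2)
            (𝓝[{ζ : ℂ | 0 ≤ ζ.im}] 0) (𝓝 0) := by
          have h2 : ((0 : ℂ) + Complex.I * δ) ^ 2 ≠ 0 :=
            pow_ne_zero 2 (add_I_mul_ne_zero (by simp) hδ)
          have h3 : ContinuousAt (fun z : ℂ => z / (z + Complex.I * δ) ^ 2) 0 := by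
            fun_prop (disch := exact h2)
          have := h3.tendsto
          rw [zero_div] at this
          exact this.mono_left nhdsWithin_le_nhds
        have h1 : Tendsto (fun z : ℂ => (z * f z) * (z / (z + Complex.I * δ) ^ 2))
            (𝓝[{ζ : ℂ | 0 ≤ ζ.im}] 0) (𝓝 0) := by
          have := h0.mul_isLittleO ((Asymptotics.isLittleO_one_iff ℝ).2 hzero)
          rw [mul_one] at this
          exact (Asymptotics.isLittleO_one_iff ℝ).1 this
        show Tendsto _ _ _
        simp only [zero_div, ne_eq, OfNat.ofNat_ne_zero, not_false_eq_true, zero_pow, mul_zero]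
        refine h1.congr fun z => ?_
        rw [div_pow]
        ring
      · have : ContinuousWithinAt f ({ζ | 0 ≤ ζ.im} \ {0}) z := hc z ⟨hz, hz0⟩
        rw [sdiff_eq, continuousWithinAt_inter (isOpen_compl_singleton.mem_nhds hz0)] at this
        exact this.mul (hfd z hz).continuousAt.continuousWithinAt
    · exact hd.mul fun z hz => (hfd z (le_of_lt hz)).differentiableWithinAt
    · intro ξ
      by_cases hξ : ξ = 0
      · simpa [hξ] using hC
      · exact (hle ξ (by simp)).trans (hreal ξ hξ)
    · refine Asymptotics.IsBigO.trans (Asymptotics.IsBigO.of_bound 1 ?_) hinf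
      filter_upwards [mem_inf_of_right (mem_principal_self _)] with z hz
      rw [one_mul]
      exact hle z hz
  have hlim : Tendsto (fun δ : ℝ => ‖f ζ * (ζ / (ζ + Complex.I * δ)) ^ 2‖) (𝓝[>] 0)
      (𝓝 ‖f ζ‖) := by
    have h1 : ContinuousAt (fun δ : ℝ => ‖f ζ * (ζ / (ζ + Complex.I * δ)) ^ 2‖) 0 := by
      refine (continuousAt_const.mul ((continuousAt_const.div ?_ ?_).pow 2)).norm
      · exact (continuous_const.add (continuous_const.mul Complex.continuous_ofReal)).continuousAt
      · simpa using hζ0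
    have := h1.tendsto
    simp only [Complex.ofReal_zero, mul_zero, add_zero, div_self hζ0, one_pow, mul_one] at this
    exact this.mono_left nhdsWithin_le_nhds
  exact le_of_tendsto hlim (by filter_upwards [self_mem_nhdsWithin] with δ hδ using key δ hδ)

theorem tendsto_I_mul_cobounded : Tendsto (fun t : ℝ => Complex.I * (t : ℂ)) atTop
    (Bornology.cobounded ℂ ⊓ 𝓟 {ζ : ℂ | 0 ≤ ζ.im}) := by
  refine tendsto_inf.2 ⟨?_, tendsto_principal.2 ?_⟩
  · rw [← tendsto_norm_atTop_iff_cobounded]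
    simpa using tendsto_abs_atTop_atTop
  · filter_upwards [eventually_ge_atTop 0] with x hx
    simpa using hx

/-- A zero-free function whose boundary values have constant modulus is constant. -/
theorem eq_of_norm_eq_on_real {f : ℂ → ℂ} {l : ℂ} (hl : l ≠ 0)
    (hc : ContinuousOn f ({ζ | 0 ≤ ζ.im} \ {0})) (hd : DifferentiableOn ℂ f {ζ | 0 < ζ.im})
    (hne : ∀ ζ : ℂ, 0 ≤ ζ.im → ζ ≠ 0 → f ζ ≠ 0)
    (hreal : ∀ ξ : ℝ, ξ ≠ 0 → ‖f ξ‖ = ‖l‖)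
    (hinf : Tendsto f (Bornology.cobounded ℂ ⊓ 𝓟 {ζ : ℂ | 0 ≤ ζ.im}) (𝓝 l))
    (h0 : (fun ζ => ζ * f ζ) =O[𝓝[{ζ : ℂ | 0 ≤ ζ.im}] 0] fun _ => (1 : ℝ))
    (h0' : (fun ζ => ζ * (f ζ)⁻¹) =O[𝓝[{ζ : ℂ | 0 ≤ ζ.im}] 0] fun _ => (1 : ℝ))
    {ζ : ℂ} (hζ : 0 ≤ ζ.im) (hζ0 : ζ ≠ 0) : f ζ = l := by
  have hpos : ∀ z : ℂ, 0 < z.im → z ≠ 0 := fun z hz h => by simp [h] at hz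
  -- The bound applied to `f` and to `1/f` gives `|f| = |l|`; the maximum principle then makes `f`
  -- constant, and the limit along the imaginary axis identifies the constant.
  have hnorm : ∀ z : ℂ, 0 < z.im → ‖f z‖ = ‖l‖ := by
    intro z hz
    refine le_antisymm ?_ ?_
    · exact norm_le_of_norm_le_on_real_of_ne_zero hc hd (fun ξ hξ => (hreal ξ hξ).le)
        (hinf.isBigO_one ℝ) h0 hz.le (hpos z hz)
    · have := norm_le_of_norm_le_on_real_of_ne_zero (f := fun ζ => (f ζ)⁻¹) (C := ‖l‖⁻¹)
        (hc.inv₀ fun z hz => hne z hz.1 hz.2)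
        (hd.inv fun z hz => hne z (le_of_lt hz) (hpos z hz))
        (fun ξ hξ => by rw [norm_inv, hreal ξ hξ]) ((hinf.inv₀ hl).isBigO_one ℝ) h0' hz.le
        (hpos z hz)
      rw [norm_inv] at this
      exact (inv_le_inv₀ (norm_pos_iff.2 (hne z hz.le (hpos z hz))) (norm_pos_iff.2 hl)).1 this
  have hI : Complex.I ∈ {ζ : ℂ | 0 < ζ.im} := by simp
  have hconst : EqOn f (Function.const ℂ (f Complex.I)) {ζ | 0 < ζ.im} :=
    Complex.eqOn_of_isPreconnected_of_isMaxOn_norm (convex_halfSpace_im_gt 0).isPreconnected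
      isOpen_im_pos hd hI (fun z hz => by
        show ‖f z‖ ≤ ‖f Complex.I‖
        rw [hnorm z hz, hnorm _ hI])
  have hIl : f Complex.I = l := by
    refine tendsto_nhds_unique (tendsto_const_nhds.congr' ?_)
      (hinf.comp tendsto_I_mul_cobounded)
    filter_upwards [eventually_gt_atTop 0] with t ht
    exact (hconst (show (Complex.I * (t : ℂ)) ∈ _ by simpa using ht)).symm
  have hsub : {ζ : ℂ | 0 ≤ ζ.im} \ {0} ⊆ closure {ζ | 0 < ζ.im} := by
    rw [closure_im_pos]; exact sdiff_subset
  have := EqOn.of_subset_closure (g := fun _ => l) (fun z hz => (hconst hz).trans hIl) hc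
    continuousOn_const (fun z (hz : 0 < z.im) => ⟨hz.le, hpos z hz⟩) hsub
  exact this ⟨hζ, hζ0⟩

/-- Zeros are divided out one at a time with `dslope`; they are distinct, so the remaining quotient
still vanishes at the next one. -/
theorem exists_eq_prod_mul {W : ℂ → ℂ} (hc : ContinuousOn W {ζ | 0 ≤ ζ.im})
    (hd : DifferentiableOn ℂ W {ζ | 0 < ζ.im}) (S : Finset ℝ)
    (hS : ∀ η ∈ S, 0 < η ∧ W (Complex.I * η) = 0) :
    ∃ H : ℂ → ℂ, ContinuousOn H {ζ | 0 ≤ ζ.im} ∧ DifferentiableOn ℂ H {ζ | 0 < ζ.im} ∧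
      ∀ ζ, W ζ = (∏ η ∈ S, (ζ - Complex.I * (η : ℂ))) * H ζ := by
  induction S using Finset.induction_on with
  | empty => exact ⟨W, hc, hd, fun ζ => by simp⟩
  | insert a S ha ih =>
    obtain ⟨H, hHc, hHd, hH⟩ := ih fun η hη => hS η (Finset.mem_insert_of_mem hη)
    obtain ⟨ha0, haW⟩ := hS a (Finset.mem_insert_self a S)
    have hmem : {ζ : ℂ | 0 < ζ.im} ∈ 𝓝 (Complex.I * (a : ℂ)) :=
      isOpen_im_pos.mem_nhds (by simpa using ha0)
    have hmem' : {ζ : ℂ | 0 ≤ ζ.im} ∈ 𝓝 (Complex.I * (a : ℂ)) :=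
      mem_of_superset hmem fun z (hz : 0 < z.im) => hz.le
    have hHa : H (Complex.I * a) = 0 := by
      rw [hH, mul_eq_zero] at haW
      refine haW.resolve_left (Finset.prod_ne_zero_iff.2 fun η hη h => ha ?_)
      have : a = η := by
        have := sub_eq_zero.1 h
        simpa using this
      rwa [this]
    refine ⟨dslope H (Complex.I * a), ?_, ?_, fun ζ => ?_⟩
    · exact (continuousOn_dslope hmem').2 ⟨hHc, hHd.differentiableAt hmem⟩
    · exact (Complex.differentiableOn_dslope hmem).2 hHd
    · have := sub_smul_dslope H (Complex.I * a) ζ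
      rw [hHa, sub_zero, smul_eq_mul] at this
      rw [Finset.prod_insert ha, hH ζ, ← this]
      ring

theorem tendsto_add_div_sub_I_mul (η : ℝ) :
    Tendsto (fun ζ : ℂ => (ζ + Complex.I * η) / (ζ - Complex.I * η)) (Bornology.cobounded ℂ)
      (𝓝 1) := by
  have h1 : Tendsto (fun ζ : ℂ => ζ - Complex.I * η) (Bornology.cobounded ℂ)
      (Bornology.cobounded ℂ) := by
    simpa only [sub_eq_add_neg] using tendsto_add_const_cobounded (-(Complex.I * (η : ℂ)))
  have h2 : Tendsto (fun ζ : ℂ => 1 + 2 * Complex.I * η * (ζ - Complex.I * η)⁻¹)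
      (Bornology.cobounded ℂ) (𝓝 1) := by
    simpa using ((tendsto_inv₀_cobounded.comp h1).const_mul (2 * Complex.I * (η : ℂ))).const_add 1
  refine h2.congr' ?_
  filter_upwards [Bornology.eventually_ne_cobounded (Complex.I * (η : ℂ))] with ζ hζ
  have hζ : ζ - Complex.I * η ≠ 0 := sub_ne_zero.2 hζ
  field_simp
  ring

/-- Recovery of a function on the upper half-plane from its zeros and its modulus on the real
line. -/
theorem eq_blaschke {W : ℂ → ℂ} {l : ℂ} {S : Finset ℝ} (hl : l ≠ 0)
    (hc : ContinuousOn W {ζ | 0 ≤ ζ.im}) (hd : DifferentiableOn ℂ W {ζ | 0 < ζ.im})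
    (hS : ∀ η ∈ S, 0 < η ∧ W (Complex.I * η) = 0)
    (hzero : ∀ ζ : ℂ, 0 < ζ.im → W ζ = 0 → ∃ η ∈ S, ζ = Complex.I * (η : ℂ))
    (hsimple : ∀ η ∈ S, ∃ c : ℝ, 0 < c ∧ ∀ ε : ℝ, 0 < ε → c * ε ≤ ‖W (Complex.I * η + ε)‖)
    (hlow : ∃ c > 0, ∃ δ > 0, ∀ ζ : ℂ, 0 < ζ.im → ‖ζ‖ < δ → c * ‖ζ‖ ≤ ‖W ζ‖)
    (hinf : Tendsto (fun ζ => W ζ / (2 * Complex.I * ζ))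
      (Bornology.cobounded ℂ ⊓ 𝓟 {ζ : ℂ | 0 ≤ ζ.im}) (𝓝 l))
    (hreal : ∀ ξ : ℝ, ξ ≠ 0 → ‖W ξ / (2 * Complex.I * ξ)‖ = ‖l‖)
    {ζ : ℂ} (hζ : 0 ≤ ζ.im) (hζ0 : ζ ≠ 0) :
    W ζ / (2 * Complex.I * ζ) =
      l * ∏ η ∈ S, (ζ - Complex.I * (η : ℂ)) / (ζ + Complex.I * (η : ℂ)) := by
  obtain ⟨H, hHc, hHd, hH⟩ := exists_eq_prod_mul hc hd S hS
  set P : ℂ → ℂ := fun ζ => ∏ η ∈ S, (ζ - Complex.I * (η : ℂ))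
  set Q : ℂ → ℂ := fun ζ => ∏ η ∈ S, (ζ + Complex.I * (η : ℂ))
  have hQ0 : ∀ z : ℂ, 0 ≤ z.im → Q z ≠ 0 := fun z hz =>
    Finset.prod_ne_zero_iff.2 fun η hη => add_I_mul_ne_zero hz (hS η hη).1
  have hPQ : ∀ z : ℂ, 0 ≤ z.im → ‖P z‖ ≤ ‖Q z‖ := fun z hz => by
    simp only [P, Q, norm_prod]
    exact Finset.prod_le_prod (fun _ _ => norm_nonneg _)
      fun η hη => norm_sub_le_norm_add_I_mul hz (hS η hη).1.le
  have hPQ' : ∀ ξ : ℝ, ‖P ξ‖ = ‖Q ξ‖ := fun ξ => by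
    simp only [P, Q, norm_prod, norm_sub_eq_norm_add_I_mul]
  have hQdiff : Differentiable ℂ Q := by fun_prop
  have hpos : ∀ z : ℂ, 0 < z.im → z ≠ 0 := fun z hz h => by simp [h] at hz
  have h2I : ∀ z : ℂ, z ≠ 0 → 2 * Complex.I * z ≠ 0 := fun z hz =>
    mul_ne_zero (mul_ne_zero two_ne_zero Complex.I_ne_zero) hz
  -- On the real axis `W` cannot vanish because its modulus is prescribed. At a zero `iη`, a further
  -- zero of `H` would make `W` vanish to second order, contradicting the linear lower bound along
  -- `iη + ε`.
  have hHne : ∀ z : ℂ, 0 ≤ z.im → z ≠ 0 → H z ≠ 0 := by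
    intro z hz hz0 hHz
    have hWz : W z = 0 := by rw [hH, hHz, mul_zero]
    rcases hz.eq_or_lt with h0 | hz
    · have e : z = ((z.re : ℝ) : ℂ) := by apply Complex.ext <;> simp [← h0]
      have hr : z.re ≠ 0 := fun h => hz0 (by rw [e, h]; simp)
      have := hreal z.re hr
      rw [← e, hWz, zero_div, norm_zero] at this
      exact hl (norm_eq_zero.1 this.symm)
    · obtain ⟨η, hη, rfl⟩ := hzero z hz hWz
      obtain ⟨c, hc0, hcε⟩ := hsimple η hη
      set G : ℂ → ℂ := fun z => (∏ a ∈ S.erase η, (z - Complex.I * (a : ℂ))) * H z with hG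
      have hGc : ContinuousAt G (Complex.I * η) := by
        refine ContinuousAt.mul (Continuous.continuousAt (by fun_prop)) ?_
        exact (hHd.differentiableAt (isOpen_im_pos.mem_nhds hz)).continuousAt
      have hG0 : G (Complex.I * η) = 0 := by simp only [hG, hHz, mul_zero]
      have hWG : ∀ z, W z = (z - Complex.I * η) * G z := fun z => by
        rw [hH z]
        simp only [hG]
        rw [← Finset.mul_prod_erase S _ hη, mul_assoc]
      have ht : Tendsto (fun ε : ℝ => ‖G (Complex.I * η + ε)‖) (𝓝[>] 0) (𝓝 0) := by
        have h1 : ContinuousAt (fun ε : ℝ => ‖G (Complex.I * η + ε)‖) 0 := by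
          have h2 : ContinuousAt (fun ε : ℝ => Complex.I * η + (ε : ℂ)) 0 :=
            (continuous_const.add Complex.continuous_ofReal).continuousAt
          exact (ContinuousAt.comp_of_eq hGc h2 (by simp)).norm
        have := h1.tendsto
        simp only [Complex.ofReal_zero, add_zero, hG0, norm_zero] at this
        exact this.mono_left nhdsWithin_le_nhds
      have hge : c ≤ 0 := by
        refine ge_of_tendsto ht ?_
        filter_upwards [self_mem_nhdsWithin] with ε hε
        have hε : 0 < ε := hε
        have := hcε ε hε
        rw [hWG, norm_mul, add_sub_cancel_left, Complex.norm_real, Real.norm_of_nonneg hε.le,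
          mul_comm] at this
        exact le_of_mul_le_mul_left this hε
      linarith
  -- This extends `W/(2iζ)` divided by the Blaschke product `P/Q` across the zeros of `P`. Its
  -- modulus on the real axis is unchanged since `|P| = |Q|` there.
  set f : ℂ → ℂ := fun z => H z * Q z / (2 * Complex.I * z) with hf
  have hWf : ∀ z : ℂ, 0 ≤ z.im → ‖W z‖ / (2 * ‖z‖) ≤ ‖f z‖ := by
    intro z hz
    simp only [hf, norm_div, norm_mul, Complex.norm_I, mul_one, Complex.norm_ofNat]
    rw [hH, norm_mul, mul_comm]
    gcongr
    exact hPQ z hz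
  have hfreal : ∀ ξ : ℝ, ξ ≠ 0 → ‖f ξ‖ = ‖l‖ := by
    intro ξ hξ
    rw [← hreal ξ hξ, hH]
    change ‖H ξ * Q ξ / _‖ = ‖P ξ * H ξ / _‖
    rw [norm_div, norm_div, norm_mul (H ξ), norm_mul (P ξ), hPQ', mul_comm ‖H ξ‖]
  have hfc : ContinuousOn f ({ζ | 0 ≤ ζ.im} \ {0}) :=
    ((hHc.mono sdiff_subset).mul hQdiff.continuous.continuousOn).div
      (continuous_const.mul continuous_id).continuousOn fun z hz => h2I z hz.2
  have hfd : DifferentiableOn ℂ f {ζ | 0 < ζ.im} :=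
    (hHd.mul hQdiff.differentiableOn).div
      (differentiable_id.const_mul (2 * Complex.I)).differentiableOn fun z hz => h2I z (hpos z hz)
  have hfinf : Tendsto f (Bornology.cobounded ℂ ⊓ 𝓟 {ζ : ℂ | 0 ≤ ζ.im}) (𝓝 l) := by
    have h1 : Tendsto (fun z : ℂ => ∏ η ∈ S, (z + Complex.I * η) / (z - Complex.I * η))
        (Bornology.cobounded ℂ) (𝓝 (∏ η ∈ S, 1)) :=
      tendsto_finsetProd S fun η _ => tendsto_add_div_sub_I_mul η
    rw [Finset.prod_const_one] at h1
    have h2 := hinf.mul (h1.mono_left inf_le_left)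
    rw [mul_one] at h2
    refine h2.congr' ?_
    have h3 : ∀ᶠ z in Bornology.cobounded ℂ, ∀ η ∈ S, z ≠ Complex.I * (η : ℂ) :=
      (Finset.eventually_all S).2 fun η _ => Bornology.eventually_ne_cobounded _
    filter_upwards [h3.filter_mono inf_le_left] with z hz
    have hP : P z ≠ 0 := Finset.prod_ne_zero_iff.2 fun η hη => sub_ne_zero.2 (hz η hη)
    rw [Finset.prod_div_distrib, hH]
    change P z * H z / _ * (Q z / P z) = H z * Q z / _
    field_simp
  have hf0 : (fun z => z * f z) =O[𝓝[{ζ : ℂ | 0 ≤ ζ.im}] 0] fun _ => (1 : ℝ) := by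
    have h1 : ContinuousWithinAt (fun z => H z * Q z / (2 * Complex.I)) {ζ : ℂ | 0 ≤ ζ.im} 0 :=
      ((hHc 0 (by simp)).mul hQdiff.continuous.continuousWithinAt).div_const _
    refine Asymptotics.IsBigO.trans (Asymptotics.IsBigO.of_bound 1 ?_) (h1.tendsto.isBigO_one ℝ)
    refine Eventually.of_forall fun z => ?_
    rw [one_mul]
    by_cases hz : z = 0
    · rw [hz, zero_mul, norm_zero]; exact norm_nonneg _
    · refine le_of_eq (congrArg _ ?_)
      simp only [hf]
      field_simp
  -- Because `|P| ≤ |Q|`, the low energy bound on `W` keeps `1/f` bounded near `0` in the open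
  -- half-plane; on the real axis `|f| = |l|`.
  have hf0' : (fun z => z * (f z)⁻¹) =O[𝓝[{ζ : ℂ | 0 ≤ ζ.im}] 0] fun _ => (1 : ℝ) := by
    obtain ⟨c, hc0, δ, hδ, hcδ⟩ := hlow
    have hl0 : 0 < ‖l‖ := norm_pos_iff.2 hl
    refine Asymptotics.IsBigO.of_bound (2 / c + 1 / ‖l‖) ?_
    filter_upwards [self_mem_nhdsWithin,
      mem_nhdsWithin_of_mem_nhds (Metric.ball_mem_nhds (0 : ℂ) (lt_min hδ one_pos))] with z hz hzb
    rw [mem_ball_zero_iff, lt_min_iff] at hzb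
    rw [norm_one, mul_one, norm_mul, norm_inv]
    have hz : 0 ≤ z.im := hz
    have hb : 0 < 2 / c ∧ 0 < 1 / ‖l‖ := ⟨by positivity, by positivity⟩
    by_cases hz0 : z = 0
    · rw [hz0, norm_zero, zero_mul]; linarith
    have hzp : 0 < ‖z‖ := norm_pos_iff.2 hz0
    have hinv : ‖f z‖⁻¹ ≤ 2 / c + 1 / ‖l‖ := by
      rcases hz.eq_or_lt with h0 | hz
      · have e : z = ((z.re : ℝ) : ℂ) := by apply Complex.ext <;> simp [← h0]
        have hr : z.re ≠ 0 := fun h => hz0 (by rw [e, h]; simp)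
        rw [e, hfreal _ hr, ← one_div]
        linarith
      · have h1 : c / 2 ≤ ‖f z‖ := by
          refine le_trans ?_ (hWf z hz.le)
          rw [le_div_iff₀ (by positivity)]
          have := hcδ z hz hzb.1
          linarith
        have h2 : ‖f z‖⁻¹ ≤ (c / 2)⁻¹ := inv_anti₀ (by positivity) h1
        rw [inv_div] at h2
        linarith
    calc ‖z‖ * ‖f z‖⁻¹ ≤ 1 * (2 / c + 1 / ‖l‖) := by
          gcongr
          exact hzb.2.le
      _ = _ := one_mul _
  have key := eq_of_norm_eq_on_real hl hfc hfd
    (fun z hz hz0 => div_ne_zero (mul_ne_zero (hHne z hz hz0) (hQ0 z hz)) (h2I z hz0))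
    hfreal hfinf hf0 hf0' hζ hζ0
  have hQζ := hQ0 ζ hζ
  rw [← key, Finset.prod_div_distrib, hH]
  change P ζ * H ζ / _ = H ζ * Q ζ / _ * (P ζ / Q ζ)
  field_simp

end HalfPlane

/-! ### Recovery of `A` from its modulus on the real line -/

section Recovery

variable {q : ℝ → ℝ} {M : Matrix (Fin 2) (Fin 2) ℝ}

/-- The estimate `exists_le_norm_jostW` is used twice: it places the zeros on the imaginary axis,
and along `iη + ε` with `ε` real it shows that they are simple. -/
theorem coeffA_eq_blaschke (hq : FirstMoment q) (hM : M.det = 1) (h01 : M 0 1 = 0)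
    {S : Finset ℝ} (hS : ∀ η : ℝ, η ∈ S ↔ 0 < η ∧ jostW q M (Complex.I * η) = 0)
    (hA : ∀ ξ : ℝ, ξ ≠ 0 → ‖coeffA q M ξ‖ = |(M 0 0 + M 1 1) / 2|)
    {ζ : ℂ} (hζ : 0 ≤ ζ.im) (hζ0 : ζ ≠ 0) :
    coeffA q M ζ = (((M 0 0 + M 1 1) / 2 : ℝ) : ℂ) *
      ∏ η ∈ S, (ζ - Complex.I * (η : ℂ)) / (ζ + Complex.I * (η : ℂ)) := by
  have hdet : M 0 0 * M 1 1 = 1 := by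
    rwa [Matrix.det_fin_two, h01, zero_mul, sub_zero] at hM
  have hl : (((M 0 0 + M 1 1) / 2 : ℝ) : ℂ) ≠ 0 := by
    rw [Complex.ofReal_ne_zero]
    intro h
    have h11 : M 1 1 = -M 0 0 := by linarith
    rw [h11] at hdet
    nlinarith [sq_nonneg (M 0 0)]
  obtain ⟨X, -, hX⟩ := exists_le_norm_jostW hq hM
  rw [coeffA_eq hq hM hζ hζ0]
  refine eq_blaschke hl (continuousOn_jostW hq) (differentiableOn_jostW hq)
    (fun η hη => (hS η).1 hη) (fun z hz hW => ?_) (fun η hη => ?_)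
    (exists_low_energy_bound hq hM) (tendsto_jostW_div hq h01) (fun ξ hξ => ?_) hζ hζ0
  · have e : z = Complex.I * (z.im : ℂ) := by
      apply Complex.ext <;> simp [re_eq_zero_of_jostW hq hM hz hW]
    exact ⟨z.im, (hS _).2 ⟨hz, by rwa [← e]⟩, e⟩
  · have hη0 := ((hS η).1 hη).1
    refine ⟨Real.exp (-(η * X)) / 2, by positivity, fun ε hε => ?_⟩
    have := hX (Complex.I * η + ε) (by simpa using hη0)
    simp only [Complex.add_re, Complex.mul_re, Complex.I_re, Complex.ofReal_re, zero_mul,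
      Complex.I_im, Complex.ofReal_im, mul_zero, sub_self, zero_add, Complex.add_im,
      Complex.mul_im, one_mul, add_zero, abs_of_pos hε] at this
    linarith
  · rw [← coeffA_eq hq hM (by simp) (by exact_mod_cast hξ), hA ξ hξ, Complex.norm_real,
      Real.norm_eq_abs]

theorem coeffA_ne_zero (hq : FirstMoment q) (hM : M.det = 1) {ξ : ℝ} (hξ : ξ ≠ 0) :
    coeffA q M ξ ≠ 0 := by
  intro h
  have := norm_coeffA_sq hq hM hξ
  rw [h, norm_zero] at this
  nlinarith [sq_nonneg ‖coeffB q M ξ‖]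

theorem tendsto_coeffA (hq : FirstMoment q) (hM : M.det = 1) (h01 : M 0 1 = 0) :
    Tendsto (fun ξ : ℝ => coeffA q M ξ) atTop (𝓝 (((M 0 0 + M 1 1) / 2 : ℝ) : ℂ)) := by
  refine ((tendsto_jostW_div hq h01).comp tendsto_ofReal_cobounded).congr' ?_
  filter_upwards [eventually_ne_atTop 0] with ξ hξ
  exact (coeffA_eq hq hM (by simp) (Complex.ofReal_ne_zero.2 hξ)).symm

theorem matrix_of_reflectionless (hq : FirstMoment q) (hM : M.det = 1)
    (hR : ∀ ξ : ℝ, ξ ≠ 0 → reflection q M ξ = 0) :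
    M 0 1 = 0 ∧ M 0 0 = M 1 1 ∧ ∀ ξ : ℝ, ξ ≠ 0 → ‖coeffA q M ξ‖ = 1 := by
  have hB : ∀ ξ : ℝ, ξ ≠ 0 → coeffB q M ξ = 0 := fun ξ hξ =>
    (div_eq_zero_iff.1 (hR ξ hξ)).resolve_right (coeffA_ne_zero hq hM hξ)
  have hA : ∀ ξ : ℝ, ξ ≠ 0 → ‖coeffA q M ξ‖ = 1 := fun ξ hξ => by
    have := norm_coeffA_sq hq hM hξ
    rw [hB ξ hξ, norm_zero] at this
    exact (sq_eq_sq₀ (norm_nonneg _) zero_le_one).1 (by rw [this]; norm_num)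
  -- From `|A(ξ)| = 1` one has `|W(ξ)|/ξ² = 2/ξ → 0`, whereas `W(ξ)/ξ²` tends to `m₁₂`.
  have h01 : M 0 1 = 0 := by
    have h1 := ((tendsto_jostW_div_sq (M := M) hq).comp tendsto_ofReal_cobounded).norm
    have h2 : Tendsto (fun ξ : ℝ => 2 * ξ⁻¹) atTop (𝓝 0) := by
      simpa using tendsto_inv_atTop_zero.const_mul (2 : ℝ)
    have h3 := tendsto_nhds_unique (h2.congr' ?_) h1
    · simpa using h3.symm
    filter_upwards [eventually_gt_atTop 0] with ξ hξ
    have h4 := hA ξ hξ.ne'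
    rw [coeffA_eq hq hM (by simp) (by exact_mod_cast hξ.ne'), norm_div] at h4
    simp only [norm_mul, Complex.norm_ofNat, Complex.norm_I, mul_one, Complex.norm_real,
      Real.norm_of_nonneg hξ.le] at h4
    simp only [Function.comp_apply, norm_div, norm_pow, Complex.norm_real,
      Real.norm_of_nonneg hξ.le]
    field_simp at h4 ⊢
    linarith
  refine ⟨h01, ?_, hA⟩
  have h5 : coeffB q M =ᶠ[atTop] fun _ => 0 := by
    filter_upwards [eventually_ne_atTop 0] with ξ hξ using hB ξ hξ
  have h6 := Complex.ofReal_eq_zero.1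
    (tendsto_nhds_unique ((tendsto_coeffB hq hM h01).congr' h5) tendsto_const_nhds)
  linarith

end Recovery

end PointTransfer

/-! ### Eigenvalues, the transfer matrix and `A` together -/

theorem corollary3p3 (q : ℝ → ℝ) (M : Matrix (Fin 2) (Fin 2) ℝ)
    (hq2 : MemLp q 2 volume)
    (hq1 : Integrable (fun x : ℝ => (1 + |x|) * |q x|) volume)
    (hM : M.det = 1) :
    ∃ (N : ℕ) (η : Fin N → ℝ),
      -- the eigenvalues of the operator are exactly `-η_j²`, with `0 < η_1 < ... < η_N`
      (∀ j, 0 < η j) ∧ StrictMono η ∧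
      (∀ lam : ℂ, IsEigenvalueL q M lam ↔ ∃ j, lam = -((η j : ℂ) ^ 2)) ∧
      -- the reflectionless case
      ((∀ ξ : ℝ, ξ ≠ 0 → reflection q M ξ = 0) →
        ∃ s : ℝ, (s = 1 ∨ s = -1) ∧ M = !![s, 0; M 1 0, s] ∧
          ∀ ζ : ℂ, 0 ≤ ζ.im → ζ ≠ 0 →
            coeffA q M ζ =
              (s : ℂ) * ∏ j, (ζ - Complex.I * (η j : ℂ)) / (ζ + Complex.I * (η j : ℂ))) ∧
      -- the case of a reflection coefficient of constant modulus, with `m₁₂ = 0`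
      (M 0 1 = 0 →
        ∃ C₂ : ℝ, |C₂| < 1 ∧ Tendsto (reflection q M) atTop (𝓝 ((-C₂ : ℝ) : ℂ)) ∧
          ((∀ ξ : ℝ, ξ ≠ 0 → ‖reflection q M ξ‖ = |C₂|) →
            ∃ s : ℝ, (s = 1 ∨ s = -1) ∧
              M 1 1 = s * √((1 + C₂) / (1 - C₂)) ∧
              M 0 0 = s * √((1 - C₂) / (1 + C₂)) ∧
              ∀ ζ : ℂ, 0 ≤ ζ.im → ζ ≠ 0 →
                coeffA q M ζ =
                  (s : ℂ) * ((1 / √(1 - C₂ ^ 2) : ℝ) : ℂ) *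
                    ∏ j, (ζ - Complex.I * (η j : ℂ)) / (ζ + Complex.I * (η j : ℂ)))) := by
  have hq : FirstMoment q := ⟨hq2.1, hq1⟩
  set S : Finset ℝ := (finite_zeros_jostW hq hM).toFinset with hSdef
  -- The `η_j` are the zeros of `W` on the positive imaginary axis, listed increasingly.
  have hS : ∀ η : ℝ, η ∈ S ↔ 0 < η ∧ jostW q M (Complex.I * η) = 0 := fun η => by simp [hSdef]
  set η : Fin S.card → ℝ := fun j => S.orderEmbOfFin rfl j
  have hηS : ∀ j, η j ∈ S := fun j => S.orderEmbOfFin_mem rfl j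
  have hηsurj : ∀ a ∈ S, ∃ j, η j = a := fun a ha => by
    have : a ∈ Set.range (S.orderEmbOfFin rfl) := by rwa [Finset.range_orderEmbOfFin]
    exact this
  have hmono : StrictMono η := (S.orderEmbOfFin rfl).strictMono
  have hprod : ∀ g : ℝ → ℂ, ∏ a ∈ S, g a = ∏ j, g (η j) := fun g => by
    have himg : S = Finset.univ.map ⟨η, hmono.injective⟩ := by
      ext a
      simp only [Finset.mem_map, Finset.mem_univ, true_and, Function.Embedding.coeFn_mk]
      exact ⟨hηsurj a, fun ⟨j, hj⟩ => hj ▸ hηS j⟩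
    conv_lhs => rw [himg]
    rw [Finset.prod_map]
    rfl
  refine ⟨S.card, η, fun j => ((hS _).1 (hηS j)).1, hmono, fun lam => ?_, fun hR => ?_,
    fun h01 => ?_⟩
  · rw [isEigenvalueL_iff hq hM]
    constructor
    · rintro ⟨a, ha, rfl, hW⟩
      obtain ⟨j, rfl⟩ := hηsurj a ((hS a).2 ⟨ha, hW⟩)
      exact ⟨j, rfl⟩
    · rintro ⟨j, rfl⟩
      exact ⟨η j, ((hS _).1 (hηS j)).1, rfl, ((hS _).1 (hηS j)).2⟩
  · obtain ⟨h01, h00, hA⟩ := matrix_of_reflectionless hq hM hR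
    have hs : M 1 1 = 1 ∨ M 1 1 = -1 := by
      rw [Matrix.det_fin_two, h01, h00] at hM
      exact mul_self_eq_one_iff.1 (by linarith)
    have hl : (M 0 0 + M 1 1) / 2 = M 1 1 := by rw [h00]; ring
    refine ⟨M 1 1, hs, ?_, fun ζ hζ hζ0 => ?_⟩
    · ext i j
      fin_cases i <;> fin_cases j <;> simp [h01, h00]
    · rw [coeffA_eq_blaschke hq hM h01 hS (fun ξ hξ => ?_) hζ hζ0, hl,
        hprod fun a => (ζ - Complex.I * (a : ℂ)) / (ζ + Complex.I * (a : ℂ))]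
      rw [hA ξ hξ, hl]
      rcases hs with h | h <;> rw [h] <;> norm_num
  · have hdet : M 0 0 * M 1 1 = 1 := by
      have := hM
      rwa [Matrix.det_fin_two, h01, zero_mul, sub_zero] at this
    -- Here `m = |m₂₂|` and `s` is the sign of `m₂₂`; the determinant gives `m₁₁ = s/m`.
    obtain ⟨s, m, hs, hm, h11, h00⟩ : ∃ s m : ℝ, (s = 1 ∨ s = -1) ∧ 0 < m ∧
        M 1 1 = s * m ∧ M 0 0 = s * m⁻¹ := by
      have hne : M 1 1 ≠ 0 := right_ne_zero_of_mul_eq_one hdet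
      have h00 : M 0 0 = (M 1 1)⁻¹ := eq_inv_of_mul_eq_one_left hdet
      rcases hne.lt_or_gt with h | h
      · exact ⟨-1, -M 1 1, Or.inr rfl, neg_pos.2 h, by ring, by rw [h00, inv_neg]; ring⟩
      · exact ⟨1, M 1 1, Or.inl rfl, h, by ring, by rw [h00]; ring⟩
    have hs2 : s ^ 2 = 1 := by rcases hs with h | h <;> rw [h] <;> norm_num
    have hs0 : s ≠ 0 := by rcases hs with h | h <;> rw [h] <;> norm_num
    have hm1 : 0 < m ^ 2 + 1 := by positivity
    -- This is `-(m₁₁ - m₂₂)/(m₁₁ + m₂₂)`, minus the limit of `B/A`, after substituting `m₁₁ = s/m`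
    -- and `m₂₂ = s m`.
    set C : ℝ := (m ^ 2 - 1) / (m ^ 2 + 1) with hC
    have hC1 : 1 + C = 2 * m ^ 2 / (m ^ 2 + 1) := by rw [hC]; field_simp; ring
    have hC2 : 1 - C = 2 / (m ^ 2 + 1) := by rw [hC]; field_simp; ring
    have hC1p : 0 < 1 + C := by rw [hC1]; positivity
    have hC2p : 0 < 1 - C := by rw [hC2]; positivity
    have hl : (M 0 0 + M 1 1) / 2 = s * ((m ^ 2 + 1) / (2 * m)) := by
      rw [h00, h11]; field_simp; ring
    have hsq : √(1 - C ^ 2) = 2 * m / (m ^ 2 + 1) := by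
      rw [Real.sqrt_eq_iff_mul_self_eq_of_pos (by positivity)]
      rw [show 1 - C ^ 2 = (1 + C) * (1 - C) by ring, hC1, hC2]
      field_simp
    have hl' : (M 0 0 + M 1 1) / 2 = s * (1 / √(1 - C ^ 2)) := by rw [hl, hsq, one_div_div]
    refine ⟨C, abs_lt.2 ⟨by linarith, by linarith⟩, ?_, fun hR => ⟨s, hs, ?_, ?_, ?_⟩⟩
    · have h1 := (tendsto_coeffB hq hM h01).div (tendsto_coeffA hq hM h01) (by
        rw [Complex.ofReal_ne_zero, hl]; exact mul_ne_zero hs0 (by positivity))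
      refine Tendsto.congr (fun ξ => rfl) (h1.trans (le_of_eq (congrArg 𝓝 ?_)))
      rw [← Complex.ofReal_div, hl, h00, h11, hC]
      congr 1
      field_simp
      ring
    · rw [h11, hC1, hC2, div_div_div_cancel_right₀ hm1.ne', mul_div_cancel_left₀ _ two_ne_zero,
        Real.sqrt_sq hm.le]
    · rw [h00, hC1, hC2, div_div_div_cancel_right₀ hm1.ne',
        div_mul_cancel_left₀ two_ne_zero, Real.sqrt_inv, Real.sqrt_sq hm.le]
    · intro ζ hζ hζ0
      rw [coeffA_eq_blaschke hq hM h01 hS (fun ξ hξ => ?_) hζ hζ0, hl', Complex.ofReal_mul,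
        hprod fun a => (ζ - Complex.I * (a : ℂ)) / (ζ + Complex.I * (a : ℂ))]
      have hA0 : 0 < ‖coeffA q M ξ‖ := norm_pos_iff.2 (coeffA_ne_zero hq hM hξ)
      have h1 := hR ξ hξ
      -- Putting `|B| = |C| |A|` into `|A|² = 1 + |B|²` gives `|A|² (1 - C²) = 1`, the constant
      -- modulus that `coeffA_eq_blaschke` requires.
      rw [reflection, norm_div, div_eq_iff hA0.ne'] at h1
      have h2 := norm_coeffA_sq hq hM hξ
      rw [h1, mul_pow, sq_abs] at h2
      have hCp : 0 < 1 - C ^ 2 := by nlinarith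
      rw [← sq_eq_sq₀ hA0.le (abs_nonneg _), sq_abs, hl', mul_pow, hs2, one_mul, div_pow,
        Real.sq_sqrt hCp.le, one_pow, eq_div_iff hCp.ne']
      linarith
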